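/- Let $k$ be an algebraically closed field of characteristic zero, $\mathfrak g$ a Lie algebra over $k$, and $U=U(\mathfrak g)$ its universal enveloping algebra with coproduct $\Delta$ and counit $\varepsilon$ determined by $\Delta(x)=x\otimes 1+1\otimes x$, $\varepsilon(x)=0$ for $x\in\mathfrak g$. Extend $\Delta,\varepsilon$ coefficientwise to $U[[h]]$, the (completed) tensor powers of $U[[h]]$ being $(U^{\otimes n})[[h]]$. An \emph{invariant twist} on $U[[h]]$ is an invertible $F\in (U\otimes U)[[h]]$ which commutes with $\Delta(U[[h]])$ and satisfies $$(F\otimes 1)(\Delta\otimes I)(F)=(1\otimes F)(I\otimes\Delta)(F),\qquad (\varepsilon\otimes I)(F)=(I\otimes\varepsilon)(F)=1 .$$ Invariant twists form a group $P$ under multiplication. Let $C$ be the group of invertible central elements $x$ of $U[[h]]$ with $\varepsilon(x)=1$, and let $\partial:C\to P$, $\partial(x)=(x\otimes x)\Delta(x)^{-1}$; this is a homomorphism with central image, and $F,F'\in P$ are gauge equivalent (that is, $F\Delta(a)=(a\otimes a)F'$ for some $a\in C$) if and only if they have the same image in $\pi_0=P/\partial(C)$. Let $(\Lambda^2\mathfrak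 g)^{\mathfrak g}$ be the space of $\mathfrak g$-invariant skew-symmetric tensors in $\mathfrak g\otimes\mathfrak g$. Then: (1) The group $\pi_0$ of gauge classes of invariant twists on $U[[h]]$ is isomorphic to the additive group $(\Lambda^2\mathfrak g)^{\mathfrak g}[[h]]$. More precisely, for every $X\in(\Lambda^2\mathfrak g)^{\mathfrak g}[[h]]$ the exponential $\exp(hX)\in(U\otimes U)[[h]]$ is an invariant twist, and sending $X$ to the class of $\exp(hX)$ is an isomorphism of groups $(\Lambda^2\mathfrak g)^{\mathfrak g}[[h]]\to\pi_0$. (2) The associator class in $H^3(\pi_0,\ker\partial)$ (trivial action) of the crossed module $\partial:C\to P$ is trivial. That is, for every section $\sigma:\pi_0\to P$ of the projection and every map $a:\pi_0\times\pi_0\to C$ with $\sigma(fg)=\partial(a(f,g))\,\sigma(f)\,\sigma(g)$, there is a map $c:\pi_0\times\pi_0\to\ker\partial$ such that for all $f,g,l\in\pi_0$ $$a(f,gl)\,a(g,l)\,a(f,g)^{-1}\,a(fg,l)^{-1}=c(g,l)\,c(fg,l)^{-1}\,c(f,gl)\,c(f,g)^{-1}.$$ -/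

import Mathlib

open scoped TensorProduct

noncomputable section

namespace InvTwist

section Bialgebra

/-! ### Invariant twists on `H[[h]]` for a bialgebra `H` over `k`

Elements of `H[[h]]` are power series with coefficients in `H`.  The (completed) tensor powers of
`H[[h]]` over `k[[h]]` are `(H ⊗ H)[[h]]` and `(H ⊗ H ⊗ H)[[h]]`, and the structure maps are those
of `H`, applied to the coefficients. -/

variable (k : Type*) (H : Type*) [Field k] [Ring H] [Bialgebra k H]

/-- `F ↦ F ⊗ 1`. -/
def tensorOne : H ⊗[k] H →ₐ[k] H ⊗[k] (H ⊗[k] H) :=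
  (Algebra.TensorProduct.assoc k k k H H H).toAlgHom.comp Algebra.TensorProduct.includeLeft

/-- `F ↦ 1 ⊗ F`. -/
def oneTensor : H ⊗[k] H →ₐ[k] H ⊗[k] (H ⊗[k] H) :=
  Algebra.TensorProduct.includeRight

/-- `Δ ⊗ I`. -/
def comulTensor : H ⊗[k] H →ₐ[k] H ⊗[k] (H ⊗[k] H) :=
  (Algebra.TensorProduct.assoc k k k H H H).toAlgHom.comp
    (Algebra.TensorProduct.map (Bialgebra.comulAlgHom k H) (AlgHom.id k H))

/-- `I ⊗ Δ`. -/
def tensorComul : H ⊗[k] H →ₐ[k] H ⊗[k] (H ⊗[k] H) :=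
  Algebra.TensorProduct.map (AlgHom.id k H) (Bialgebra.comulAlgHom k H)

/-- `ε ⊗ I`. -/
def counitTensor : H ⊗[k] H →ₐ[k] H :=
  (Algebra.TensorProduct.lid k H).toAlgHom.comp
    (Algebra.TensorProduct.map (Bialgebra.counitAlgHom k H) (AlgHom.id k H))

/-- `I ⊗ ε`. -/
def tensorCounit : H ⊗[k] H →ₐ[k] H :=
  (Algebra.TensorProduct.rid k k H).toAlgHom.comp
    (Algebra.TensorProduct.map (AlgHom.id k H) (Bialgebra.counitAlgHom k H))

variable {k} in
/-- The extension of an algebra homomorphism to power series in `h`, coefficient by coefficient. -/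
abbrev extendh {A B : Type*} [Ring A] [Algebra k A] [Ring B] [Algebra k B] (f : A →ₐ[k] B) :
    PowerSeries A →+* PowerSeries B :=
  PowerSeries.map (f : A →+* B)

/-- The coproduct of `H[[h]]`. -/
abbrev comulh : PowerSeries H →+* PowerSeries (H ⊗[k] H) :=
  extendh (Bialgebra.comulAlgHom k H)

/-- The counit of `H[[h]]`. -/
abbrev counith : PowerSeries H →+* PowerSeries k :=
  extendh (Bialgebra.counitAlgHom k H)

variable {H}

/-- `x ⊗ x` for `x` in `H[[h]]`. -/
def tensorSelf (x : PowerSeries H) : PowerSeries (H ⊗[k] H) :=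
  extendh (Algebra.TensorProduct.includeLeft : H →ₐ[k] H ⊗[k] H) x *
    extendh (Algebra.TensorProduct.includeRight : H →ₐ[k] H ⊗[k] H) x

/-- An invariant twist on `H[[h]]` is an invertible element `F` of `(H ⊗ H)[[h]]` which commutes
with `Δ(H[[h]])`, is a 2-cocycle and is normalised. -/
structure IsInvariantTwist (F : (PowerSeries (H ⊗[k] H))ˣ) : Prop where
  invariant : ∀ x : PowerSeries H, comulh k H x * (F : PowerSeries (H ⊗[k] H)) = F * comulh k H x
  cocycle : extendh (tensorOne k H) (F : PowerSeries (H ⊗[k] H)) * extendh (comulTensor k H) F.1 =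
    extendh (oneTensor k H) F.1 * extendh (tensorComul k H) F.1
  counit_left : extendh (counitTensor k H) F.1 = 1
  counit_right : extendh (tensorCounit k H) F.1 = 1

section Commutation

variable {k}

theorem commute_of_coeff {A : Type*} [Ring A] {p q : PowerSeries A}
    (h : ∀ i j, Commute (PowerSeries.coeff i p) (PowerSeries.coeff j q)) : Commute p q := by
  refine PowerSeries.ext fun n => ?_
  rw [PowerSeries.coeff_mul, PowerSeries.coeff_mul, ← Finset.Nat.sum_antidiagonal_swap]
  exact Finset.sum_congr rfl fun x _ => (h x.2 x.1).eq

theorem coeff_commute_comul {F : PowerSeries (H ⊗[k] H)}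
    (h : ∀ x : PowerSeries H, comulh k H x * F = F * comulh k H x) (u : H) (i : ℕ) :
    Commute (Bialgebra.comulAlgHom k H u) (PowerSeries.coeff i F) := by
  have := congrArg (PowerSeries.coeff i) (h (PowerSeries.C u))
  simpa [Commute, SemiconjBy] using this

theorem commute_comulTensor {F : PowerSeries (H ⊗[k] H)}
    (h : ∀ x : PowerSeries H, comulh k H x * F = F * comulh k H x) (G : PowerSeries (H ⊗[k] H)) :
    Commute (extendh (tensorOne k H) F) (extendh (comulTensor k H) G) := by
  refine commute_of_coeff fun i j => ?_
  have key : ∀ z : H ⊗[k] H, Commute (tensorOne k H (PowerSeries.coeff i F))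
      (comulTensor k H z) := by
    intro z
    induction z with
    | zero => simp
    | add x y hx hy => rw [map_add]; exact hx.add_right hy
    | tmul u v =>
      have h1 : Commute ((PowerSeries.coeff i F) ⊗ₜ[k] (1 : H))
          ((Bialgebra.comulAlgHom k H u) ⊗ₜ[k] v) := by
        simp only [Commute, SemiconjBy, Algebra.TensorProduct.tmul_mul_tmul, one_mul, mul_one]
        rw [(coeff_commute_comul h u i).eq]
      exact h1.map (Algebra.TensorProduct.assoc k k k H H H)
  simpa using key (PowerSeries.coeff j G)

theorem commute_tensorComul {F : PowerSeries (H ⊗[k] H)}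
    (h : ∀ x : PowerSeries H, comulh k H x * F = F * comulh k H x) (G : PowerSeries (H ⊗[k] H)) :
    Commute (extendh (oneTensor k H) F) (extendh (tensorComul k H) G) := by
  refine commute_of_coeff fun i j => ?_
  have key : ∀ z : H ⊗[k] H, Commute (oneTensor k H (PowerSeries.coeff i F))
      (tensorComul k H z) := by
    intro z
    induction z with
    | zero => simp
    | add x y hx hy => rw [map_add]; exact hx.add_right hy
    | tmul u v =>
      have h1 : Commute ((1 : H) ⊗ₜ[k] (PowerSeries.coeff i F))
          (u ⊗ₜ[k] (Bialgebra.comulAlgHom k H v)) := by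
        simp only [Commute, SemiconjBy, Algebra.TensorProduct.tmul_mul_tmul, one_mul, mul_one]
        rw [(coeff_commute_comul h v i).eq]
      exact h1
  simpa using key (PowerSeries.coeff j G)

theorem coeff_central {x : PowerSeries H} (hx : x ∈ Subring.center (PowerSeries H)) (i : ℕ)
    (u : H) : Commute u (PowerSeries.coeff i x) := by
  have := congrArg (PowerSeries.coeff i) (Subring.mem_center_iff.1 hx (PowerSeries.C u))
  simpa [Commute, SemiconjBy] using this

theorem tensorSelf_central {x : PowerSeries H} (hx : x ∈ Subring.center (PowerSeries H))
    (G : PowerSeries (H ⊗[k] H)) : Commute (tensorSelf k x) G := by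
  refine Commute.mul_left (commute_of_coeff fun i j => ?_) (commute_of_coeff fun i j => ?_)
  · simp only [PowerSeries.coeff_map]
    induction PowerSeries.coeff j G with
    | zero => simp
    | add x y hx hy => exact hx.add_right hy
    | tmul u v =>
      simp [Commute, SemiconjBy, (coeff_central hx i u).eq]
  · simp only [PowerSeries.coeff_map]
    induction PowerSeries.coeff j G with
    | zero => simp
    | add x y hx hy => exact hx.add_right hy
    | tmul u v =>
      simp [Commute, SemiconjBy, (coeff_central hx i v).eq]

end Commutation

variable (H) in
/-- The group `Aut¹_Tw(H[[h]])` of invariant twists, with multiplication as the group law. -/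
def invariantTwists : Subgroup (PowerSeries (H ⊗[k] H))ˣ where
  carrier := {F | IsInvariantTwist k F}
  one_mem' := ⟨fun x => by simp, by simp, by simp, by simp⟩
  mul_mem' := by
    intro F G hF hG
    refine ⟨fun x => ?_, ?_, ?_, ?_⟩
    · rw [Units.val_mul, ← mul_assoc, hF.invariant, mul_assoc, hG.invariant, mul_assoc]
    · have h1 := (commute_comulTensor hG.invariant F.1).eq
      have h2 := (commute_tensorComul hG.invariant F.1).eq
      simp only [Units.val_mul, map_mul]
      rw [mul_assoc (extendh (tensorOne k H) F.1), ← mul_assoc (extendh (tensorOne k H) G.1), h1,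
        mul_assoc (extendh (comulTensor k H) F.1), ← mul_assoc, hF.cocycle, hG.cocycle, mul_assoc,
        mul_assoc, ← mul_assoc (extendh (tensorComul k H) F.1), ← h2, mul_assoc]
    · rw [Units.val_mul, map_mul, hF.counit_left, hG.counit_left, one_mul]
    · rw [Units.val_mul, map_mul, hF.counit_right, hG.counit_right, one_mul]
  inv_mem' := by
    intro F hF
    have inv_one : ∀ f : PowerSeries (H ⊗[k] H) →+* PowerSeries H, f F.1 = 1 → f (F⁻¹).1 = 1 := by
      intro f hf
      have := map_mul f F.1 (F⁻¹).1
      rwa [Units.mul_inv, map_one, hf, one_mul, eq_comm] at this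
    refine ⟨fun x => ?_, ?_, inv_one _ hF.counit_left, inv_one _ hF.counit_right⟩
    · exact (show Commute _ _ from hF.invariant x).units_inv_right.eq
    · have h1 := commute_comulTensor hF.invariant F.1
      have h2 := commute_tensorComul hF.invariant F.1
      let u (f : H ⊗[k] H →ₐ[k] H ⊗[k] (H ⊗[k] H)) := Units.map (extendh f).toMonoidHom F
      have e1 : u (tensorOne k H) * u (comulTensor k H) =
          u (oneTensor k H) * u (tensorComul k H) := Units.ext hF.cocycle
      have c1 : u (tensorOne k H) * u (comulTensor k H) =
        u (comulTensor k H) * u (tensorOne k H) := Units.ext h1.eq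
      have c2 : u (oneTensor k H) * u (tensorComul k H) =
        u (tensorComul k H) * u (oneTensor k H) := Units.ext h2.eq
      have e2 : (u (tensorOne k H))⁻¹ * (u (comulTensor k H))⁻¹ =
          (u (oneTensor k H))⁻¹ * (u (tensorComul k H))⁻¹ := by
        rw [← mul_inv_rev, ← mul_inv_rev, ← c1, ← c2, e1]
      exact congrArg Units.val e2

variable (H) in
/-- The group `(Z(H[[h]])_ε)ˣ` of invertible central elements of `H[[h]]` of counit `1`. -/
def centralUnits : Subgroup (PowerSeries H)ˣ where
  carrier := {x | (x : PowerSeries H) ∈ Subring.center (PowerSeries H) ∧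
    counith k H (x : PowerSeries H) = 1}
  one_mem' := ⟨Subring.one_mem _, by simp⟩
  mul_mem' := by
    rintro x y ⟨hx, hx'⟩ ⟨hy, hy'⟩
    exact ⟨Subring.mul_mem _ hx hy, by rw [Units.val_mul, map_mul, hx', hy', one_mul]⟩
  inv_mem' := by
    rintro x ⟨hx, hx'⟩
    refine ⟨Subring.mem_center_iff.2 fun g => ?_, ?_⟩
    · exact (show Commute g x.1 from Subring.mem_center_iff.1 hx g).units_inv_right.eq
    · have := map_mul (counith k H) x.1 (x⁻¹).1
      rwa [Units.mul_inv, map_one, hx', one_mul, eq_comm] at this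

variable {k} in
/-- `x ⊗ x` as an invertible element, for an invertible central `x`. -/
def tensorSelfUnit (x : centralUnits k H) : (PowerSeries (H ⊗[k] H))ˣ :=
  Units.map (extendh (Algebra.TensorProduct.includeLeft : H →ₐ[k] H ⊗[k] H)).toMonoidHom x.1 *
    Units.map (extendh (Algebra.TensorProduct.includeRight : H →ₐ[k] H ⊗[k] H)).toMonoidHom x.1

variable {k} in
/-- `Δ(x)` as an invertible element. -/
def comulUnit (x : centralUnits k H) : (PowerSeries (H ⊗[k] H))ˣ :=
  Units.map (comulh k H).toMonoidHom x.1

variable {k} in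
theorem tensorSelfUnit_commute (x : centralUnits k H) (G : (PowerSeries (H ⊗[k] H))ˣ) :
    Commute (tensorSelfUnit x) G :=
  Units.ext (tensorSelf_central x.2.1 G.1).eq

variable {k} in
theorem extendh_comp_apply {A B C : Type*} [Ring A] [Algebra k A] [Ring B] [Algebra k B]
    [Ring C] [Algebra k C] (f : A →ₐ[k] B) (g : B →ₐ[k] C) (x : PowerSeries A) :
    extendh g (extendh f x) = extendh (g.comp f) x :=
  PowerSeries.ext fun n => by simp

variable {k} in
theorem isInvariantTwist_boundary (x : centralUnits k H) :
    IsInvariantTwist k (tensorSelfUnit x * (comulUnit x)⁻¹) := by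
  have counit_aux : ∀ f : H ⊗[k] H →ₐ[k] H,
      (extendh (f.comp (Algebra.TensorProduct.includeLeft : H →ₐ[k] H ⊗[k] H)) x.1.1 *
        extendh (f.comp (Algebra.TensorProduct.includeRight : H →ₐ[k] H ⊗[k] H)) x.1.1 =
          x.1.1) →
      f.comp (Bialgebra.comulAlgHom k H) = AlgHom.id k H →
      extendh f (tensorSelfUnit x * (comulUnit x)⁻¹).1 = 1 := by
    intro f h1 h2
    have e1 : Units.map (extendh f).toMonoidHom (tensorSelfUnit x) = x.1 := by
      ext1
      simp only [tensorSelfUnit, map_mul]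
      exact (congrArg₂ (· * ·) (extendh_comp_apply _ f x.1.1)
        (extendh_comp_apply _ f x.1.1)).trans h1
    have e2 : Units.map (extendh f).toMonoidHom (comulUnit x) = x.1 := by
      ext1
      refine (extendh_comp_apply (Bialgebra.comulAlgHom k H) f x.1.1).trans ?_
      rw [h2]
      exact PowerSeries.ext fun n => by simp
    have e3 : Units.map (extendh f).toMonoidHom (tensorSelfUnit x * (comulUnit x)⁻¹) = 1 := by
      rw [map_mul, map_inv, e1, e2, mul_inv_cancel]
    exact congrArg Units.val e3
  have hε : ∀ f : H →ₐ[k] H, f = (Algebra.ofId k H).comp (Bialgebra.counitAlgHom k H) →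
      extendh f x.1.1 = 1 := by
    rintro f rfl
    rw [← extendh_comp_apply, x.2.2, map_one]
  have hid : ∀ f : H →ₐ[k] H, f = AlgHom.id k H → extendh f x.1.1 = x.1.1 := by
    rintro f rfl
    exact PowerSeries.ext fun n => by simp
  refine ⟨fun y => ?_, ?_, ?_, ?_⟩
  · refine (Commute.mul_right (tensorSelf_central x.2.1 _).symm ?_).eq
    refine Commute.units_inv_right (u := comulUnit x) ?_
    exact (show Commute y x.1.1 from Subring.mem_center_iff.1 x.2.1 y).map (comulh k H)
  · let u {A : Type _} [Ring A] [Algebra k A] (f : H →ₐ[k] A) : (PowerSeries A)ˣ :=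
      Units.map (extendh f).toMonoidHom x.1
    let inl : H →ₐ[k] H ⊗[k] H := Algebra.TensorProduct.includeLeft
    let inr : H →ₐ[k] H ⊗[k] H := Algebra.TensorProduct.includeRight
    let Δ : H →ₐ[k] H ⊗[k] H := Bialgebra.comulAlgHom k H
    let i : H →ₐ[k] H ⊗[k] (H ⊗[k] H) := Algebra.TensorProduct.includeLeft
    have expand : ∀ f : H ⊗[k] H →ₐ[k] H ⊗[k] (H ⊗[k] H),
        Units.map (extendh f).toMonoidHom (tensorSelfUnit x * (comulUnit x)⁻¹) =
          u (f.comp inl) * u (f.comp inr) * (u (f.comp Δ))⁻¹ := by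
      intro f
      have hu : ∀ g : H →ₐ[k] H ⊗[k] H,
          Units.map (extendh f).toMonoidHom (u g) = u (f.comp g) := fun g =>
        Units.ext (extendh_comp_apply g f x.1.1)
      rw [← hu, ← hu, ← hu, ← map_inv, ← map_mul, ← map_mul]
      rfl
    have a1 : (tensorOne k H).comp inl = i := by
      ext v; simp [tensorOne, inl, i, Algebra.TensorProduct.one_def]
    have a2 : (tensorOne k H).comp inr = (oneTensor k H).comp inl := by
      ext v; simp [tensorOne, oneTensor, inl, inr]
    have a3 : (comulTensor k H).comp inl = (tensorOne k H).comp Δ := by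
      ext v; simp [tensorOne, comulTensor, inl, Δ]
    have a4 : (comulTensor k H).comp inr = (oneTensor k H).comp inr := by
      ext v; simp [oneTensor, comulTensor, inr, Algebra.TensorProduct.one_def]
    have a5 : (tensorComul k H).comp inl = i := by
      ext v; simp [tensorComul, inl, i]
    have a6 : (tensorComul k H).comp inr = (oneTensor k H).comp Δ := by
      ext v; simp [tensorComul, oneTensor, inr, Δ]
    have a7 : (comulTensor k H).comp Δ = (tensorComul k H).comp Δ := by
      ext v
      exact Coalgebra.coassoc_apply v
    have comm : ∀ g : H →ₐ[k] H ⊗[k] H, Commute (u i) (u ((oneTensor k H).comp g)) := by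
      intro g
      refine Units.ext (commute_of_coeff fun m n => ?_).eq
      change Commute (i (PowerSeries.coeff m x.1.1))
        (oneTensor k H (g (PowerSeries.coeff n x.1.1)))
      simp [i, oneTensor, Commute, SemiconjBy]
    have main : Units.map (extendh (tensorOne k H)).toMonoidHom
          (tensorSelfUnit x * (comulUnit x)⁻¹) *
        Units.map (extendh (comulTensor k H)).toMonoidHom (tensorSelfUnit x * (comulUnit x)⁻¹) =
        Units.map (extendh (oneTensor k H)).toMonoidHom (tensorSelfUnit x * (comulUnit x)⁻¹) *
        Units.map (extendh (tensorComul k H)).toMonoidHom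
          (tensorSelfUnit x * (comulUnit x)⁻¹) := by
      rw [expand, expand, expand, expand, a1, a2, a3, a4, a5, a6, a7]
      have c1 := (comm inl).eq
      have c2 := (comm inr).eq
      have c3 := (comm Δ).inv_right.eq
      simp only [mul_assoc, inv_mul_cancel_left]
      rw [← mul_assoc (u ((oneTensor k H).comp Δ))⁻¹, ← c3, mul_assoc, inv_mul_cancel_left,
        ← mul_assoc (u ((oneTensor k H).comp inr)) (u i), ← c2, mul_assoc,
        ← mul_assoc (u ((oneTensor k H).comp inl)) (u i), ← c1, mul_assoc]
    exact congrArg Units.val main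
  · refine counit_aux _ ?_ ?_
    · rw [hε, hid, one_mul]
      · ext v; simp [counitTensor]
      · ext v; simp [counitTensor, Algebra.ofId_apply, Algebra.algebraMap_eq_smul_one]
    · ext v
      change TensorProduct.lid k H ((TensorProduct.map Coalgebra.counit LinearMap.id)
        (Coalgebra.comul v)) = v
      have := Coalgebra.rTensor_counit_comul (R := k) v
      rw [LinearMap.rTensor] at this
      rw [this]; simp
  · refine counit_aux _ ?_ ?_
    · rw [hid, hε, mul_one]
      · ext v; simp [tensorCounit, Algebra.ofId_apply, Algebra.algebraMap_eq_smul_one]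
      · ext v; simp [tensorCounit]
    · ext v
      change TensorProduct.rid k H ((TensorProduct.map LinearMap.id Coalgebra.counit)
        (Coalgebra.comul v)) = v
      have := Coalgebra.lTensor_counit_comul (R := k) v
      rw [LinearMap.lTensor] at this
      rw [this]; simp

variable (H) in
/-- The boundary map of the crossed module of invariant twists, `∂ x = (x ⊗ x) Δ(x)⁻¹`. -/
def boundary : centralUnits k H →* invariantTwists k H where
  toFun x := ⟨tensorSelfUnit x * (comulUnit x)⁻¹, isInvariantTwist_boundary x⟩
  map_one' := by
    ext1
    simp [tensorSelfUnit, comulUnit]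
  map_mul' x y := by
    ext1
    have h1 : tensorSelfUnit (x * y) = tensorSelfUnit x * tensorSelfUnit y := by
      ext1
      have hc : Commute (extendh (Algebra.TensorProduct.includeLeft : H →ₐ[k] H ⊗[k] H) y.1.1)
          (extendh (Algebra.TensorProduct.includeRight : H →ₐ[k] H ⊗[k] H) x.1.1) :=
        commute_of_coeff fun m n => by simp [Commute, SemiconjBy]
      change extendh _ (x.1.1 * y.1.1) * extendh _ (x.1.1 * y.1.1) =
        (extendh _ x.1.1 * extendh _ x.1.1) * (extendh _ y.1.1 * extendh _ y.1.1)
      rw [map_mul, map_mul, mul_assoc, ← mul_assoc _ (extendh _ x.1.1), hc.eq]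
      simp only [mul_assoc]
    have h2 : comulUnit (x * y) = comulUnit y * comulUnit x := by
      have hxy : x.1 * y.1 = y.1 * x.1 := Units.ext (Subring.mem_center_iff.1 y.2.1 x.1.1)
      change Units.map _ (x.1 * y.1) = _
      rw [hxy, map_mul]
      rfl
    change tensorSelfUnit (x * y) * (comulUnit (x * y))⁻¹ =
      (tensorSelfUnit x * (comulUnit x)⁻¹) * (tensorSelfUnit y * (comulUnit y)⁻¹)
    rw [h1, h2, mul_inv_rev, mul_assoc, mul_assoc, ← mul_assoc (comulUnit x)⁻¹,
      ← (tensorSelfUnit_commute y (comulUnit x)⁻¹).eq, mul_assoc]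

variable {k} in
theorem boundary_commute (x : centralUnits k H) (F : invariantTwists k H) :
    Commute (boundary k H x) F := by
  refine Subtype.ext (Commute.mul_left (tensorSelfUnit_commute x F.1) (Commute.inv_left ?_)).eq
  exact Units.ext (F.2.invariant x.1.1)

instance boundary_range_normal : (boundary k H).range.Normal := by
  refine ⟨?_⟩
  rintro _ ⟨x, rfl⟩ F
  rw [← (boundary_commute x F).eq, mul_inv_cancel_right]
  exact ⟨x, rfl⟩

variable (H) in
/-- The group `π₀` of gauge classes of invariant twists on `H[[h]]`: the cokernel of `∂`. -/
abbrev GaugeClasses : Type _ := invariantTwists k H ⧸ (boundary k H).range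

variable {k} in
/-- Two invariant twists have the same class if and only if there is a gauge transformation
between them, that is an invertible central `a` of counit `1` with `F Δ(a) = (a ⊗ a) F'`. -/
theorem gaugeClass_eq_iff (F F' : invariantTwists k H) :
    (F : GaugeClasses k H) = F' ↔ ∃ a : centralUnits k H,
      F.1.1 * comulh k H a.1.1 = tensorSelf k a.1.1 * F'.1.1 := by
  have key : ∀ a : centralUnits k H, F.1.1 * comulh k H a.1.1 = tensorSelf k a.1.1 * F'.1.1 ↔
      F = boundary k H a * F' := by
    intro a
    have h1 : F.1.1 * comulh k H a.1.1 = tensorSelf k a.1.1 * F'.1.1 ↔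
        F.1 * comulUnit a = tensorSelfUnit a * F'.1 :=
      (Units.ext_iff (u := F.1 * comulUnit a) (v := tensorSelfUnit a * F'.1)).symm
    have h2 : Commute (comulUnit a) F'.1 := Units.ext (F'.2.invariant a.1.1)
    rw [h1, ← eq_mul_inv_iff_mul_eq, mul_assoc, ← h2.inv_left.eq, ← mul_assoc, Subtype.ext_iff]
    rfl
  rw [QuotientGroup.eq]
  constructor
  · rintro ⟨x, hx⟩
    refine ⟨x⁻¹, (key _).2 ?_⟩
    have := (boundary_commute x F).eq
    rw [map_inv, eq_inv_mul_iff_mul_eq, this, hx, mul_inv_cancel_left]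
  · rintro ⟨a, ha⟩
    refine ⟨a⁻¹, ?_⟩
    rw [(key a).1 ha, map_inv, (boundary_commute a F').eq]
    group

/-- A choice of data that computes the associator of the crossed module `∂`: a section `σ` of the
projection onto `coker ∂` and a map `a` with `σ(fg) = ∂(a(f,g)) σ(f) σ(g)`. -/
structure IsAssociatorChoice (σ : GaugeClasses k H → invariantTwists k H)
    (a : GaugeClasses k H → GaugeClasses k H → centralUnits k H) : Prop where
  isSection : ∀ f, (σ f : GaugeClasses k H) = f
  boundary_eq : ∀ f g, σ (f * g) = boundary k H (a f g) * σ f * σ g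

variable (H) in
/-- The associator class in `H³(coker ∂, ker ∂)` is trivial.  The action of invariant twists on
`centralUnits` is trivial, so the class is represented by the cochain
`a(f,gh) a(g,h) a(f,g)⁻¹ a(fg,h)⁻¹`, and it is trivial if this cochain is the coboundary of a
2-cochain `c` with values in `ker ∂`.  As the class does not depend on the choice of `σ` and `a`,
this is required for every choice. -/
def AssociatorTrivial : Prop :=
  ∀ (σ : GaugeClasses k H → invariantTwists k H)
    (a : GaugeClasses k H → GaugeClasses k H → centralUnits k H), IsAssociatorChoice k σ a →
    ∃ c : GaugeClasses k H → GaugeClasses k H → (boundary k H).ker, ∀ f g l,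
      a f (g * l) * a g l * (a f g)⁻¹ * (a (f * g) l)⁻¹ =
        ((c g l * (c (f * g) l)⁻¹ * c f (g * l) * (c f g)⁻¹ : (boundary k H).ker) :
          centralUnits k H)

end Bialgebra

section Enveloping

/-! ### The bialgebra `U(g)` and invariant bivectors -/

variable (k : Type*) (g : Type*) [Field k] [LieRing g] [LieAlgebra k g]

attribute [local instance 100] LieRing.ofAssociativeRing

/-- The coproduct of `U(g)`, determined by `Δ(x) = x ⊗ 1 + 1 ⊗ x` for `x` in `g`. -/
def envComul : UniversalEnvelopingAlgebra k g →ₐ[k]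
    UniversalEnvelopingAlgebra k g ⊗[k] UniversalEnvelopingAlgebra k g :=
  UniversalEnvelopingAlgebra.lift k
    { toFun := fun x =>
        UniversalEnvelopingAlgebra.ι k x ⊗ₜ 1 + 1 ⊗ₜ UniversalEnvelopingAlgebra.ι k x
      map_add' := fun x y => by
        simp only [map_add, TensorProduct.add_tmul, TensorProduct.tmul_add]; abel
      map_smul' := fun c x => by
        simp only [map_smul, RingHom.id_apply, smul_add, TensorProduct.smul_tmul',
          TensorProduct.tmul_smul]
      map_lie' := fun {x y} => by
        simp only [LieHom.map_lie, LieRing.of_associative_ring_bracket, TensorProduct.sub_tmul,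
          TensorProduct.tmul_sub, add_mul, mul_add, Algebra.TensorProduct.tmul_mul_tmul,
          one_mul, mul_one]
        abel }

/-- The counit of `U(g)`, determined by `ε(x) = 0` for `x` in `g`. -/
def envCounit : UniversalEnvelopingAlgebra k g →ₐ[k] k :=
  UniversalEnvelopingAlgebra.lift k 0

variable {g} in
theorem env_algHom_ext {A : Type*} [Ring A] [Algebra k A]
    {f f' : UniversalEnvelopingAlgebra k g →ₐ[k] A}
    (h : ∀ x : g, f (UniversalEnvelopingAlgebra.ι k x) = f' (UniversalEnvelopingAlgebra.ι k x)) :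
    f = f' :=
  UniversalEnvelopingAlgebra.hom_ext k (LieHom.ext h)

variable {g} in
theorem envComul_ι (x : g) : envComul k g (UniversalEnvelopingAlgebra.ι k x) =
    UniversalEnvelopingAlgebra.ι k x ⊗ₜ 1 + 1 ⊗ₜ UniversalEnvelopingAlgebra.ι k x :=
  UniversalEnvelopingAlgebra.lift_ι_apply k _ x

variable {g} in
theorem envCounit_ι (x : g) : envCounit k g (UniversalEnvelopingAlgebra.ι k x) = 0 :=
  UniversalEnvelopingAlgebra.lift_ι_apply k _ x

instance envBialgebra : Bialgebra k (UniversalEnvelopingAlgebra k g) :=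
  Bialgebra.ofAlgHom (envComul k g) (envCounit k g)
    (by
      refine env_algHom_ext k fun x => ?_
      change Algebra.TensorProduct.assoc k k k _ _ _ (Algebra.TensorProduct.map (envComul k g)
        (.id k _) (envComul k g (UniversalEnvelopingAlgebra.ι k x))) =
          Algebra.TensorProduct.map (.id k _) (envComul k g)
            (envComul k g (UniversalEnvelopingAlgebra.ι k x))
      simp only [envComul_ι, map_add, Algebra.TensorProduct.map_tmul, map_one, AlgHom.id_apply,
        TensorProduct.add_tmul, TensorProduct.tmul_add, Algebra.TensorProduct.assoc_tmul,
        Algebra.TensorProduct.one_def]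
      abel)
    (by
      refine env_algHom_ext k fun x => ?_
      change Algebra.TensorProduct.map (envCounit k g) (.id k _)
        (envComul k g (UniversalEnvelopingAlgebra.ι k x)) =
          (Algebra.TensorProduct.lid k _).symm (UniversalEnvelopingAlgebra.ι k x)
      simp [envComul_ι, envCounit_ι, -UniversalEnvelopingAlgebra.ι_apply])
    (by
      refine env_algHom_ext k fun x => ?_
      change Algebra.TensorProduct.map (.id k _) (envCounit k g)
        (envComul k g (UniversalEnvelopingAlgebra.ι k x)) =
          (Algebra.TensorProduct.rid k k _).symm (UniversalEnvelopingAlgebra.ι k x)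
      simp [envComul_ι, envCounit_ι, -UniversalEnvelopingAlgebra.ι_apply])

/-- The space `(Λ²g)^g` of `g`-invariant skew-symmetric tensors in `g ⊗ g`. -/
def invariantBivectors : Submodule k (g ⊗[k] g) :=
  (LieModule.maxTrivSubmodule k g (g ⊗[k] g)).toSubmodule ⊓
    LinearMap.ker ((TensorProduct.comm k g g).toLinearMap + LinearMap.id)

/-- The additive group `(Λ²g)^g[[h]]`: the formal series `∑ Xₙ hⁿ` is the sequence of its
coefficients. -/
abbrev InvariantBivectorSeries : Type _ := ℕ → invariantBivectors k g

variable {k g} in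
/-- The series `h X = ∑ Xₙ hⁿ⁺¹` in `(U(g) ⊗ U(g))[[h]]`, for `X = ∑ Xₙ hⁿ` in `(Λ²g)^g[[h]]`. -/
def hMul (X : InvariantBivectorSeries k g) :
    PowerSeries (UniversalEnvelopingAlgebra k g ⊗[k] UniversalEnvelopingAlgebra k g) :=
  PowerSeries.X * PowerSeries.mk fun n =>
    TensorProduct.map (LieHom.toLinearMap (UniversalEnvelopingAlgebra.ι k))
      (LieHom.toLinearMap (UniversalEnvelopingAlgebra.ι k)) (X n : g ⊗[k] g)

/-- The exponential `∑ Yᵐ / m!` of a power series `Y` without constant term.  As `Yᵐ` is divisible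
by `hᵐ`, only the terms with `m ≤ n` contribute to the coefficient of `hⁿ`. -/
def exph {A : Type*} [Ring A] [Algebra k A] (Y : PowerSeries A) : PowerSeries A :=
  PowerSeries.mk fun n =>
    ∑ m ∈ Finset.range (n + 1), ((m.factorial : k)⁻¹) • PowerSeries.coeff n (Y ^ m)

end Enveloping

end InvTwist

end

/-!
The logarithm of an invariant twist has its coefficients in the additive, invariant, normalised
2-cocycles of `U = U(g)`: by induction on the degree `n`, the twist and the exponential of its
logarithm truncated below degree `n` agree below degree `n`, and the first difference of two twists
is such a cocycle. An invariant cocycle is the sum of an element of `(Λ²g)^g` and of the coboundary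
of a central element. Hence every twist is `exp(hX + ∂s)` with `s` central, which is gauge
equivalent to `exp(hX)`. Conversely `X` is determined by its gauge class because `∂` takes symmetric
values, while the flip sends `exp(hX)` to `exp(-hX)`.

For the group law, the commutator of two invariant bivectors is the coboundary of a central element
which is bilinear in them. It commutes with both of them, so the Campbell-Hausdorff series stops
after its quadratic term, and `exp(hX) exp(hY) = ∂(c) exp(h(X + Y))` with `c` the exponential of a
bilinear expression. A bilinear cochain is a 2-cocycle, and this trivialises the associator.

The structure of `U` enters through its primitive elements. The second Adams operation `u ↦ u₁ u₂`
multiplies the `n`-th graded piece of the word filtration by `2 ^ n`, which shows that the primitive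
elements are the generators and that symmetric cocycles are coboundaries. No basis of `U` is needed:
the injectivity of `g → U` follows from the case of a free Lie algebra, where it is detected by the
Euler derivation.
-/

noncomputable section

namespace InvTwist

/-! ### Exponentials of power series without constant term -/

section Exponential

open PowerSeries Finset

variable {k : Type*} [Field k] {A : Type*} [Ring A] [Algebra k A]

theorem coeff_mul_congr {F F' G G' : PowerSeries A} {n : ℕ}
    (h : ∀ i ≤ n, coeff i F = coeff i G) (h' : ∀ i ≤ n, coeff i F' = coeff i G') :
    coeff n (F * F') = coeff n (G * G') := by
  rw [coeff_mul, coeff_mul]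
  refine sum_congr rfl fun x hx => ?_
  rw [h _ (HasAntidiagonal.antidiagonal.fst_le hx), h' _ (HasAntidiagonal.antidiagonal.snd_le hx)]

theorem coeff_mul_sub_coeff_mul {F F' G G' : PowerSeries A} {n : ℕ} (hn : n ≠ 0)
    (h : ∀ i < n, coeff i F = coeff i G) (h' : ∀ i < n, coeff i F' = coeff i G') :
    coeff n (F * F') - coeff n (G * G') =
      (coeff n F - coeff n G) * constantCoeff F' + constantCoeff F * (coeff n F' - coeff n G') := by
  obtain ⟨n, rfl⟩ := Nat.exists_eq_succ_of_ne_zero hn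
  have hconst' : constantCoeff F' = constantCoeff G' := by simpa using h' 0 n.succ_pos
  have hconst : constantCoeff F = constantCoeff G := by simpa using h 0 n.succ_pos
  have hmiddle : ∑ x ∈ range n, coeff (x + 1) F * coeff (n - x) F' =
      ∑ x ∈ range n, coeff (x + 1) G * coeff (n - x) G' := by
    refine sum_congr rfl fun x hx => ?_
    rw [mem_range] at hx
    rw [h _ (by omega), h' _ (by omega)]
  rw [coeff_mul, coeff_mul, Nat.sum_antidiagonal_succ, Nat.sum_antidiagonal_succ,
    Nat.sum_antidiagonal_eq_sum_range_succ_mk, Nat.sum_antidiagonal_eq_sum_range_succ_mk,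
    sum_range_succ, sum_range_succ]
  simp only [hmiddle, coeff_zero_eq_constantCoeff, Nat.sub_self, hconst', hconst]
  noncomm_ring

theorem coeff_pow_congr {Y Z : PowerSeries A} {n : ℕ} (hY : constantCoeff Y = 0)
    (h : ∀ i < n, coeff i Y = coeff i Z) (hn : n ≠ 0) {m : ℕ} (hm : m ≠ 1) :
    coeff n (Y ^ m) = coeff n (Z ^ m) := by
  have hlow (j : ℕ) : ∀ i < n, coeff i (Y ^ j) = coeff i (Z ^ j) := by
    induction j with
    | zero => simp
    | succ j ih =>
      intro i hi
      exact coeff_mul_congr (fun l hl => ih l (by omega)) fun l hl => h l (by omega)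
  rcases m with _ | _ | m
  · simp
  · simp at hm
  · rw [← sub_eq_zero, pow_succ Y, pow_succ Z, coeff_mul_sub_coeff_mul hn (hlow _) h, hY]
    simp [hY]

variable (k) in
/-- The partial sum `∑_{m < N} Yᵐ / m!` of the exponential series. -/
def expPartialSum (N : ℕ) (Y : PowerSeries A) : PowerSeries A :=
  ∑ m ∈ range N, ((m.factorial : k)⁻¹) • Y ^ m

theorem coeff_exph (Y : PowerSeries A) (n : ℕ) :
    coeff n (exph k Y) = ∑ m ∈ range (n + 1), ((m.factorial : k)⁻¹) • coeff n (Y ^ m) := by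
  simp [exph]

theorem coeff_exph_eq_coeff_expPartialSum {Y : PowerSeries A} (hY : constantCoeff Y = 0)
    {n N : ℕ} (h : n < N) : coeff n (exph k Y) = coeff n (expPartialSum k N Y) := by
  rw [coeff_exph, expPartialSum, map_sum]
  simp only [coeff_smul]
  refine sum_subset (range_subset_range.2 h) fun m _ hm => ?_
  have hnm : n < m := by simpa using hm
  rw [coeff_of_lt_order n, smul_zero]
  exact lt_of_lt_of_le (by exact_mod_cast hnm) (le_order_pow_of_constantCoeff_eq_zero m hY)

theorem constantCoeff_exph (Y : PowerSeries A) : constantCoeff (exph k Y) = 1 := by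
  rw [← coeff_zero_eq_constantCoeff_apply, coeff_exph]
  simp

theorem exph_zero : exph k (0 : PowerSeries A) = 1 := by
  ext n
  rw [coeff_exph, sum_eq_single 0]
  · simp
  · intro m _ hm
    simp [hm]
  · simp

theorem extendh_exph {B : Type*} [Ring B] [Algebra k B] (f : A →ₐ[k] B) (Y : PowerSeries A) :
    extendh f (exph k Y) = exph k (extendh f Y) := by
  ext n
  simp only [coeff_exph, coeff_map, ← map_pow, AlgHom.coe_toRingHom, map_sum, map_smul]

theorem commute_expPartialSum {Y Z : PowerSeries A} (h : Commute Z Y) (N : ℕ) :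
    Commute Z (expPartialSum k N Y) :=
  Commute.sum_right _ _ _ fun m _ => (h.pow_right m).smul_right _

theorem commute_exph {Y Z : PowerSeries A} (hY : constantCoeff Y = 0) (h : Commute Z Y) :
    Commute Z (exph k Y) := by
  ext n
  have hE : ∀ i ≤ n, coeff i (exph k Y) = coeff i (expPartialSum k (n + 1) Y) := fun i hi =>
    coeff_exph_eq_coeff_expPartialSum hY (by omega)
  calc coeff n (Z * exph k Y) = coeff n (Z * expPartialSum k (n + 1) Y) :=
        coeff_mul_congr (fun _ _ => rfl) hE
    _ = coeff n (expPartialSum k (n + 1) Y * Z) := by rw [(commute_expPartialSum h _).eq]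
    _ = coeff n (exph k Y * Z) := coeff_mul_congr (fun i hi => (hE i hi).symm) fun _ _ => rfl

theorem coeff_exph_sub {Y Z : PowerSeries A} {n : ℕ} (hY : constantCoeff Y = 0)
    (h : ∀ i < n, coeff i Y = coeff i Z) (hn : n ≠ 0) :
    coeff n (exph k Y) - coeff n (exph k Z) = coeff n Y - coeff n Z := by
  rw [coeff_exph, coeff_exph, ← sum_sub_distrib, sum_eq_single 1]
  · simp
  · intro m _ hm
    rw [coeff_pow_congr hY h hn hm, sub_self]
  · intro h1
    simp only [mem_range] at h1
    omega

theorem coeff_exph_congr {Y Z : PowerSeries A} {n : ℕ} (hY : constantCoeff Y = 0)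
    (h : ∀ i < n, coeff i Y = coeff i Z) : ∀ i < n, coeff i (exph k Y) = coeff i (exph k Z) := by
  intro i hi
  rcases Nat.eq_zero_or_pos i with rfl | h0
  · simp [coeff_zero_eq_constantCoeff, constantCoeff_exph]
  · rw [← sub_eq_zero, coeff_exph_sub hY (fun j hj => h j (by omega)) (by omega), h i hi, sub_self]

theorem exph_injOn : Set.InjOn (exph k) {Y : PowerSeries A | constantCoeff Y = 0} := by
  intro Y hY Z hZ h
  ext n
  induction n using Nat.strong_induction_on with
  | _ n ih =>
    rcases Nat.eq_zero_or_pos n with rfl | h0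
    · simp [Set.mem_ofPred.1 hY, Set.mem_ofPred.1 hZ]
    · rw [← sub_eq_zero, ← coeff_exph_sub (k := k) hY ih (by omega), h, sub_self]

variable (k) in
/-- The coefficients of the logarithm of a power series `F` with constant term `1`: the `n`-th one
corrects the discrepancy between `F` and the exponential of the lower terms found so far. -/
def logCoeff (F : PowerSeries A) (n : ℕ) : A :=
  if n = 0 then 0 else
    coeff n F - coeff n (exph k (PowerSeries.mk fun i => if _h : i < n then logCoeff F i else 0))

theorem exists_exph_eq {F : PowerSeries A} (hF : constantCoeff F = 1) :
    ∃ Y : PowerSeries A, constantCoeff Y = 0 ∧ exph k Y = F := by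
  have h0 : constantCoeff (PowerSeries.mk (logCoeff k F)) = 0 := by
    rw [← coeff_zero_eq_constantCoeff_apply, coeff_mk, logCoeff, if_pos rfl]
  refine ⟨PowerSeries.mk (logCoeff k F), h0, ?_⟩
  ext n
  rcases Nat.eq_zero_or_pos n with rfl | hn
  · simp [coeff_zero_eq_constantCoeff, constantCoeff_exph, hF]
  · have hsub := coeff_exph_sub (k := k) (Y := PowerSeries.mk (logCoeff k F))
      (Z := PowerSeries.mk fun i => if _h : i < n then logCoeff k F i else 0) (n := n) h0
      (fun i hi => by simp [hi]) (by omega)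
    rw [coeff_mk, coeff_mk, dif_neg (lt_irrefl n), sub_zero, logCoeff.eq_1 k F n,
      if_neg (by omega)] at hsub
    exact sub_left_injective hsub

variable (k) in
/-- The formal derivative of a power series. `PowerSeries.derivative` is only available over
commutative rings. -/
def formalDeriv : PowerSeries A →ₗ[k] PowerSeries A where
  toFun F := PowerSeries.mk fun n => ((n : k) + 1) • coeff (n + 1) F
  map_add' F G := by ext n; simp
  map_smul' c F := by ext n; simp [smul_comm _ c]

theorem coeff_formalDeriv (F : PowerSeries A) (n : ℕ) :
    coeff n (formalDeriv k F) = ((n : k) + 1) • coeff (n + 1) F := by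
  simp [formalDeriv]

theorem formalDeriv_mul (F G : PowerSeries A) :
    formalDeriv k (F * G) = formalDeriv k F * G + F * formalDeriv k G := by
  ext n
  have hleft : ∑ p ∈ antidiagonal (n + 1), (p.1 : k) • (coeff p.1 F * coeff p.2 G) =
      ∑ p ∈ antidiagonal n, coeff p.1 (formalDeriv k F) * coeff p.2 G := by
    simp [Nat.sum_antidiagonal_succ, coeff_formalDeriv]
  have hright : ∑ p ∈ antidiagonal (n + 1), (p.2 : k) • (coeff p.1 F * coeff p.2 G) =
      ∑ p ∈ antidiagonal n, coeff p.1 F * coeff p.2 (formalDeriv k G) := by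
    simp [Nat.sum_antidiagonal_succ', coeff_formalDeriv]
  rw [map_add, coeff_formalDeriv, coeff_mul, coeff_mul, coeff_mul, ← hleft, ← hright,
    ← sum_add_distrib, smul_sum]
  refine sum_congr rfl fun p hp => ?_
  rw [← add_smul, ← Nat.cast_add, HasAntidiagonal.mem_antidiagonal.1 hp, Nat.cast_add_one]

theorem formalDeriv_C_mul_X_pow (a : A) (n : ℕ) :
    formalDeriv k (C a * X ^ (n + 1) : PowerSeries A) = C (((n : k) + 1) • a) * X ^ n := by
  ext m
  rw [coeff_formalDeriv, coeff_C_mul_X_pow, coeff_C_mul_X_pow]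
  rcases eq_or_ne m n with rfl | hm
  · simp
  · simp [hm]

theorem formalDeriv_pow_succ {Y : PowerSeries A} (h : Commute (formalDeriv k Y) Y) (m : ℕ) :
    formalDeriv k (Y ^ (m + 1)) = ((m : k) + 1) • (formalDeriv k Y * Y ^ m) := by
  induction m with
  | zero => simp
  | succ m ih =>
    rw [pow_succ, formalDeriv_mul, ih, (h.pow_right (m + 1)).symm.eq, smul_mul_assoc, mul_assoc,
      ← pow_succ]
    push_cast
    module

theorem formalDeriv_one : formalDeriv k (1 : PowerSeries A) = 0 := by
  ext n
  simp [coeff_formalDeriv, coeff_one]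

theorem factorial_succ_inv_smul [CharZero k] {M : Type*} [AddCommGroup M] [Module k M] (m : ℕ)
    (v : M) : (((m + 1).factorial : k)⁻¹) • ((m : k) + 1) • v = ((m.factorial : k)⁻¹) • v := by
  have hm : (m : k) + 1 ≠ 0 := by exact_mod_cast m.succ_ne_zero
  rw [smul_smul, Nat.factorial_succ, Nat.cast_mul, Nat.cast_succ, mul_inv_rev, mul_assoc,
    inv_mul_cancel₀ hm, mul_one]

theorem formalDeriv_expPartialSum_succ [CharZero k] {Y : PowerSeries A}
    (h : Commute (formalDeriv k Y) Y) (N : ℕ) :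
    formalDeriv k (expPartialSum k (N + 1) Y) = formalDeriv k Y * expPartialSum k N Y := by
  simp only [expPartialSum, sum_range_succ', map_add, map_sum, map_smul, pow_zero, mul_sum,
    formalDeriv_one, smul_zero, add_zero, formalDeriv_pow_succ h, mul_smul_comm,
    factorial_succ_inv_smul]

theorem formalDeriv_exph [CharZero k] {Y : PowerSeries A} (hY : constantCoeff Y = 0)
    (h : Commute (formalDeriv k Y) Y) :
    formalDeriv k (exph k Y) = formalDeriv k Y * exph k Y := by
  ext n
  rw [coeff_formalDeriv, coeff_exph_eq_coeff_expPartialSum hY (n + 1).lt_succ_self,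
    ← coeff_formalDeriv, formalDeriv_expPartialSum_succ h]
  exact coeff_mul_congr (fun _ _ => rfl) fun i hi =>
    (coeff_exph_eq_coeff_expPartialSum hY (by omega)).symm

theorem eq_of_formalDeriv_eq_mul [CharZero k] {F G P : PowerSeries A}
    (h0 : constantCoeff F = constantCoeff G) (hF : formalDeriv k F = P * F)
    (hG : formalDeriv k G = P * G) : F = G := by
  ext n
  induction n using Nat.strong_induction_on with
  | _ n ih =>
    rcases n with _ | n
    · simpa using h0
    · have hn : (n : k) + 1 ≠ 0 := by exact_mod_cast n.succ_ne_zero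
      refine smul_right_injective A hn ?_
      change ((n : k) + 1) • coeff (n + 1) F = ((n : k) + 1) • coeff (n + 1) G
      rw [← coeff_formalDeriv, ← coeff_formalDeriv, hF, hG]
      exact coeff_mul_congr (fun _ _ => rfl) fun i hi => ih i (by omega)

theorem pow_succ_mul_of_commute_commutator {x y : A} (hx : Commute (x * y - y * x) x) (m : ℕ) :
    x ^ (m + 1) * y = y * x ^ (m + 1) + ((m : k) + 1) • ((x * y - y * x) * x ^ m) := by
  induction m with
  | zero => simp
  | succ m ih =>
    calc x ^ (m + 2) * y = x * (x ^ (m + 1) * y) := by rw [pow_succ' x (m + 1), mul_assoc]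
      _ = x * y * x ^ (m + 1) + ((m : k) + 1) • (x * (x * y - y * x) * x ^ m) := by
        rw [ih, mul_add, mul_smul_comm]; simp only [mul_assoc]
      _ = y * x ^ (m + 2) + (((m + 1 : ℕ) : k) + 1) • ((x * y - y * x) * x ^ (m + 1)) := by
        rw [← hx.eq, mul_assoc _ x, ← pow_succ', pow_succ' x (m + 1), ← mul_assoc y,
          ← sub_add_cancel (x * y) (y * x), add_sub_cancel_right, add_mul]
        push_cast
        module

theorem coeff_exph_C_mul_X (x : A) (n : ℕ) :
    coeff n (exph k (C x * X)) = ((n.factorial : k)⁻¹) • x ^ n := by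
  simp only [coeff_exph, (commute_X (C x)).mul_pow, ← map_pow, coeff_C_mul_X_pow]
  simp

theorem exph_C_mul_X_mul_C [CharZero k] {x y : A} (hx : Commute (x * y - y * x) x) :
    exph k (C x * X) * C y = (C y + C (x * y - y * x) * X) * exph k (C x * X) := by
  ext n
  rw [add_mul, map_add, coeff_C_mul, coeff_mul_C, mul_assoc, ← (commute_X (exph k (C x * X))).eq,
    coeff_C_mul]
  rcases n with _ | n
  · simp [coeff_exph_C_mul_X]
  · rw [coeff_succ_mul_X, coeff_exph_C_mul_X, coeff_exph_C_mul_X, smul_mul_assoc,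
      pow_succ_mul_of_commute_commutator (k := k) hx, smul_add, mul_smul_comm, mul_smul_comm,
      factorial_succ_inv_smul]

/-- Both sides solve `F' = (x + y + [x, y] t) F`. -/
theorem exph_C_mul_X_mul_exph_C_mul_X [CharZero k] {x y : A} (hx : Commute (x * y - y * x) x)
    (hy : Commute (x * y - y * x) y) :
    exph k (C x * X) * exph k (C y * X) =
      exph k (C (x + y) * X + C ((2 : k)⁻¹ • (x * y - y * x)) * X ^ 2) := by
  set w := x * y - y * x
  have hlin (a : A) : formalDeriv k (C a * X : PowerSeries A) = C a := by
    simpa using formalDeriv_C_mul_X_pow (k := k) a 0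
  have hlin_comm (a : A) : Commute (formalDeriv k (C a * X : PowerSeries A)) (C a * X) := by
    rw [hlin]
    exact (Commute.refl _).mul_right (commute_X _)
  have hquad : formalDeriv k (C ((2 : k)⁻¹ • w) * X ^ 2 : PowerSeries A) = C w * X := by
    rw [formalDeriv_C_mul_X_pow, smul_smul, Nat.cast_one, one_add_one_eq_two,
      mul_inv_cancel₀ two_ne_zero, one_smul, pow_one]
  have hsum : formalDeriv k (C (x + y) * X + C ((2 : k)⁻¹ • w) * X ^ 2 : PowerSeries A) =
      C (x + y) + C w * X := by rw [map_add, hlin, hquad]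
  have hsum_comm : Commute (C (x + y) + C w * X : PowerSeries A)
      (C (x + y) * X + C ((2 : k)⁻¹ • w) * X ^ 2) := by
    have hw : Commute w (x + y) := hx.add_right hy
    have hcommute {a b : A} (hab : Commute a b) (i j : ℕ) :
        Commute (C a * X ^ i : PowerSeries A) (C b * X ^ j) :=
      ((hab.map C).mul_right ((commute_X _).pow_right j)).mul_left
        ((commute_X _).pow_right i).symm
    have hpowers := ((hcommute (Commute.refl (x + y)) 0 1).add_right
      (hcommute (hw.symm.smul_right (2 : k)⁻¹) 0 2)).add_left
      ((hcommute hw 1 1).add_right (hcommute ((Commute.refl w).smul_right (2 : k)⁻¹) 1 2))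
    simpa only [pow_zero, pow_one, mul_one] using hpowers
  have hshift : exph k (C x * X) * C y = (C y + C w * X) * exph k (C x * X) :=
    exph_C_mul_X_mul_C hx
  refine eq_of_formalDeriv_eq_mul (k := k) (P := C (x + y) + C w * X) ?_ ?_ ?_
  · simp [constantCoeff_exph]
  · rw [formalDeriv_mul, formalDeriv_exph (by simp) (hlin_comm x),
      formalDeriv_exph (by simp) (hlin_comm y), hlin, hlin, ← mul_assoc, hshift, map_add]
    noncomm_ring
  · rw [formalDeriv_exph (by simp) (by rw [hsum]; exact hsum_comm), hsum]

theorem sum_antidiagonal_antidiagonal_comm {M : Type*} [AddCommMonoid M] (f : ℕ → ℕ → ℕ → ℕ → M)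
    (n : ℕ) :
    ∑ p ∈ antidiagonal n, ∑ q ∈ antidiagonal p.1, ∑ r ∈ antidiagonal p.2, f q.1 q.2 r.1 r.2 =
      ∑ p ∈ antidiagonal n, ∑ q ∈ antidiagonal p.1, ∑ r ∈ antidiagonal p.2,
        f q.1 r.1 q.2 r.2 := by
  simp only [sum_sigma']
  refine sum_nbij'
    (fun s => ⟨(s.2.1.1 + s.2.2.1, s.2.1.2 + s.2.2.2), (s.2.1.1, s.2.2.1), s.2.1.2, s.2.2.2⟩)
    (fun s => ⟨(s.2.1.1 + s.2.2.1, s.2.1.2 + s.2.2.2), (s.2.1.1, s.2.2.1), s.2.1.2, s.2.2.2⟩)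
    ?_ ?_ ?_ ?_ fun _ _ => rfl <;>
  · rintro ⟨⟨p, q⟩, ⟨a, b⟩, ⟨c, d⟩⟩ hs
    simp only [mem_sigma, HasAntidiagonal.mem_antidiagonal] at hs ⊢
    grind

variable (k A) in
/-- The substitution `t ↦ h` from `A[[h]][[t]]` to `A[[h]]`, where `t` is the outer variable. -/
def diagonal : PowerSeries (PowerSeries A) →ₐ[k] PowerSeries A :=
  AlgHom.ofLinearMap
    { toFun := fun F => PowerSeries.mk fun n => ∑ p ∈ antidiagonal n, coeff p.2 (coeff p.1 F)
      map_add' := fun F G => by ext n; simp [sum_add_distrib]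
      map_smul' := fun c F => by ext n; simp [smul_sum] }
    (by
      ext n
      simp only [LinearMap.coe_mk, AddHom.coe_mk, coeff_mk]
      rw [sum_eq_single (0, n)]
      · simp
      · rintro ⟨i, j⟩ hij hne
        rw [coeff_one, if_neg, map_zero]
        rintro rfl
        exact hne (by rw [← HasAntidiagonal.mem_antidiagonal.1 hij, zero_add])
      · simp)
    (by
      intro F G
      ext n
      simp only [LinearMap.coe_mk, AddHom.coe_mk, coeff_mul, coeff_mk, map_sum, sum_mul_sum]
      exact sum_antidiagonal_antidiagonal_comm
        (fun a b c d => coeff c (coeff a F) * coeff d (coeff b G)) n)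

theorem coeff_diagonal (F : PowerSeries (PowerSeries A)) (n : ℕ) :
    coeff n (diagonal k A F) = ∑ p ∈ antidiagonal n, coeff p.2 (coeff p.1 F) := by
  simp [diagonal]

theorem diagonal_C_mul_X_pow (F : PowerSeries A) (m : ℕ) :
    diagonal k A (C F * X ^ m) = F * X ^ m := by
  ext n
  rw [coeff_diagonal, coeff_mul_X_pow']
  simp only [coeff_C_mul_X_pow, apply_ite, map_zero]
  split_ifs with hmn
  · rw [sum_eq_single (m, n - m)]
    · simp
    · rintro ⟨i, j⟩ hij hne
      rw [HasAntidiagonal.mem_antidiagonal] at hij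
      exact if_neg fun h => hne (Prod.ext h (by grind))
    · exact fun h => absurd (HasAntidiagonal.mem_antidiagonal.2 (by grind)) h
  · refine sum_eq_zero fun p hp => if_neg ?_
    have hfst := HasAntidiagonal.antidiagonal.fst_le hp
    omega

theorem diagonal_exph {Z : PowerSeries (PowerSeries A)} (hZ : constantCoeff Z = 0) :
    diagonal k A (exph k Z) = exph k (diagonal k A Z) := by
  ext n
  have hpartial : coeff n (diagonal k A (exph k Z)) =
      coeff n (diagonal k A (expPartialSum k (n + 1) Z)) := by
    rw [coeff_diagonal, coeff_diagonal]
    refine sum_congr rfl fun p hp => ?_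
    rw [coeff_exph_eq_coeff_expPartialSum hZ
      (Nat.lt_succ_of_le (HasAntidiagonal.antidiagonal.fst_le hp))]
  rw [hpartial, coeff_exph]
  simp [expPartialSum]

/-- For `Y = y h` and `Z = z h`, this is the image under `t ↦ h` of the formula for
`exp(y t) exp(z t)`. -/
theorem exph_mul_exph [CharZero k] {Y Z : PowerSeries A} (hY : constantCoeff Y = 0)
    (hZ : constantCoeff Z = 0) (h : Commute (Y * Z - Z * Y) Y) (h' : Commute (Y * Z - Z * Y) Z) :
    exph k Y * exph k Z = exph k (Y + Z + (2 : k)⁻¹ • (Y * Z - Z * Y)) := by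
  obtain ⟨y, rfl⟩ : ∃ y, Y = y * X := ⟨_, by simpa [hY] using eq_shift_mul_X_add_const Y⟩
  obtain ⟨z, rfl⟩ : ∃ z, Z = z * X := ⟨_, by simpa [hZ] using eq_shift_mul_X_add_const Z⟩
  have hmul (F G : PowerSeries A) (m : ℕ) : F * X ^ m * (G * X) = F * G * X ^ (m + 1) := by
    rw [pow_succ, mul_assoc, ← mul_assoc _ G, ← ((commute_X G).pow_right m).eq]
    simp only [mul_assoc]
  have hmul' (F G : PowerSeries A) (m : ℕ) : G * X * (F * X ^ m) = G * F * X ^ (m + 1) := by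
    rw [pow_succ', mul_assoc, ← mul_assoc X, ← (commute_X F).eq]
    simp only [mul_assoc]
  have hcommutator : y * X * (z * X) - z * X * (y * X) = (y * z - z * y) * X ^ 2 := by
    simpa [sub_mul] using congrArg₂ (· - ·) (hmul y z 1) (hmul z y 1)
  rw [hcommutator] at h h' ⊢
  have hcancel {T : PowerSeries A} (hT : Commute ((y * z - z * y) * X ^ 2) (T * X)) :
      Commute (y * z - z * y) T :=
    mul_X_pow_inj.1 ((hmul _ T 2).symm.trans (hT.eq.trans (hmul' _ T 2)))
  have main := congrArg (diagonal k A)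
    (exph_C_mul_X_mul_exph_C_mul_X (k := k) (hcancel h) (hcancel h'))
  have hdiag (F : PowerSeries A) : diagonal k A (C F * X) = F * X := by
    simpa using diagonal_C_mul_X_pow (k := k) F 1
  rwa [map_mul, diagonal_exph (by simp), diagonal_exph (by simp), diagonal_exph (by simp), map_add,
    hdiag, hdiag, hdiag, diagonal_C_mul_X_pow, add_mul, smul_mul_assoc] at main

theorem exph_add [CharZero k] {Y Z : PowerSeries A} (hY : constantCoeff Y = 0)
    (hZ : constantCoeff Z = 0) (h : Commute Y Z) : exph k (Y + Z) = exph k Y * exph k Z := by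
  have hcomm : Y * Z - Z * Y = 0 := sub_eq_zero.2 h.eq
  rw [exph_mul_exph hY hZ (by rw [hcomm]; exact Commute.zero_left _)
    (by rw [hcomm]; exact Commute.zero_left _), hcomm, smul_zero, add_zero]

/-- The exponential of a series without constant term as an invertible element. -/
def exphUnit [CharZero k] {Y : PowerSeries A} (hY : constantCoeff Y = 0) : (PowerSeries A)ˣ where
  val := exph k Y
  inv := exph k (-Y)
  val_inv := by
    rw [← exph_add hY (by simpa using hY) (Commute.refl Y).neg_right, add_neg_cancel, exph_zero]
  inv_val := by
    rw [← exph_add (by simpa using hY) hY (Commute.refl Y).neg_left, neg_add_cancel, exph_zero]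

end Exponential

/-! ### Primitively generated bialgebras -/

section WordFiltration

variable {k A : Type*} [CommRing k] [Ring A] [Algebra k A]

/-- The filtration of an algebra by word length in `V`: the span of the products of at most `n`
elements of `V`. -/
def wordFil (V : Submodule k A) (n : ℕ) : Submodule k A := (1 ⊔ V) ^ n

/-- The step of the word filtration preceding the `n`-th one, which is zero for `n = 0`. -/
def wordFilPred (V : Submodule k A) : ℕ → Submodule k A
  | 0 => ⊥
  | n + 1 => wordFil V n

variable {V : Submodule k A}

theorem wordFil_mono {m n : ℕ} (h : m ≤ n) : wordFil V m ≤ wordFil V n :=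
  pow_le_pow_right₀ le_sup_left h

theorem wordFil_mul (m n : ℕ) : wordFil V m * wordFil V n = wordFil V (m + n) :=
  (pow_add _ m n).symm

theorem mul_mem_wordFil {m n : ℕ} {a b : A} (ha : a ∈ wordFil V m) (hb : b ∈ wordFil V n) :
    a * b ∈ wordFil V (m + n) :=
  wordFil_mul (V := V) m n ▸ Submodule.mul_mem_mul ha hb

theorem wordFil_one : wordFil V 1 = 1 ⊔ V := pow_one _

theorem le_wordFil_one : V ≤ wordFil V 1 := wordFil_one (V := V) ▸ le_sup_right

theorem mem_wordFil_zero {u : A} : u ∈ wordFil V 0 ↔ ∃ c : k, c • (1 : A) = u := by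
  simp [wordFil, Submodule.mem_one, Algebra.algebraMap_eq_smul_one]

theorem one_mem_wordFil (n : ℕ) : (1 : A) ∈ wordFil V n :=
  wordFil_mono n.zero_le (mem_wordFil_zero.2 ⟨1, one_smul k 1⟩)

theorem mul_mem_wordFil_succ {n : ℕ} {v u : A} (hv : v ∈ V) (hu : u ∈ wordFil V n) :
    v * u ∈ wordFil V (n + 1) :=
  add_comm 1 n ▸ mul_mem_wordFil (le_wordFil_one hv) hu

theorem wordFil_succ_le {n : ℕ} {W : Submodule k A} (hone : wordFil V n ≤ W)
    (hmul : ∀ v ∈ V, ∀ u ∈ wordFil V n, v * u ∈ W) : wordFil V (n + 1) ≤ W := by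
  rw [wordFil, pow_succ', ← wordFil, Submodule.sup_mul, one_mul]
  exact sup_le hone (Submodule.mul_le.2 hmul)

theorem wordFilPred_le (n : ℕ) : wordFilPred V n ≤ wordFil V n := by
  cases n with
  | zero => exact bot_le
  | succ n => exact wordFil_mono n.le_succ

theorem wordFilPred_mono {m n : ℕ} (h : m ≤ n) : wordFilPred V m ≤ wordFilPred V n := by
  rcases m with _ | m
  · exact bot_le
  · obtain ⟨n, rfl⟩ : ∃ l, n = l + 1 := ⟨n - 1, by omega⟩
    exact wordFil_mono (Nat.succ_le_succ_iff.1 h)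

theorem wordFil_mul_wordFilPred_le {i j n : ℕ} (h : i + j ≤ n) :
    wordFil V i * wordFilPred V j ≤ wordFilPred V n := by
  cases j with
  | zero => simp [wordFilPred]
  | succ j => exact (wordFil_mul i j).le.trans (wordFilPred_mono h)

theorem mul_mem_wordFil_of_mem_wordFilPred {n : ℕ} {v u : A} (hv : v ∈ V)
    (hu : u ∈ wordFilPred V n) : v * u ∈ wordFil V n :=
  wordFil_mul_wordFilPred_le (n := n + 1) (add_comm 1 n).le
    (Submodule.mul_mem_mul (le_wordFil_one hv) hu)

/-- The filtration of `A ⊗ A` by the total word length in `V`. -/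
def tensorWordFil (V : Submodule k A) (n : ℕ) : Submodule k (A ⊗[k] A) :=
  Submodule.span k
    {z | ∃ i j : ℕ, i + j ≤ n ∧ ∃ a ∈ wordFil V i, ∃ b ∈ wordFil V j, a ⊗ₜ[k] b = z}

theorem tmul_mem_tensorWordFil {i j n : ℕ} (h : i + j ≤ n) {a b : A} (ha : a ∈ wordFil V i)
    (hb : b ∈ wordFil V j) : a ⊗ₜ[k] b ∈ tensorWordFil V n :=
  Submodule.subset_span ⟨i, j, h, a, ha, b, hb, rfl⟩

theorem tensorWordFil_le {n : ℕ} {W : Submodule k (A ⊗[k] A)}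
    (h : ∀ i j : ℕ, i + j ≤ n → ∀ a ∈ wordFil V i, ∀ b ∈ wordFil V j, a ⊗ₜ[k] b ∈ W) :
    tensorWordFil V n ≤ W := by
  refine Submodule.span_le.2 ?_
  rintro _ ⟨i, j, hij, a, ha, b, hb, rfl⟩
  exact h i j hij a ha b hb

theorem tensorWordFil_mono {m n : ℕ} (h : m ≤ n) : tensorWordFil V m ≤ tensorWordFil V n :=
  tensorWordFil_le fun _ _ hij _ ha _ hb => tmul_mem_tensorWordFil (hij.trans h) ha hb

variable (k) in
/-- The linear map `a ⊗ b ↦ [v, a] b`. -/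
def commutatorMul (v : A) : A ⊗[k] A →ₗ[k] A :=
  LinearMap.mul' k A ∘ₗ
    TensorProduct.map (LinearMap.mulLeft k v - LinearMap.mulRight k v) LinearMap.id

theorem commutatorMul_tmul (v a b : A) :
    commutatorMul k v (a ⊗ₜ b) = (v * a - a * v) * b := by
  simp [commutatorMul]

theorem mul'_primitive_mul (v : A) (z : A ⊗[k] A) :
    LinearMap.mul' k A ((v ⊗ₜ[k] 1 + 1 ⊗ₜ v) * z) =
      (2 : k) • (v * LinearMap.mul' k A z) - commutatorMul k v z := by
  induction z with
  | zero => simp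
  | add x y hx hy => rw [mul_add, map_add, hx, hy, map_add, map_add, mul_add]; module
  | tmul a b =>
    simp only [add_mul, Algebra.TensorProduct.tmul_mul_tmul, one_mul, map_add,
      LinearMap.mul'_apply, commutatorMul_tmul, two_smul]
    noncomm_ring

end WordFiltration

section PrimitiveGeneration

open Coalgebra (comul counit)

section CommRing

variable {k A : Type*} [CommRing k] [Ring A] [Bialgebra k A]

variable (k) in
/-- Primitive elements of a bialgebra: `Δ(p) = p ⊗ 1 + 1 ⊗ p`. -/
def IsPrimitiveElem (p : A) : Prop := comul (R := k) p = p ⊗ₜ[k] 1 + 1 ⊗ₜ p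

/-- A bialgebra is primitively generated by `V` if `V` is a Lie algebra of primitive elements which
generates it as an algebra. -/
structure IsPrimitivelyGenerated (V : Submodule k A) : Prop where
  isPrimitiveElem : ∀ v ∈ V, IsPrimitiveElem k v
  commutator_mem : ∀ v ∈ V, ∀ w ∈ V, v * w - w * v ∈ V
  exhaust : ∀ u : A, ∃ n, u ∈ wordFil V n

theorem IsPrimitiveElem.counit_eq_zero {p : A} (hp : IsPrimitiveElem k p) :
    counit (R := k) p = 0 := by
  have hcounit := Coalgebra.rTensor_counit_comul (R := k) p
  rw [hp, map_add, LinearMap.rTensor_tmul, LinearMap.rTensor_tmul, Bialgebra.counit_one,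
    add_eq_right] at hcounit
  simpa using congrArg (counit ∘ₗ (TensorProduct.lid k A).toLinearMap) hcounit

variable (k A) in
/-- The second Adams operation `u ↦ u₁ u₂`. It multiplies primitive elements by `2` and, up to lower
terms, products of `n` primitive elements by `2 ^ n`. -/
def adams : A →ₗ[k] A := LinearMap.mul' k A ∘ₗ comul

theorem adams_apply (u : A) : adams k A u = LinearMap.mul' k A (comul u) := rfl

theorem IsPrimitiveElem.adams_eq {p : A} (hp : IsPrimitiveElem k p) :
    adams k A p = (2 : k) • p := by
  rw [adams_apply, hp]
  simp [two_smul]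

theorem adams_one : adams k A 1 = 1 := by simp [adams_apply, Algebra.TensorProduct.one_def]

variable {V : Submodule k A}

namespace IsPrimitivelyGenerated

variable (h : IsPrimitivelyGenerated V)
include h

theorem comul_mul {v : A} (hv : v ∈ V) (u : A) :
    comul (R := k) (v * u) = (v ⊗ₜ[k] 1 + 1 ⊗ₜ v) * comul (R := k) u := by
  rw [Bialgebra.comul_mul, h.isPrimitiveElem v hv]

theorem comul_mem_tensorWordFil {n : ℕ} {u : A} (hu : u ∈ wordFil V n) :
    comul (R := k) u ∈ tensorWordFil V n := by
  induction n generalizing u with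
  | zero =>
    obtain ⟨c, rfl⟩ := mem_wordFil_zero.1 hu
    rw [map_smul, Bialgebra.comul_one, Algebra.TensorProduct.one_def]
    exact Submodule.smul_mem _ _
      (tmul_mem_tensorWordFil (add_zero 0).le (one_mem_wordFil 0) (one_mem_wordFil 0))
  | succ n ih =>
    refine wordFil_succ_le (W := (tensorWordFil V (n + 1)).comap (comul (R := k)))
      (fun u hu => tensorWordFil_mono n.le_succ (ih hu)) (fun v hv u hu => ?_) hu
    rw [Submodule.mem_comap, h.comul_mul hv]
    refine tensorWordFil_le (V := V) (n := n) (W := (tensorWordFil V (n + 1)).comap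
      (LinearMap.mulLeft k (v ⊗ₜ[k] 1 + 1 ⊗ₜ v))) (fun i j hij a ha b hb => ?_) (ih hu)
    simp only [Submodule.mem_comap, LinearMap.mulLeft_apply, add_mul,
      Algebra.TensorProduct.tmul_mul_tmul, one_mul]
    exact Submodule.add_mem _
      (tmul_mem_tensorWordFil (by omega) (mul_mem_wordFil_succ hv ha) hb)
      (tmul_mem_tensorWordFil (by omega) ha (mul_mem_wordFil_succ hv hb))

theorem commutator_mem_wordFil {n : ℕ} {v u : A} (hv : v ∈ V) (hu : u ∈ wordFil V n) :
    v * u - u * v ∈ wordFil V n := by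
  induction n generalizing u with
  | zero =>
    obtain ⟨c, rfl⟩ := mem_wordFil_zero.1 hu
    simp
  | succ n ih =>
    refine wordFil_succ_le
      (W := (wordFil V (n + 1)).comap (LinearMap.mulLeft k v - LinearMap.mulRight k v))
      (fun u hu => wordFil_mono n.le_succ (ih hu)) (fun w hw u hu => ?_) hu
    have hleibniz : v * (w * u) - w * u * v = (v * w - w * v) * u + w * (v * u - u * v) := by
      noncomm_ring
    rw [Submodule.mem_comap, LinearMap.sub_apply, LinearMap.mulLeft_apply,
      LinearMap.mulRight_apply, hleibniz]
    exact Submodule.add_mem _ (mul_mem_wordFil_succ (h.commutator_mem v hv w hw) hu)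
      (mul_mem_wordFil_succ hw (ih hu))

theorem commutatorMul_comul_mem {n : ℕ} {v u : A} (hv : v ∈ V) (hu : u ∈ wordFil V n) :
    commutatorMul k v (comul u) ∈ wordFil V n := by
  refine tensorWordFil_le (W := (wordFil V n).comap (commutatorMul k v))
    (fun i j hij a ha b hb => ?_) (h.comul_mem_tensorWordFil hu)
  rw [Submodule.mem_comap, commutatorMul_tmul]
  exact wordFil_mono hij (mul_mem_wordFil (h.commutator_mem_wordFil hv ha) hb)

theorem adams_sub_mem {n : ℕ} {u : A} (hu : u ∈ wordFil V n) :
    adams k A u - (2 : k) ^ n • u ∈ wordFilPred V n := by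
  induction n generalizing u with
  | zero =>
    obtain ⟨c, rfl⟩ := mem_wordFil_zero.1 hu
    simp [adams_one]
  | succ n ih =>
    refine wordFil_succ_le
      (W := (wordFil V n).comap (adams k A - (2 : k) ^ (n + 1) • LinearMap.id))
      (fun u hu => ?_) (fun v hv u hu => ?_) hu
    · have hadams : adams k A u ∈ wordFil V n :=
        ((wordFil V n).sub_mem_iff_left ((wordFil V n).smul_mem ((2 : k) ^ n) hu)).1
          (wordFilPred_le n (ih hu))
      exact (wordFil V n).sub_mem hadams ((wordFil V n).smul_mem ((2 : k) ^ (n + 1)) hu)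
    · have hmul : adams k A (v * u) - (2 : k) ^ (n + 1) • (v * u) =
          (2 : k) • (v * (adams k A u - (2 : k) ^ n • u)) - commutatorMul k v (comul u) := by
        rw [adams_apply, h.comul_mul hv, mul'_primitive_mul, ← adams_apply, mul_sub,
          mul_smul_comm, pow_succ']
        module
      change adams k A (v * u) - (2 : k) ^ (n + 1) • (v * u) ∈ wordFil V n
      rw [hmul]
      exact (wordFil V n).sub_mem
        ((wordFil V n).smul_mem _ (mul_mem_wordFil_of_mem_wordFilPred hv (ih hu)))
        (h.commutatorMul_comul_mem hv hu)

end IsPrimitivelyGenerated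

end CommRing

theorem two_sub_two_pow_ne_zero {k : Type*} [Ring k] [CharZero k] (n : ℕ) :
    (2 : k) - 2 ^ (n + 2) ≠ 0 := by
  rw [sub_ne_zero]
  exact_mod_cast (Nat.pow_lt_pow_right one_lt_two (by omega : 1 < n + 2)).ne

theorem IsPrimitivelyGenerated.mem_of_isPrimitiveElem {k A : Type*} [Field k] [CharZero k] [Ring A]
    [Bialgebra k A] {V : Submodule k A} (h : IsPrimitivelyGenerated V) {p : A}
    (hp : IsPrimitiveElem k p) : p ∈ V := by
  have hdescend (n : ℕ) (hn : p ∈ wordFil V (n + 2)) : p ∈ wordFil V (n + 1) := by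
    have hlower := h.adams_sub_mem hn
    rw [hp.adams_eq, ← sub_smul] at hlower
    exact (Submodule.smul_mem_iff _ (two_sub_two_pow_ne_zero n)).1 hlower
  have hone (n : ℕ) : p ∈ wordFil V (n + 1) → p ∈ wordFil V 1 := by
    induction n with
    | zero => exact id
    | succ n ih => exact fun hn => ih (hdescend n hn)
  obtain ⟨n, hn⟩ := h.exhaust p
  have hsup := hone n (wordFil_mono n.le_succ hn)
  rw [wordFil_one] at hsup
  obtain ⟨c, hc, v, hv, hcv⟩ := Submodule.mem_sup.1 hsup
  obtain ⟨c, rfl⟩ := Submodule.mem_one.1 hc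
  have hc0 := congrArg (counit (R := k)) hcv
  rw [map_add, (h.isPrimitiveElem v hv).counit_eq_zero, hp.counit_eq_zero, add_zero,
    Bialgebra.counit_algebraMap] at hc0
  rw [hc0, map_zero, zero_add] at hcv
  exact hcv ▸ hv

end PrimitiveGeneration

section Contraction

open Coalgebra (comul counit IsCocomm)

variable {k A : Type*} [CommRing k]

/-- The contraction `a ⊗ b ↦ φ(a) b` of the left tensor factor with a functional `φ`. -/
def contractLeft {M N : Type*} [AddCommGroup M] [Module k M] [AddCommGroup N] [Module k N]
    (φ : M →ₗ[k] k) : M ⊗[k] N →ₗ[k] N :=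
  (TensorProduct.lid k N).toLinearMap ∘ₗ φ.rTensor N

@[simp]
theorem contractLeft_tmul {M N : Type*} [AddCommGroup M] [Module k M] [AddCommGroup N] [Module k N]
    (φ : M →ₗ[k] k) (a : M) (b : N) : contractLeft φ (a ⊗ₜ[k] b) = φ a • b := by
  simp [contractLeft]

section Coalgebra

variable [AddCommGroup A] [Module k A] [Coalgebra k A]

/-- The operator `u ↦ φ(u₁) u₂` of contraction with a functional `φ`. For `φ(1) = 0` it behaves like
a differential operator lowering the word length. -/
def contract (φ : A →ₗ[k] k) : Module.End k A := contractLeft φ ∘ₗ comul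

theorem contract_apply (φ : A →ₗ[k] k) (u : A) : contract φ u = contractLeft φ (comul u) := rfl

theorem contract_add_smul (φ χ : A →ₗ[k] k) (t : k) :
    contract (φ + t • χ) = contract φ + t • contract χ := by
  have hleft : contractLeft (N := A) (φ + t • χ) = contractLeft φ + t • contractLeft χ := by
    ext a b
    simp [add_smul, mul_smul]
  ext u
  simp [contract, hleft]

theorem contractLeft_counit_comul (u : A) : contractLeft (counit (R := k)) (comul u) = u := by
  simp [contractLeft]

theorem contract_mul_contract (φ χ : A →ₗ[k] k) :
    contract φ * contract χ = contract (LinearMap.mul' k k ∘ₗ TensorProduct.map χ φ ∘ₗ comul) := by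
  have hcontract : contract φ ∘ₗ contractLeft χ =
      contractLeft χ ∘ₗ (contractLeft φ).lTensor A ∘ₗ comul.lTensor A := by
    ext a b
    simp [contract]
  have hassoc : contractLeft χ ∘ₗ (contractLeft φ).lTensor A ∘ₗ
      (TensorProduct.assoc k A A A).toLinearMap =
        contractLeft (LinearMap.mul' k k ∘ₗ TensorProduct.map χ φ) := by
    ext a b c
    simp [mul_smul, smul_comm (φ b)]
  have hcomp : contractLeft (N := A) (LinearMap.mul' k k ∘ₗ TensorProduct.map χ φ) ∘ₗ
      comul.rTensor A = contractLeft (LinearMap.mul' k k ∘ₗ TensorProduct.map χ φ ∘ₗ comul) := by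
    ext a b
    simp
  ext u
  calc contract φ (contractLeft χ (comul u))
      = contractLeft χ ((contractLeft φ).lTensor A (comul.lTensor A (comul u))) :=
        LinearMap.congr_fun hcontract _
    _ = contractLeft χ ((contractLeft φ).lTensor A
          (TensorProduct.assoc k A A A (comul.rTensor A (comul u)))) := by
        rw [Coalgebra.coassoc_apply]
    _ = contractLeft (LinearMap.mul' k k ∘ₗ TensorProduct.map χ φ)
          (comul.rTensor A (comul u)) := LinearMap.congr_fun hassoc _
    _ = _ := LinearMap.congr_fun hcomp _

theorem commute_contract [IsCocomm k A] (φ χ : A →ₗ[k] k) :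
    Commute (contract φ) (contract χ) := by
  have hswap : LinearMap.mul' k k ∘ₗ TensorProduct.map χ φ =
      LinearMap.mul' k k ∘ₗ TensorProduct.map φ χ ∘ₗ (TensorProduct.comm k A A).toLinearMap := by
    ext a b
    simp [mul_comm]
  have hconv : LinearMap.mul' k k ∘ₗ TensorProduct.map χ φ ∘ₗ comul (R := k) (A := A) =
      LinearMap.mul' k k ∘ₗ TensorProduct.map φ χ ∘ₗ comul := by
    ext u
    simpa [Coalgebra.comm_comul] using LinearMap.congr_fun hswap (comul u)
  rw [Commute, SemiconjBy, contract_mul_contract, contract_mul_contract, hconv]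

open Polynomial

/-- The polynomial in `t` with value `ε(D ^ m u)` at `t`, where `D` is the contraction with
`φ + t χ`. -/
def contractPolynomial (φ χ : A →ₗ[k] k) (m : ℕ) (u : A) : k[X] :=
  ∑ j ∈ Finset.range (m + 1), C ((m.choose j : k) *
    counit (R := k) ((contract φ ^ (m - j)) ((contract χ ^ j) u))) * X ^ j

theorem eval_contractPolynomial [IsCocomm k A] (φ χ : A →ₗ[k] k) (m : ℕ) (u : A) (t : k) :
    (contractPolynomial φ χ m u).eval t =
      counit (R := k) ((contract (φ + t • χ) ^ m) u) := by
  have hcomm : Commute (t • contract χ) (contract φ) := (commute_contract χ φ).smul_left t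
  rw [contractPolynomial, contract_add_smul, add_comm (contract φ), hcomm.add_pow,
    eval_finsetSum, LinearMap.sum_apply, map_sum]
  refine Finset.sum_congr rfl fun j _ => ?_
  rw [(hcomm.pow_pow j (m - j)).eq, _root_.smul_pow, ← Nat.cast_comm, ← nsmul_eq_mul]
  simp only [eval_mul, eval_C, eval_pow, eval_X, mul_smul_comm, LinearMap.smul_apply,
    Module.End.mul_apply, Module.End.natCast_apply, map_nsmul, map_smul, smul_eq_mul, nsmul_eq_mul]
  ring

theorem coeff_contractPolynomial (φ χ : A →ₗ[k] k) {m j : ℕ} (u : A) (hj : j ≤ m) :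
    (contractPolynomial φ χ m u).coeff j =
      m.choose j * counit (R := k) ((contract φ ^ (m - j)) ((contract χ ^ j) u)) := by
  simp only [contractPolynomial, finsetSum_coeff, coeff_C_mul_X_pow, Finset.sum_ite_eq,
    Finset.mem_range, Nat.lt_succ_of_le hj, if_true]

end Coalgebra

section Bialgebra

variable [Ring A] [Bialgebra k A]

/-- The failure of the Leibniz rule for `contractLeft φ`, with the remaining factors contracted by
the counit. -/
def leibnizDefect (φ : A →ₗ[k] k) : A ⊗[k] A →ₗ[k] A ⊗[k] A →ₗ[k] A :=
  (LinearMap.mul k (A ⊗[k] A)).compr₂ (contractLeft φ) -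
    (LinearMap.mul k A).compl₁₂ (contractLeft φ) (contractLeft (counit (R := k))) -
    (LinearMap.mul k A).compl₁₂ (contractLeft (counit (R := k))) (contractLeft φ)

theorem leibnizDefect_tmul (φ : A →ₗ[k] k) (a b a' b' : A) :
    leibnizDefect φ (a ⊗ₜ b) (a' ⊗ₜ b') =
      (φ (a * a') - φ a * counit (R := k) a' - counit (R := k) a * φ a') • (b * b') := by
  simp only [leibnizDefect, LinearMap.sub_apply, LinearMap.compr₂_apply, LinearMap.mul_apply',
    LinearMap.compl₁₂_apply, Algebra.TensorProduct.tmul_mul_tmul, contractLeft_tmul,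
    smul_mul_assoc, mul_smul_comm]
  module

theorem leibnizDefect_comul (φ : A →ₗ[k] k) (u v : A) :
    leibnizDefect φ (comul u) (comul v) =
      contract φ (u * v) - contract φ u * v - u * contract φ v := by
  simp only [leibnizDefect, LinearMap.sub_apply, LinearMap.compr₂_apply, LinearMap.mul_apply',
    LinearMap.compl₁₂_apply, contractLeft_counit_comul, ← Bialgebra.comul_mul, contract_apply]

variable {V : Submodule k A}

theorem leibnizDefect_mem {φ : A →ₗ[k] k} (hφ : φ 1 = 0) {m n : ℕ} {z z' : A ⊗[k] A}
    (hz : z ∈ tensorWordFil V (m + 1)) (hz' : z' ∈ tensorWordFil V (n + 1)) :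
    leibnizDefect φ z z' ∈ wordFil V (m + n) := by
  refine tensorWordFil_le (W := (wordFil V (m + n)).comap (leibnizDefect φ z))
    (fun i' j' hij' a' ha' b' hb' => ?_) hz'
  refine tensorWordFil_le (W := (wordFil V (m + n)).comap ((leibnizDefect φ).flip (a' ⊗ₜ b')))
    (fun i j hij a ha b hb => ?_) hz
  rw [Submodule.mem_comap, LinearMap.flip_apply, leibnizDefect_tmul]
  rcases i with _ | i
  · obtain ⟨c, rfl⟩ := mem_wordFil_zero.1 ha
    simp [hφ]
  · rcases i' with _ | i'
    · obtain ⟨c, rfl⟩ := mem_wordFil_zero.1 ha'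
      simp [hφ, mul_comm]
    · exact Submodule.smul_mem _ _ (wordFil_mono (by omega) (mul_mem_wordFil hb hb'))

theorem eq_zero_of_counit_eq_zero {u : A} (hu : u ∈ wordFil V 0) (hcounit : counit (R := k) u = 0) :
    u = 0 := by
  obtain ⟨c, rfl⟩ := mem_wordFil_zero.1 hu
  obtain rfl : c = 0 := by simpa using hcounit
  exact zero_smul k 1

namespace IsPrimitivelyGenerated

variable (h : IsPrimitivelyGenerated V)
include h

theorem contract_mem {φ : A →ₗ[k] k} (hφ : φ 1 = 0) {n : ℕ} {u : A} (hu : u ∈ wordFil V n) :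
    contract φ u ∈ wordFilPred V n := by
  refine tensorWordFil_le (W := (wordFilPred V n).comap (contractLeft φ))
    (fun i j hij a ha b hb => ?_) (h.comul_mem_tensorWordFil hu)
  rw [Submodule.mem_comap, contractLeft_tmul]
  rcases i with _ | i
  · obtain ⟨c, rfl⟩ := mem_wordFil_zero.1 ha
    simp [hφ]
  · exact Submodule.smul_mem _ _ (wordFilPred_mono (m := j + 1) (by omega) hb)

theorem contract_pow_mem {φ : A →ₗ[k] k} (hφ : φ 1 = 0) {n : ℕ} {u : A} (m : ℕ)
    (hu : u ∈ wordFil V (n + m)) : (contract φ ^ m) u ∈ wordFil V n := by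
  induction m generalizing u with
  | zero => simpa using hu
  | succ m ih =>
    rw [pow_succ, Module.End.mul_apply]
    exact ih (h.contract_mem hφ hu)

theorem contract_pow_eq_zero {φ : A →ₗ[k] k} (hφ : φ 1 = 0) {n : ℕ} {u : A}
    (hu : u ∈ wordFilPred V n) : (contract φ ^ n) u = 0 := by
  rcases n with _ | n
  · simpa [wordFilPred] using hu
  · have hzero : (contract φ ^ n) u ∈ wordFil V 0 :=
      h.contract_pow_mem hφ n (by rw [zero_add]; exact hu)
    rw [pow_succ', Module.End.mul_apply]
    simpa [wordFilPred] using h.contract_mem hφ hzero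

theorem contract_mul_sub_mem {φ : A →ₗ[k] k} (hφ : φ 1 = 0) {m n : ℕ} {u v : A}
    (hu : u ∈ wordFil V (m + 1)) (hv : v ∈ wordFil V (n + 1)) :
    contract φ (u * v) - contract φ u * v - u * contract φ v ∈ wordFil V (m + n) :=
  leibnizDefect_comul φ u v ▸
    leibnizDefect_mem hφ (h.comul_mem_tensorWordFil hu) (h.comul_mem_tensorWordFil hv)

theorem contract_pow_mul {φ : A →ₗ[k] k} (hφ : φ 1 = 0) {m n : ℕ} {u v : A}
    (hu : u ∈ wordFil V m) (hv : v ∈ wordFil V n) :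
    (contract φ ^ (m + n)) (u * v) =
      ((m + n).choose m : k) • ((contract φ ^ m) u * (contract φ ^ n) v) := by
  obtain ⟨N, hN⟩ : ∃ N, m + n = N := ⟨_, rfl⟩
  induction N generalizing m n u v with
  | zero =>
    obtain ⟨rfl, rfl⟩ : m = 0 ∧ n = 0 := by omega
    simp
  | succ N ih =>
    rcases m with _ | m
    · obtain ⟨c, rfl⟩ := mem_wordFil_zero.1 hu
      simp
    rcases n with _ | n
    · obtain ⟨c, rfl⟩ := mem_wordFil_zero.1 hv
      simp
    obtain ⟨w, hw, hleibniz⟩ : ∃ w ∈ wordFilPred V (m + n + 1),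
        contract φ (u * v) = contract φ u * v + u * contract φ v + w :=
      ⟨_, h.contract_mul_sub_mem hφ hu hv, by abel⟩
    have hleft := ih (h.contract_mem hφ hu) hv (by omega : m + (n + 1) = N)
    have hright := ih hu (h.contract_mem hφ hv) (by omega : m + 1 + n = N)
    rw [← Module.End.mul_apply, ← pow_succ] at hleft hright
    rw [show m + (n + 1) = m + n + 1 by omega] at hleft
    rw [show m + 1 + n = m + n + 1 by omega] at hright
    rw [show m + 1 + (n + 1) = m + n + 1 + 1 by omega, pow_succ, Module.End.mul_apply, hleibniz,
      map_add, map_add, h.contract_pow_eq_zero hφ hw, hleft, hright, add_zero,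
      Nat.choose_succ_succ' (m + n + 1), Nat.cast_add, add_smul]

end IsPrimitivelyGenerated

end Bialgebra

end Contraction

section Units

open Coalgebra (comul counit IsCocomm)

variable {k A : Type*} [Field k] [Ring A] [Bialgebra k A] {V : Submodule k A}

theorem mul'_map_subtype_mem_mul {W : Submodule k A} {y : V ⊗[k] A}
    (hy : ∀ φ : V →ₗ[k] k, contractLeft φ y ∈ W) :
    LinearMap.mul' k A (V.subtype.rTensor A y) ∈ V * W := by
  classical
  let b := Module.Free.chooseBasis k V
  obtain ⟨c, rfl⟩ := TensorProduct.eq_repr_basis_left b y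
  have hc (i : Module.Free.ChooseBasisIndex k V) : c i ∈ W := by
    have hcoord := hy (b.coord i)
    simp only [Finsupp.sum, map_sum, contractLeft_tmul, Module.Basis.coord_apply,
      Module.Basis.repr_self, Finsupp.single_apply, ite_smul, one_smul, zero_smul,
      Finset.sum_ite_eq', Finsupp.mem_support_iff] at hcoord
    by_cases hi : c i = 0
    · rw [hi]
      exact W.zero_mem
    · simpa [hi] using hcoord
  simp only [Finsupp.sum, map_sum, LinearMap.rTensor_tmul, LinearMap.mul'_apply,
    Submodule.subtype_apply]
  exact Submodule.sum_mem _ fun i _ => Submodule.mul_mem_mul (b i).2 (hc i)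

/-- The operator `u ↦ p(u₁) u₂`. For a projection `p` onto `V`, it multiplies products of `n`
elements of `V` by `n`, up to lower terms. -/
def numberOperator (p : A →ₗ[k] V) : A →ₗ[k] A :=
  LinearMap.mul' k A ∘ₗ (V.subtype ∘ₗ p).rTensor A ∘ₗ comul

/-- The failure of `numberOperator p` to increase by one under multiplication by `v`, as a map of
the coproduct. -/
def numberDefect (p : A →ₗ[k] V) (v : A) : A ⊗[k] A →ₗ[k] A :=
  LinearMap.mul' k A ∘ₗ (V.subtype ∘ₗ p).rTensor A ∘ₗ LinearMap.mulLeft k (v ⊗ₜ[k] 1 + 1 ⊗ₜ v) -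
    LinearMap.mulLeft k v ∘ₗ contractLeft (counit (R := k)) -
    LinearMap.mulLeft k v ∘ₗ LinearMap.mul' k A ∘ₗ (V.subtype ∘ₗ p).rTensor A

theorem numberDefect_tmul (p : A →ₗ[k] V) (v a b : A) :
    numberDefect p v (a ⊗ₜ b) =
      p (v * a) * b + (p a * v - v * p a : A) * b - counit (R := k) a • (v * b) := by
  simp only [numberDefect, LinearMap.sub_apply, LinearMap.comp_apply, LinearMap.mulLeft_apply,
    add_mul, Algebra.TensorProduct.tmul_mul_tmul, one_mul, map_add, LinearMap.rTensor_tmul,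
    LinearMap.mul'_apply, Submodule.subtype_apply, contractLeft_tmul, mul_smul_comm]
  noncomm_ring

theorem numberOperator_one {p : A →ₗ[k] V} (hp1 : p 1 = 0) : numberOperator p 1 = 0 := by
  simp [numberOperator, hp1, Algebra.TensorProduct.one_def]

namespace IsPrimitivelyGenerated

variable (h : IsPrimitivelyGenerated V)
include h

theorem exists_projection : ∃ p : A →ₗ[k] V, p 1 = 0 ∧ ∀ v : V, p v = v := by
  obtain ⟨q, hq⟩ := V.subtype.exists_leftInverse_of_injective (by simp)
  refine ⟨q ∘ₗ (LinearMap.id - (counit (R := k)).smulRight (1 : A)), by simp, fun v => ?_⟩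
  simpa [(h.isPrimitiveElem v v.2).counit_eq_zero] using LinearMap.congr_fun hq v

theorem numberOperator_mul (p : A →ₗ[k] V) {v : A} (hv : v ∈ V) (u : A) :
    numberOperator p (v * u) = v * u + v * numberOperator p u + numberDefect p v (comul u) := by
  simp only [numberOperator, numberDefect, LinearMap.sub_apply, LinearMap.comp_apply,
    LinearMap.mulLeft_apply, contractLeft_counit_comul, h.comul_mul hv]
  abel

theorem numberDefect_comul_mem {p : A →ₗ[k] V} (hp1 : p 1 = 0) (hp : ∀ v : V, p v = v) {n : ℕ}
    {v u : A} (hv : v ∈ V) (hu : u ∈ wordFil V n) : numberDefect p v (comul u) ∈ wordFil V n := by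
  refine tensorWordFil_le (W := (wordFil V n).comap (numberDefect p v))
    (fun i j hij a ha b hb => ?_) (h.comul_mem_tensorWordFil hu)
  rw [Submodule.mem_comap, numberDefect_tmul]
  rcases i with _ | i
  · obtain ⟨c, rfl⟩ := mem_wordFil_zero.1 ha
    simp [hp1, hp ⟨v, hv⟩]
  · have hmul {w : A} (hw : w ∈ V) : w * b ∈ wordFil V n :=
      wordFil_mono (by omega) (mul_mem_wordFil_succ hw hb)
    exact (wordFil V n).sub_mem ((wordFil V n).add_mem (hmul (p (v * a)).2)
      (hmul (h.commutator_mem _ (p a).2 _ hv))) ((wordFil V n).smul_mem _ (hmul hv))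

theorem numberOperator_sub_mem {p : A →ₗ[k] V} (hp1 : p 1 = 0) (hp : ∀ v : V, p v = v) {n : ℕ}
    {u : A} (hu : u ∈ wordFil V n) : numberOperator p u - (n : k) • u ∈ wordFilPred V n := by
  induction n generalizing u with
  | zero =>
    obtain ⟨c, rfl⟩ := mem_wordFil_zero.1 hu
    simp [numberOperator_one hp1]
  | succ n ih =>
    refine wordFil_succ_le
      (W := (wordFil V n).comap (numberOperator p - ((n + 1 : ℕ) : k) • LinearMap.id))
      (fun u hu => ?_) (fun v hv u hu => ?_) hu
    · have hnumber : numberOperator p u ∈ wordFil V n :=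
        ((wordFil V n).sub_mem_iff_left ((wordFil V n).smul_mem (n : k) hu)).1
          (wordFilPred_le n (ih hu))
      exact (wordFil V n).sub_mem hnumber ((wordFil V n).smul_mem ((n + 1 : ℕ) : k) hu)
    · have hmul : numberOperator p (v * u) - ((n + 1 : ℕ) : k) • (v * u) =
          v * (numberOperator p u - (n : k) • u) + numberDefect p v (comul u) := by
        rw [h.numberOperator_mul p hv, mul_sub, mul_smul_comm]
        push_cast
        module
      change numberOperator p (v * u) - ((n + 1 : ℕ) : k) • (v * u) ∈ wordFil V n
      rw [hmul]
      exact (wordFil V n).add_mem (mul_mem_wordFil_of_mem_wordFilPred hv (ih hu))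
        (h.numberDefect_comul_mem hp1 hp hv hu)

theorem mem_wordFil_of_contract_mem [CharZero k] {m : ℕ} {u : A} (hu : u ∈ wordFil V (m + 1))
    (hcontract : ∀ φ : A →ₗ[k] k, φ 1 = 0 → contract φ u ∈ wordFilPred V m) :
    u ∈ wordFil V m := by
  obtain ⟨p, hp1, hp⟩ := h.exists_projection
  have hmem : numberOperator p u ∈ V * wordFilPred V m := by
    rw [numberOperator, LinearMap.comp_apply, LinearMap.comp_apply, LinearMap.rTensor_comp_apply]
    refine mul'_map_subtype_mem_mul fun φ => ?_
    have hcomp : contractLeft φ (p.rTensor A (comul u)) = contract (φ ∘ₗ p) u := by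
      rw [contract_apply, contractLeft, contractLeft, LinearMap.rTensor_comp]
      rfl
    rw [hcomp]
    exact hcontract _ (by simp [hp1])
  have hle : V * wordFilPred V m ≤ wordFil V m :=
    Submodule.mul_le.2 fun v hv w hw => mul_mem_wordFil_of_mem_wordFilPred hv hw
  have hsmul := (wordFil V m).sub_mem (hle hmem) (h.numberOperator_sub_mem hp1 hp hu)
  rw [sub_sub_cancel] at hsmul
  exact (Submodule.smul_mem_iff _ (by exact_mod_cast m.succ_ne_zero)).1 hsmul

/-- By polarization: the coefficient of `t` in `contractPolynomial φ χ (m + 1) u` is a multiple of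
`ε(contract φ ^ m (contract χ u))`. -/
theorem mem_wordFilPred_of_contract_pow_eq_zero [CharZero k] [IsCocomm k A] {m : ℕ} {u : A}
    (hu : u ∈ wordFil V m) (hcontract : ∀ φ : A →ₗ[k] k, φ 1 = 0 → (contract φ ^ m) u = 0) :
    u ∈ wordFilPred V m := by
  induction m generalizing u with
  | zero => simpa [wordFilPred] using hcontract 0 rfl
  | succ m ih =>
    refine h.mem_wordFil_of_contract_mem hu fun χ hχ => ih (h.contract_mem hχ hu) fun φ hφ => ?_
    have hpoly : contractPolynomial φ χ (m + 1) u = 0 := Polynomial.funext fun t => by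
      rw [eval_contractPolynomial, hcontract _ (by simp [hφ, hχ]), map_zero, Polynomial.eval_zero]
    have hcoeff := coeff_contractPolynomial φ χ u (Nat.le_add_left 1 m)
    rw [hpoly, Polynomial.coeff_zero, Nat.choose_one_right, Nat.add_sub_cancel, pow_one, eq_comm,
      mul_eq_zero_iff_left (by exact_mod_cast m.succ_ne_zero)] at hcoeff
    exact eq_zero_of_counit_eq_zero
      (h.contract_pow_mem hφ m (by rw [zero_add]; exact h.contract_mem hχ hu)) hcoeff

theorem contractPolynomial_ne_zero_left {φ : A →ₗ[k] k} (hφ : φ 1 = 0) (χ : A →ₗ[k] k) {m : ℕ}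
    {u : A} (hu : u ∈ wordFil V m) (hne : (contract φ ^ m) u ≠ 0) :
    contractPolynomial φ χ m u ≠ 0 := by
  intro hpoly
  have hcoeff := coeff_contractPolynomial φ χ u m.zero_le
  simp only [hpoly, Polynomial.coeff_zero, Nat.choose_zero_right, Nat.cast_one, one_mul, pow_zero,
    Module.End.one_apply, Nat.sub_zero] at hcoeff
  exact hne (eq_zero_of_counit_eq_zero (h.contract_pow_mem hφ m (by simpa using hu)) hcoeff.symm)

theorem contractPolynomial_ne_zero_right (φ : A →ₗ[k] k) {χ : A →ₗ[k] k} (hχ : χ 1 = 0) {m : ℕ}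
    {u : A} (hu : u ∈ wordFil V m) (hne : (contract χ ^ m) u ≠ 0) :
    contractPolynomial φ χ m u ≠ 0 := by
  intro hpoly
  have hcoeff := coeff_contractPolynomial φ χ u le_rfl (m := m)
  simp only [hpoly, Polynomial.coeff_zero, Nat.choose_self, Nat.cast_one, one_mul, pow_zero,
    Module.End.one_apply, Nat.sub_self] at hcoeff
  exact hne (eq_zero_of_counit_eq_zero (h.contract_pow_mem hχ m (by simpa using hu)) hcoeff.symm)

theorem exists_counit_contract_pow_ne_zero [CharZero k] [IsCocomm k A] {m n : ℕ} {u v : A}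
    (hu : u ∈ wordFil V m) (hv : v ∈ wordFil V n) (hu' : u ∉ wordFilPred V m)
    (hv' : v ∉ wordFilPred V n) : ∃ ψ : A →ₗ[k] k, ψ 1 = 0 ∧
      counit (R := k) ((contract ψ ^ m) u) ≠ 0 ∧ counit (R := k) ((contract ψ ^ n) v) ≠ 0 := by
  obtain ⟨φ, hφ, hφu⟩ : ∃ φ : A →ₗ[k] k, φ 1 = 0 ∧ (contract φ ^ m) u ≠ 0 := by
    by_contra! hcon
    exact hu' (h.mem_wordFilPred_of_contract_pow_eq_zero hu hcon)
  obtain ⟨χ, hχ, hχv⟩ : ∃ χ : A →ₗ[k] k, χ 1 = 0 ∧ (contract χ ^ n) v ≠ 0 := by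
    by_contra! hcon
    exact hv' (h.mem_wordFilPred_of_contract_pow_eq_zero hv hcon)
  have hprod : contractPolynomial φ χ m u * contractPolynomial φ χ n v ≠ 0 :=
    mul_ne_zero (h.contractPolynomial_ne_zero_left hφ χ hu hφu)
      (h.contractPolynomial_ne_zero_right φ hχ hv hχv)
  obtain ⟨t, ht⟩ : ∃ t, (contractPolynomial φ χ m u * contractPolynomial φ χ n v).eval t ≠ 0 := by
    by_contra! hcon
    exact hprod (Polynomial.funext fun t => by rw [hcon t, Polynomial.eval_zero])
  rw [Polynomial.eval_mul, eval_contractPolynomial, eval_contractPolynomial] at ht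
  exact ⟨φ + t • χ, by simp [hφ, hχ], left_ne_zero_of_mul ht, right_ne_zero_of_mul ht⟩

theorem mul_notMem_wordFilPred [CharZero k] [IsCocomm k A] {m n : ℕ} {u v : A}
    (hu : u ∈ wordFil V m) (hv : v ∈ wordFil V n) (hu' : u ∉ wordFilPred V m)
    (hv' : v ∉ wordFilPred V n) : u * v ∉ wordFilPred V (m + n) := by
  obtain ⟨ψ, hψ, hψu, hψv⟩ := h.exists_counit_contract_pow_ne_zero hu hv hu' hv'
  intro hmem
  have hcounit := congrArg (counit (R := k)) (h.contract_pow_mul hψ hu hv)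
  rw [h.contract_pow_eq_zero hψ hmem, map_zero, map_smul, Bialgebra.counit_mul, smul_eq_mul,
    eq_comm] at hcounit
  refine mul_ne_zero ?_ (mul_ne_zero hψu hψv) hcounit
  exact_mod_cast (Nat.choose_pos (m.le_add_right n)).ne'

theorem exists_mem_wordFil_notMem_wordFilPred {u : A} (hu : u ≠ 0) :
    ∃ n, u ∈ wordFil V n ∧ u ∉ wordFilPred V n := by
  classical
  refine ⟨Nat.find (h.exhaust u), Nat.find_spec (h.exhaust u), fun hmem => ?_⟩
  rcases hn : Nat.find (h.exhaust u) with _ | n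
  · rw [hn] at hmem
    exact hu (by simpa [wordFilPred] using hmem)
  · rw [hn] at hmem
    exact Nat.find_min (h.exhaust u) (by omega) hmem

theorem exists_smul_one_of_mul_eq_one [CharZero k] [IsCocomm k A] {u v : A} (huv : u * v = 1) :
    ∃ c : k, c • (1 : A) = u := by
  have : Nontrivial A := (Bialgebra.counitAlgHom k A).toRingHom.domain_nontrivial
  obtain ⟨m, hm, hm'⟩ := h.exists_mem_wordFil_notMem_wordFilPred
    (left_ne_zero_of_mul (huv ▸ one_ne_zero))
  obtain ⟨n, hn, hn'⟩ := h.exists_mem_wordFil_notMem_wordFilPred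
    (right_ne_zero_of_mul (huv ▸ one_ne_zero))
  have hone := h.mul_notMem_wordFilPred hm hn hm' hn'
  rw [huv] at hone
  rcases m with _ | m
  · exact mem_wordFil_zero.1 hm
  · exact absurd (wordFilPred_mono (m := 1) (by omega) (one_mem_wordFil 0)) hone

end IsPrimitivelyGenerated

end Units

section TensorSquare

variable {k : Type*} {A : Type*} [CommRing k] [Ring A] [Bialgebra k A] {V : Submodule k A}

open Coalgebra (comul)

theorem isPrimitivelyGenerated_of_adjoin (hprim : ∀ v ∈ V, IsPrimitiveElem k v)
    (hcomm : ∀ v ∈ V, ∀ w ∈ V, v * w - w * v ∈ V) (htop : Algebra.adjoin k (V : Set A) = ⊤) :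
    IsPrimitivelyGenerated V := by
  refine ⟨hprim, hcomm, fun u => ?_⟩
  have hu : u ∈ Algebra.adjoin k (V : Set A) := htop ▸ Algebra.mem_top
  induction hu using Algebra.adjoin_induction with
  | mem v hv => exact ⟨1, le_wordFil_one hv⟩
  | algebraMap c => exact ⟨0, mem_wordFil_zero.2 ⟨c, (Algebra.algebraMap_eq_smul_one c).symm⟩⟩
  | add a b _ _ ha hb =>
    obtain ⟨m, hm⟩ := ha
    obtain ⟨n, hn⟩ := hb
    exact ⟨m + n, Submodule.add_mem _ (wordFil_mono (by omega) hm) (wordFil_mono (by omega) hn)⟩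
  | mul a b _ _ ha hb =>
    obtain ⟨m, hm⟩ := ha
    obtain ⟨n, hn⟩ := hb
    exact ⟨m + n, mul_mem_wordFil hm hn⟩

theorem IsPrimitivelyGenerated.adjoin_eq_top (h : IsPrimitivelyGenerated V) :
    Algebra.adjoin k (V : Set A) = ⊤ := by
  refine Algebra.eq_top_iff.2 fun u => ?_
  obtain ⟨n, hn⟩ := h.exhaust u
  induction n generalizing u with
  | zero =>
    obtain ⟨c, rfl⟩ := mem_wordFil_zero.1 hn
    exact Subalgebra.smul_mem _ (Subalgebra.one_mem _) c
  | succ n ih =>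
    exact wordFil_succ_le (W := Subalgebra.toSubmodule (Algebra.adjoin k (V : Set A)))
      (fun u hu => ih u hu)
      (fun v hv u hu => Subalgebra.mul_mem _ (Algebra.subset_adjoin hv) (ih u hu)) hn

/-- The subspace `V ⊗ 1 + 1 ⊗ V` of `A ⊗ A`. It generates `A ⊗ A` if `V` generates `A`. -/
def tensorSup (V : Submodule k A) : Submodule k (A ⊗[k] A) :=
  V.map (Algebra.TensorProduct.includeLeft : A →ₐ[k] A ⊗[k] A).toLinearMap ⊔
    V.map (Algebra.TensorProduct.includeRight : A →ₐ[k] A ⊗[k] A).toLinearMap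

theorem mem_tensorSup {z : A ⊗[k] A} :
    z ∈ tensorSup V ↔ ∃ v ∈ V, ∃ w ∈ V, v ⊗ₜ[k] (1 : A) + (1 : A) ⊗ₜ[k] w = z := by
  simp [tensorSup, Submodule.mem_sup]

theorem adjoin_tensorSup (htop : Algebra.adjoin k (V : Set A) = ⊤) :
    Algebra.adjoin k (tensorSup V : Set (A ⊗[k] A)) = ⊤ := by
  have hmap {f : A →ₐ[k] A ⊗[k] A} (hf : V.map f.toLinearMap ≤ tensorSup V) (u : A) :
      f u ∈ Algebra.adjoin k (tensorSup V : Set (A ⊗[k] A)) := by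
    have hrange : (Algebra.adjoin k (V : Set A)).map f ≤ Algebra.adjoin k (tensorSup V) := by
      rw [AlgHom.map_adjoin]
      exact Algebra.adjoin_mono hf
    exact hrange ⟨u, htop ▸ trivial, rfl⟩
  refine Algebra.eq_top_iff.2 fun z => ?_
  induction z with
  | zero => exact Subalgebra.zero_mem _
  | add x y hx hy => exact Subalgebra.add_mem _ hx hy
  | tmul u v =>
    rw [← mul_one u, ← one_mul v, ← Algebra.TensorProduct.tmul_mul_tmul]
    exact Subalgebra.mul_mem _ (hmap le_sup_left u) (hmap le_sup_right v)

theorem isPrimitiveElem_of_mem_tensorSup (hprim : ∀ v ∈ V, IsPrimitiveElem k v) {z : A ⊗[k] A}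
    (hz : z ∈ tensorSup V) : IsPrimitiveElem k z := by
  obtain ⟨v, hv, w, hw, rfl⟩ := mem_tensorSup.1 hz
  have hv : comul (R := k) v = _ := hprim v hv
  have hw : comul (R := k) w = _ := hprim w hw
  rw [IsPrimitiveElem, map_add, TensorProduct.comul_tmul, TensorProduct.comul_tmul, hv, hw,
    Bialgebra.comul_one, Algebra.TensorProduct.one_def]
  simp only [TensorProduct.add_tmul, TensorProduct.tmul_add,
    TensorProduct.AlgebraTensorModule.tensorTensorTensorComm_tmul, map_add]
  abel

theorem commutator_mem_tensorSup (hcomm : ∀ v ∈ V, ∀ w ∈ V, v * w - w * v ∈ V) {z z' : A ⊗[k] A}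
    (hz : z ∈ tensorSup V) (hz' : z' ∈ tensorSup V) : z * z' - z' * z ∈ tensorSup V := by
  obtain ⟨v, hv, w, hw, rfl⟩ := mem_tensorSup.1 hz
  obtain ⟨v', hv', w', hw', rfl⟩ := mem_tensorSup.1 hz'
  refine mem_tensorSup.2 ⟨_, hcomm v hv v' hv', _, hcomm w hw w' hw', ?_⟩
  simp only [mul_add, add_mul, Algebra.TensorProduct.tmul_mul_tmul, one_mul, mul_one,
    TensorProduct.sub_tmul, TensorProduct.tmul_sub]
  abel

theorem IsPrimitivelyGenerated.tensorSup (h : IsPrimitivelyGenerated V) :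
    IsPrimitivelyGenerated (tensorSup V) :=
  isPrimitivelyGenerated_of_adjoin (fun _ => isPrimitiveElem_of_mem_tensorSup h.isPrimitiveElem)
    (fun _ hz _ => commutator_mem_tensorSup h.commutator_mem hz) (adjoin_tensorSup h.adjoin_eq_top)

end TensorSquare

section Enveloping

variable (k : Type*) (g : Type*) [Field k] [LieRing g] [LieAlgebra k g]

open Coalgebra (comul counit IsCocomm)

attribute [local instance 100] LieRing.ofAssociativeRing

/-- The linear map `g → U(g)`. -/
abbrev envι : g →ₗ[k] UniversalEnvelopingAlgebra k g :=
  LieHom.toLinearMap (UniversalEnvelopingAlgebra.ι k)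

section

variable {g}

theorem envι_lie (x y : g) : envι k g ⁅x, y⁆ = envι k g x * envι k g y - envι k g y * envι k g x :=
  LieHom.map_lie (UniversalEnvelopingAlgebra.ι k) x y

theorem comul_envι (x : g) :
    comul (R := k) (envι k g x) = envι k g x ⊗ₜ[k] 1 + 1 ⊗ₜ envι k g x :=
  envComul_ι k x

theorem counit_envι (x : g) : counit (R := k) (envι k g x) = 0 := envCounit_ι k x

end

theorem adjoin_range_envι :
    Algebra.adjoin k (LinearMap.range (envι k g) : Set (UniversalEnvelopingAlgebra k g)) = ⊤ := by
  set S := Algebra.adjoin k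
    (LinearMap.range (envι k g) : Set (UniversalEnvelopingAlgebra k g))
  have hmem (x : g) : envι k g x ∈ S := Algebra.subset_adjoin ⟨x, rfl⟩
  let f : g →ₗ⁅k⁆ S :=
    { toFun := fun x => ⟨envι k g x, hmem x⟩
      map_add' := fun x y => Subtype.ext (map_add _ x y)
      map_smul' := fun c x => Subtype.ext (map_smul _ c x)
      map_lie' := fun {x y} => Subtype.ext (envι_lie k x y) }
  have hlift : S.val.comp (UniversalEnvelopingAlgebra.lift k f) = AlgHom.id k _ := by
    refine env_algHom_ext k fun x => ?_
    rw [AlgHom.comp_apply, UniversalEnvelopingAlgebra.lift_ι_apply]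
    rfl
  refine Algebra.eq_top_iff.2 fun u => ?_
  rw [← AlgHom.id_apply (R := k) u, ← hlift]
  exact (UniversalEnvelopingAlgebra.lift k f u).2

theorem isPrimitivelyGenerated_range_envι :
    IsPrimitivelyGenerated (LinearMap.range (envι k g)) := by
  refine isPrimitivelyGenerated_of_adjoin ?_ ?_ (adjoin_range_envι k g)
  · rintro _ ⟨x, rfl⟩
    exact comul_envι k x
  · rintro _ ⟨x, rfl⟩ _ ⟨y, rfl⟩
    exact ⟨⁅x, y⁆, envι_lie k x y⟩

instance env_isCocomm : IsCocomm k (UniversalEnvelopingAlgebra k g) where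
  comm_comp_comul := by
    have hcomm : (Algebra.TensorProduct.comm k _ _).toAlgHom.comp (envComul k g) =
        envComul k g := by
      refine env_algHom_ext k fun x => ?_
      rw [AlgHom.comp_apply, envComul_ι]
      simp [add_comm, -UniversalEnvelopingAlgebra.ι_apply]
    exact congrArg AlgHom.toLinearMap hcomm

end Enveloping

/-! ### The embedding of `g` into `U(g)` -/

section FreeLieAlgebra

variable (k : Type*) [CommRing k] (X : Type*)

attribute [local instance 100] LieRing.ofAssociativeRing

theorem lieSpan_range_freeLieAlgebra_of :
    LieSubalgebra.lieSpan k _ (Set.range (FreeLieAlgebra.of k : X → FreeLieAlgebra k X)) = ⊤ := by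
  set S := LieSubalgebra.lieSpan k _ (Set.range (FreeLieAlgebra.of k : X → FreeLieAlgebra k X))
  let f : FreeLieAlgebra k X →ₗ⁅k⁆ S := FreeLieAlgebra.lift k fun x =>
    ⟨FreeLieAlgebra.of k x, LieSubalgebra.subset_lieSpan ⟨x, rfl⟩⟩
  have hid : S.incl.comp f = LieHom.id := by
    ext x
    simp [f]
  refine eq_top_iff.2 fun a _ => ?_
  rw [← LieHom.id_apply (R := k) a, ← hid]
  exact (f a).2

variable {k X} in
@[elab_as_elim]
theorem freeLieAlgebra_induction {motive : FreeLieAlgebra k X → Prop}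
    (of : ∀ x, motive (FreeLieAlgebra.of k x)) (zero : motive 0)
    (add : ∀ a b, motive a → motive b → motive (a + b))
    (smul : ∀ (c : k) a, motive a → motive (c • a))
    (lie : ∀ a b, motive a → motive b → motive ⁅a, b⁆) (a : FreeLieAlgebra k X) : motive a := by
  have ha : a ∈ LieSubalgebra.lieSpan k _ (Set.range (FreeLieAlgebra.of k)) := by
    rw [lieSpan_range_freeLieAlgebra_of]
    trivial
  induction ha using LieSubalgebra.lieSpan_induction with
  | mem _ hx => exact hx.choose_spec ▸ of hx.choose
  | zero => exact zero
  | add a b _ _ ha hb => exact add a b ha hb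
  | smul c a _ ha => exact smul c a ha
  | lie a b _ _ ha hb => exact lie a b ha hb

/-- The affine action of the free Lie algebra `L` on `L × k` in which a generator `x` acts by
`(l, c) ↦ (⁅x, l⁆ + c x, 0)`. -/
def affineAction : FreeLieAlgebra k X →ₗ⁅k⁆ Module.End k (FreeLieAlgebra k X × k) :=
  FreeLieAlgebra.lift k fun x => LinearMap.inl k _ k ∘ₗ
    LinearMap.coprod (LieAlgebra.ad k _ (FreeLieAlgebra.of k x))
      (LinearMap.toSpanSingleton k _ (FreeLieAlgebra.of k x))

/-- The Euler derivation of the free Lie algebra, which multiplies a bracket of `n` generators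
by `n`. It is the translation part of `affineAction`. -/
def euler : FreeLieAlgebra k X →ₗ[k] FreeLieAlgebra k X where
  toFun a := (affineAction k X a (0, 1)).1
  map_add' a b := by rw [map_add, LinearMap.add_apply, Prod.fst_add]
  map_smul' c a := by rw [map_smul, LinearMap.smul_apply, Prod.smul_fst, RingHom.id_apply]

variable {k X}

theorem affineAction_zero_one_fst (a : FreeLieAlgebra k X) :
    (affineAction k X a (0, 1)).1 = euler k X a :=
  rfl

theorem affineAction_of (x : X) (l : FreeLieAlgebra k X) (c : k) :
    affineAction k X (FreeLieAlgebra.of k x) (l, c) =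
      (⁅FreeLieAlgebra.of k x, l⁆ + c • FreeLieAlgebra.of k x, 0) := by
  simp [affineAction]

theorem euler_of (x : X) : euler k X (FreeLieAlgebra.of k x) = FreeLieAlgebra.of k x := by
  rw [← affineAction_zero_one_fst, affineAction_of, lie_zero, zero_add, one_smul]

theorem affineAction_lie {a b a' b' : FreeLieAlgebra k X}
    (ha : ∀ l (c : k), affineAction k X a (l, c) = (⁅a, l⁆ + c • a', 0))
    (hb : ∀ l (c : k), affineAction k X b (l, c) = (⁅b, l⁆ + c • b', 0))
    (l : FreeLieAlgebra k X) (c : k) :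
    affineAction k X ⁅a, b⁆ (l, c) = (⁅⁅a, b⁆, l⁆ + c • (⁅a, b'⁆ - ⁅b, a'⁆), 0) := by
  rw [LieHom.map_lie, LieRing.of_associative_ring_bracket, LinearMap.sub_apply,
    Module.End.mul_apply, Module.End.mul_apply, ha, hb, ha, hb]
  simp only [Prod.mk_sub_mk, sub_self, zero_smul, add_zero, lie_add, lie_smul, lie_lie,
    smul_sub, Prod.mk.injEq, and_true]
  abel

theorem affineAction_apply (a l : FreeLieAlgebra k X) (c : k) :
    affineAction k X a (l, c) = (⁅a, l⁆ + c • euler k X a, 0) := by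
  induction a using freeLieAlgebra_induction generalizing l c with
  | of x => rw [affineAction_of, euler_of]
  | zero => rw [map_zero, map_zero, LinearMap.zero_apply, zero_lie, smul_zero, add_zero]; rfl
  | add a b ha hb =>
    rw [map_add, LinearMap.add_apply, ha, hb]
    simp only [Prod.mk_add_mk, map_add, add_lie, smul_add, add_zero, Prod.mk.injEq, and_true]
    abel
  | smul t a ha =>
    rw [map_smul, LinearMap.smul_apply, ha, map_smul, smul_lie, Prod.smul_mk, smul_add,
      smul_zero, smul_comm t c]
  | lie a b ha hb =>
    rw [affineAction_lie ha hb, ← affineAction_zero_one_fst ⁅a, b⁆, affineAction_lie ha hb,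
      lie_zero, zero_add, one_smul]

theorem euler_lie (a b : FreeLieAlgebra k X) :
    euler k X ⁅a, b⁆ = ⁅euler k X a, b⁆ + ⁅a, euler k X b⁆ := by
  rw [← affineAction_zero_one_fst, affineAction_lie (affineAction_apply a) (affineAction_apply b),
    lie_zero, zero_add, one_smul, sub_eq_add_neg, lie_skew, add_comm]

theorem iSup_eigenspace_euler :
    ⨆ n : ℕ, Module.End.eigenspace (euler k X) ((n : k) + 1) = ⊤ := by
  refine Submodule.eq_top_iff'.2 fun a => ?_
  induction a using freeLieAlgebra_induction with
  | of x =>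
    refine Submodule.mem_iSup_of_mem 0 (Module.End.mem_eigenspace_iff.2 ?_)
    rw [euler_of, Nat.cast_zero, zero_add, one_smul]
  | zero => exact Submodule.zero_mem _
  | add a b ha hb => exact Submodule.add_mem _ ha hb
  | smul c a ha => exact Submodule.smul_mem _ c ha
  | lie a b ha hb =>
    induction ha using Submodule.iSup_induction' with
    | zero => simp
    | add a a' _ _ ha ha' => rw [add_lie]; exact Submodule.add_mem _ ha ha'
    | mem m a ha =>
      induction hb using Submodule.iSup_induction' with
      | zero => simp
      | add b b' _ _ hb hb' => rw [lie_add]; exact Submodule.add_mem _ hb hb'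
      | mem n b hb =>
        refine Submodule.mem_iSup_of_mem (m + n + 1) ?_
        rw [Module.End.mem_eigenspace_iff] at ha hb ⊢
        rw [euler_lie, ha, hb, smul_lie, lie_smul]
        push_cast
        module

end FreeLieAlgebra

section FreeLieAlgebra

variable {k : Type*} [Field k] [CharZero k] {X : Type*}

attribute [local instance 100] LieRing.ofAssociativeRing

theorem eq_zero_of_euler_eq_zero {a : FreeLieAlgebra k X} (h : euler k X a = 0) : a = 0 := by
  have hdisjoint := Module.End.eigenspaces_iSupIndep (euler k X) 0
  refine Submodule.disjoint_def.1 hdisjoint a (by simpa using h) ?_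
  have hle : ⨆ n : ℕ, Module.End.eigenspace (euler k X) ((n : k) + 1) ≤
      ⨆ (j : k) (_ : j ≠ 0), Module.End.eigenspace (euler k X) j :=
    iSup_le fun n => le_iSup₂_of_le ((n : k) + 1) (by exact_mod_cast Nat.succ_ne_zero n) le_rfl
  rw [iSup_eigenspace_euler] at hle
  exact hle trivial

/-- `affineAction` extends to `U(L)`, so that `ι a = 0` forces `euler a = 0`. -/
theorem envι_freeLieAlgebra_injective : Function.Injective (envι k (FreeLieAlgebra k X)) := by
  rw [← LinearMap.ker_eq_bot, LinearMap.ker_eq_bot']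
  intro a ha
  have haction : affineAction k X a = 0 := by
    rw [← UniversalEnvelopingAlgebra.lift_ι_apply k (affineAction k X) a]
    exact (congrArg _ ha).trans (map_zero _)
  refine eq_zero_of_euler_eq_zero ?_
  rw [← affineAction_zero_one_fst, haction, LinearMap.zero_apply, Prod.fst_zero]

end FreeLieAlgebra

section LieIdeal

variable {k A : Type*} [CommRing k] [Ring A] [Bialgebra k A] {V r : Submodule k A}

open Coalgebra (comul)

theorem commutator_mem_wordFilPred_mul (hr : ∀ y ∈ r, ∀ v ∈ V, y * v - v * y ∈ r) {n : ℕ}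
    {b y : A} (hb : b ∈ wordFil V n) (hy : y ∈ r) : y * b - b * y ∈ wordFilPred V n * r := by
  induction n generalizing b y with
  | zero =>
    obtain ⟨c, rfl⟩ := mem_wordFil_zero.1 hb
    simp
  | succ n ih =>
    have hle : wordFilPred V n * r ≤ wordFil V n * r := mul_le_mul_left (wordFilPred_le n) r
    refine wordFil_succ_le (W := (wordFilPred V (n + 1) * r).comap
      (LinearMap.mulLeft k y - LinearMap.mulRight k y))
      (fun b hb => hle (ih hb hy)) (fun v hv b hb => ?_) hb
    have hleibniz : y * (v * b) - v * b * y =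
        v * (y * b - b * y) + (b * (y * v - v * y) +
          ((y * v - v * y) * b - b * (y * v - v * y))) := by
      noncomm_ring
    have hvb : v * (y * b - b * y) ∈ wordFil V 1 * (wordFilPred V n * r) :=
      Submodule.mul_mem_mul (le_wordFil_one hv) (ih hb hy)
    rw [← mul_assoc] at hvb
    rw [Submodule.mem_comap, LinearMap.sub_apply, LinearMap.mulLeft_apply,
      LinearMap.mulRight_apply, hleibniz]
    exact Submodule.add_mem _ (mul_le_mul_left (wordFil_mul_wordFilPred_le (by omega)) r hvb)
      (Submodule.add_mem _ (Submodule.mul_mem_mul hb (hr y hy v hv)) (hle (ih hb (hr y hy v hv))))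

variable (k) in
/-- The linear map `a ⊗ b ↦ a [y, b]`, the defect of `y` in the product of `A`. -/
def mulCommutator (y : A) : A ⊗[k] A →ₗ[k] A :=
  LinearMap.mul' k A ∘ₗ (LinearMap.mulLeft k y - LinearMap.mulRight k y).lTensor A

@[simp]
theorem mulCommutator_tmul (y a b : A) : mulCommutator k y (a ⊗ₜ b) = a * (y * b - b * y) := by
  simp [mulCommutator, mul_sub]

theorem mul'_mul_primitive (y : A) (z : A ⊗[k] A) :
    LinearMap.mul' k A (z * (y ⊗ₜ[k] 1 + 1 ⊗ₜ y)) =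
      (2 : k) • (LinearMap.mul' k A z * y) + mulCommutator k y z := by
  induction z with
  | zero => simp
  | add a b ha hb => rw [add_mul, map_add, ha, hb, map_add, map_add, add_mul]; module
  | tmul a b =>
    simp only [mul_add, Algebra.TensorProduct.tmul_mul_tmul, mul_one, map_add,
      LinearMap.mul'_apply, mulCommutator_tmul, two_smul, mul_sub, mul_assoc]
    abel

theorem mul_le_span (M : Submodule k A) :
    M * r ≤ (Ideal.span (r : Set A)).restrictScalars k :=
  Submodule.mul_le.2 fun a _ _ hy => Ideal.mul_mem_left _ a (Ideal.subset_span hy)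

namespace IsPrimitivelyGenerated

variable (h : IsPrimitivelyGenerated V) (hr : ∀ y ∈ r, ∀ v ∈ V, y * v - v * y ∈ r)
include h hr

theorem mulCommutator_comul_mem {n : ℕ} {u y : A} (hu : u ∈ wordFil V n) (hy : y ∈ r) :
    mulCommutator k y (comul u) ∈ wordFilPred V n * r := by
  refine tensorWordFil_le (W := (wordFilPred V n * r).comap (mulCommutator k y))
    (fun i j hij a ha b hb => ?_) (h.comul_mem_tensorWordFil hu)
  have hab : a * (y * b - b * y) ∈ wordFil V i * (wordFilPred V j * r) :=
    Submodule.mul_mem_mul ha (commutator_mem_wordFilPred_mul hr hb hy)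
  rw [← mul_assoc] at hab
  rw [Submodule.mem_comap, mulCommutator_tmul]
  exact mul_le_mul_left (wordFil_mul_wordFilPred_le hij) r hab

theorem adams_sub_mem_mul (hrV : r ≤ V) {n : ℕ} {w : A} (hw : w ∈ wordFil V n * r) :
    adams k A w - (2 : k) ^ (n + 1) • w ∈ wordFilPred V n * r := by
  suffices hle : wordFil V n * r ≤ (wordFilPred V n * r).comap
      (adams k A - (2 : k) ^ (n + 1) • LinearMap.id) from hle hw
  refine Submodule.mul_le.2 fun u hu y hy => ?_
  have hprod : adams k A (u * y) - (2 : k) ^ (n + 1) • (u * y) =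
      (2 : k) • ((adams k A u - (2 : k) ^ n • u) * y) + mulCommutator k y (comul u) := by
    rw [adams_apply, Bialgebra.comul_mul, h.isPrimitiveElem y (hrV hy), mul'_mul_primitive,
      ← adams_apply, sub_mul, smul_mul_assoc, pow_succ']
    module
  change adams k A (u * y) - (2 : k) ^ (n + 1) • (u * y) ∈ wordFilPred V n * r
  rw [hprod]
  exact Submodule.add_mem _
    (Submodule.smul_mem _ _ (Submodule.mul_mem_mul (h.adams_sub_mem hu) hy))
    (h.mulCommutator_comul_mem hr hu hy)

theorem isTwoSided_span : (Ideal.span (r : Set A)).IsTwoSided := by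
  refine ⟨fun {x} b hx => ?_⟩
  induction hx using Submodule.span_induction with
  | mem y hy =>
    obtain ⟨n, hn⟩ := h.exhaust b
    rw [← sub_add_cancel (y * b) (b * y)]
    exact Ideal.add_mem _ (mul_le_span _ (commutator_mem_wordFilPred_mul hr hn hy))
      (Ideal.mul_mem_left _ b (Ideal.subset_span hy))
  | zero => rw [zero_mul]; exact Ideal.zero_mem _
  | add x y _ _ hx hy => rw [add_mul]; exact Ideal.add_mem _ hx hy
  | smul a x _ hx => rw [smul_eq_mul, mul_assoc]; exact Ideal.mul_mem_left _ a hx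

omit hr in
theorem exists_mem_wordFil_mul {p : A} (hp : p ∈ Ideal.span (r : Set A)) :
    ∃ n, p ∈ wordFil V n * r := by
  induction hp using Submodule.span_induction with
  | mem y hy => exact ⟨0, one_mul y ▸ Submodule.mul_mem_mul (one_mem_wordFil 0) hy⟩
  | zero => exact ⟨0, Submodule.zero_mem _⟩
  | add x y _ _ hx hy =>
    obtain ⟨m, hm⟩ := hx
    obtain ⟨n, hn⟩ := hy
    exact ⟨m + n, Submodule.add_mem _ (mul_le_mul_left (wordFil_mono (by omega)) r hm)
      (mul_le_mul_left (wordFil_mono (by omega)) r hn)⟩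
  | smul a x _ hx =>
    obtain ⟨m, hm⟩ := h.exhaust a
    obtain ⟨n, hn⟩ := hx
    have hax := Submodule.mul_mem_mul hm hn
    rw [← mul_assoc] at hax
    exact ⟨m + n, mul_le_mul_left (wordFil_mul m n).le r hax⟩

end IsPrimitivelyGenerated

theorem IsPrimitivelyGenerated.mem_of_mem_span {k A : Type*} [Field k] [CharZero k] [Ring A]
    [Bialgebra k A] {V r : Submodule k A} (h : IsPrimitivelyGenerated V)
    (hr : ∀ y ∈ r, ∀ v ∈ V, y * v - v * y ∈ r) (hrV : r ≤ V) {p : A} (hp : IsPrimitiveElem k p)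
    (hspan : p ∈ Ideal.span (r : Set A)) : p ∈ r := by
  obtain ⟨n, hn⟩ := h.exists_mem_wordFil_mul hspan
  induction n with
  | zero => rwa [wordFil, pow_zero, one_mul] at hn
  | succ n ih =>
    refine ih ?_
    have hlower := h.adams_sub_mem_mul hr hrV hn
    rw [hp.adams_eq, ← sub_smul] at hlower
    exact (Submodule.smul_mem_iff _ (two_sub_two_pow_ne_zero n)).1 hlower

end LieIdeal

section Injectivity

attribute [local instance 100] LieRing.ofAssociativeRing

theorem exists_lieHom_comp_eq {R L M N : Type*} [CommRing R] [LieRing L] [LieAlgebra R L]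
    [LieRing M] [LieAlgebra R M] [LieRing N] [LieAlgebra R N] {π : L →ₗ⁅R⁆ M}
    (hπ : Function.Surjective π) {φ : L →ₗ⁅R⁆ N} (hker : ∀ l, π l = 0 → φ l = 0) :
    ∃ f : M →ₗ⁅R⁆ N, f.comp π = φ := by
  have hwell (l : L) : φ (Function.surjInv hπ (π l)) = φ l := by
    rw [← sub_eq_zero, ← map_sub]
    exact hker _ (by rw [map_sub, Function.surjInv_eq hπ, sub_self])
  refine ⟨{
    toFun := fun x => φ (Function.surjInv hπ x)
    map_add' := hπ.forall₂.2 fun l l' => by rw [← map_add, hwell, hwell, hwell, map_add]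
    map_smul' := fun c => hπ.forall.2 fun l => by
      rw [← map_smul, hwell, hwell, map_smul, RingHom.id_apply]
    map_lie' := fun {x y} => by
      obtain ⟨l, rfl⟩ := hπ x
      obtain ⟨l', rfl⟩ := hπ y
      rw [← LieHom.map_lie, hwell, LieHom.map_lie, ← hwell l, ← hwell l'] }, LieHom.ext hwell⟩

variable {k : Type*} [Field k] [CharZero k] {L g : Type*} [LieRing L] [LieAlgebra k L] [LieRing g]
  [LieAlgebra k g]

/-- The kernel of `L → g` generates an ideal of `U(L)`, and a primitive element of this ideal lies
in the kernel. -/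
theorem envι_injective_of_surjective {π : L →ₗ⁅k⁆ g} (hπ : Function.Surjective π)
    (hL : Function.Injective (envι k L)) : Function.Injective (envι k g) := by
  have hgen := isPrimitivelyGenerated_range_envι k L
  set r : Submodule k (UniversalEnvelopingAlgebra k L) :=
    (LinearMap.ker (π : L →ₗ[k] g)).map (envι k L)
  have hr : ∀ y ∈ r, ∀ v ∈ LinearMap.range (envι k L), y * v - v * y ∈ r := by
    rintro _ ⟨y, hy, rfl⟩ _ ⟨v, rfl⟩
    have hy : π y = 0 := hy
    exact ⟨⁅y, v⁆, by simp [hy], envι_lie k y v⟩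
  set I := Ideal.span (r : Set (UniversalEnvelopingAlgebra k L))
  have : I.IsTwoSided := hgen.isTwoSided_span hr
  let φ : L →ₗ⁅k⁆ UniversalEnvelopingAlgebra k L ⧸ I :=
    (Ideal.Quotient.mkₐ k I).toLieHom.comp (UniversalEnvelopingAlgebra.ι k)
  have hφ (l : L) : φ l = 0 ↔ envι k L l ∈ I := Ideal.Quotient.eq_zero_iff_mem
  obtain ⟨f, hf⟩ := exists_lieHom_comp_eq hπ (φ := φ) fun l hl =>
    (hφ l).2 (Ideal.subset_span ⟨l, hl, rfl⟩)
  rw [← LinearMap.ker_eq_bot, LinearMap.ker_eq_bot']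
  refine hπ.forall.2 fun l hl => ?_
  have hmem : envι k L l ∈ I := by
    rw [← hφ, ← hf, LieHom.comp_apply, ← UniversalEnvelopingAlgebra.lift_ι_apply k f]
    exact (congrArg _ hl).trans (map_zero _)
  obtain ⟨l', hl', hll'⟩ := hgen.mem_of_mem_span hr LinearMap.map_le_range (comul_envι k l) hmem
  rw [← hL hll']
  exact hl'

variable (k g) in
theorem envι_injective : Function.Injective (envι k g) :=
  envι_injective_of_surjective (π := FreeLieAlgebra.lift k (id : g → g))
    (fun x => ⟨FreeLieAlgebra.of k x, by simp⟩) envι_freeLieAlgebra_injective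

end Injectivity

/-! ### Cocycles of the cobar complex -/

section Cocycle

variable {k A : Type*} [Field k] [Ring A] [Bialgebra k A]

open Coalgebra (comul counit IsCocomm)

/-- The 2-cocycles of the cobar complex of `A`, written additively: the linearisation at `1` of the
twist equation. -/
def IsCocycle (f : A ⊗[k] A) : Prop :=
  tensorOne k A f + comulTensor k A f = oneTensor k A f + tensorComul k A f

theorem tensorOne_tmul (a b : A) : tensorOne k A (a ⊗ₜ b) = a ⊗ₜ (b ⊗ₜ 1) := by
  simp [tensorOne]

theorem oneTensor_apply (z : A ⊗[k] A) : oneTensor k A z = 1 ⊗ₜ z := by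
  simp [oneTensor]

theorem tensorComul_tmul (a b : A) : tensorComul k A (a ⊗ₜ b) = a ⊗ₜ comul b := by
  simp [tensorComul]

theorem comulTensor_tmul (a b : A) :
    comulTensor k A (a ⊗ₜ b) = TensorProduct.assoc k A A A (comul a ⊗ₜ b) := by
  simp only [comulTensor, AlgHom.comp_apply, Algebra.TensorProduct.map_tmul]
  rfl

theorem counitTensor_tmul (a b : A) :
    counitTensor k A (a ⊗ₜ b) = counit (R := k) a • b := by
  simp [counitTensor]

theorem tensorCounit_tmul (a b : A) :
    tensorCounit k A (a ⊗ₜ b) = counit (R := k) b • a := by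
  simp [tensorCounit]

theorem counitTensor_comul (a : A) : counitTensor k A (comul a) = a := by
  change TensorProduct.lid k A (LinearMap.rTensor A counit (comul a)) = a
  rw [Coalgebra.rTensor_counit_comul, TensorProduct.lid_tmul, one_smul]

theorem tensorCounit_comul (a : A) : tensorCounit k A (comul a) = a := by
  change TensorProduct.rid k A (LinearMap.lTensor A counit (comul a)) = a
  rw [Coalgebra.lTensor_counit_comul, TensorProduct.rid_tmul, one_smul]

theorem tensorCounit_comm (f : A ⊗[k] A) :
    tensorCounit k A (TensorProduct.comm k A A f) = counitTensor k A f := by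
  induction f with
  | zero => simp
  | add x y hx hy => simp only [map_add, hx, hy]
  | tmul a b => simp [tensorCounit_tmul, counitTensor_tmul]

theorem counit_mul' (z : A ⊗[k] A) :
    counit (R := k) (LinearMap.mul' k A z) = counit (R := k) (counitTensor k A z) := by
  induction z with
  | zero => simp
  | add x y hx hy => simp only [map_add, hx, hy]
  | tmul a b => simp [counitTensor_tmul]

section Reversal

variable (k A) in
/-- The linear map `a ⊗ b ⊗ c ↦ c ⊗ b ⊗ a`. -/
def reverseTriple : A ⊗[k] (A ⊗[k] A) →ₗ[k] A ⊗[k] (A ⊗[k] A) :=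
  (TensorProduct.assoc k A A A).toLinearMap ∘ₗ
    LinearMap.rTensor A (TensorProduct.comm k A A).toLinearMap ∘ₗ
      (TensorProduct.comm k A (A ⊗[k] A)).toLinearMap

theorem reverseTriple_tmul (a : A) (z : A ⊗[k] A) :
    reverseTriple k A (a ⊗ₜ z) =
      TensorProduct.assoc k A A A (TensorProduct.comm k A A z ⊗ₜ a) := by
  simp [reverseTriple]

theorem reverseTriple_tensorOne (f : A ⊗[k] A) :
    reverseTriple k A (tensorOne k A f) = oneTensor k A (TensorProduct.comm k A A f) := by
  induction f with
  | zero => simp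
  | add x y hx hy => simp only [map_add, hx, hy]
  | tmul a b => simp [tensorOne_tmul, reverseTriple_tmul, oneTensor_apply]

theorem reverseTriple_oneTensor (f : A ⊗[k] A) :
    reverseTriple k A (oneTensor k A f) = tensorOne k A (TensorProduct.comm k A A f) := by
  induction f with
  | zero => simp
  | add x y hx hy => simp only [map_add, hx, hy]
  | tmul a b => simp [tensorOne_tmul, reverseTriple_tmul, oneTensor_apply]

theorem reverseTriple_assoc (z : A ⊗[k] A) (b : A) :
    reverseTriple k A (TensorProduct.assoc k A A A (z ⊗ₜ b)) =
      b ⊗ₜ TensorProduct.comm k A A z := by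
  induction z with
  | zero => simp
  | add x y hx hy => simp only [TensorProduct.add_tmul, map_add, hx, hy, TensorProduct.tmul_add]
  | tmul a a' => simp [reverseTriple_tmul]

theorem reverseTriple_tensorComul [IsCocomm k A] (f : A ⊗[k] A) :
    reverseTriple k A (tensorComul k A f) = comulTensor k A (TensorProduct.comm k A A f) := by
  induction f with
  | zero => simp
  | add x y hx hy => simp only [map_add, hx, hy]
  | tmul a b =>
    rw [tensorComul_tmul, reverseTriple_tmul, Coalgebra.comm_comul, TensorProduct.comm_tmul,
      comulTensor_tmul]

theorem reverseTriple_comulTensor [IsCocomm k A] (f : A ⊗[k] A) :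
    reverseTriple k A (comulTensor k A f) = tensorComul k A (TensorProduct.comm k A A f) := by
  induction f with
  | zero => simp
  | add x y hx hy => simp only [map_add, hx, hy]
  | tmul a b =>
    rw [comulTensor_tmul, reverseTriple_assoc, Coalgebra.comm_comul, TensorProduct.comm_tmul,
      tensorComul_tmul]

theorem IsCocycle.comm [IsCocomm k A] {f : A ⊗[k] A} (hf : IsCocycle f) :
    IsCocycle (TensorProduct.comm k A A f) := by
  have hreverse := congrArg (reverseTriple k A) hf
  rw [map_add, map_add, reverseTriple_tensorOne, reverseTriple_comulTensor,
    reverseTriple_oneTensor, reverseTriple_tensorComul] at hreverse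
  exact hreverse.symm

end Reversal

section Evaluation

variable {C : Type*} [Ring C] [Algebra k C] {f : A ⊗[k] A} {α β γ : WithConv (A →ₗ[k] C)}

open WithConv (toConv)

/-- The linear map `a ⊗ b ↦ α(a) β(b)`. Its composition with the comultiplication is the convolution
product `α * β`. -/
def evalPair (α β : WithConv (A →ₗ[k] C)) : A ⊗[k] A →ₗ[k] C :=
  LinearMap.mul' k C ∘ₗ TensorProduct.map α.ofConv β.ofConv

theorem evalPair_tmul (α β : WithConv (A →ₗ[k] C)) (a b : A) :
    evalPair α β (a ⊗ₜ b) = α a * β b := by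
  simp [evalPair]

theorem convMul_eq_evalPair_comul (α β : WithConv (A →ₗ[k] C)) (u : A) :
    (α * β) u = evalPair α β (comul u) := rfl

theorem convMul_map_one (hα : α 1 = 1) (hβ : β 1 = 1) : (α * β) 1 = 1 := by
  rw [convMul_eq_evalPair_comul, Bialgebra.comul_one, Algebra.TensorProduct.one_def,
    evalPair_tmul, hα, hβ, one_mul]

/-- The linear map `a ⊗ b ⊗ c ↦ α(a) β(b) γ(c)`. -/
def evalTriple (α β γ : WithConv (A →ₗ[k] C)) : A ⊗[k] (A ⊗[k] A) →ₗ[k] C :=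
  LinearMap.mul' k C ∘ₗ TensorProduct.map α.ofConv (evalPair β γ)

theorem evalTriple_tmul (α β γ : WithConv (A →ₗ[k] C)) (a : A) (z : A ⊗[k] A) :
    evalTriple α β γ (a ⊗ₜ z) = α a * evalPair β γ z := by
  simp [evalTriple]

theorem evalTriple_tensorOne (α β : WithConv (A →ₗ[k] C)) (hγ : γ 1 = 1) (f : A ⊗[k] A) :
    evalTriple α β γ (tensorOne k A f) = evalPair α β f := by
  induction f with
  | zero => simp
  | add x y hx hy => simp only [map_add, hx, hy]
  | tmul a b => rw [tensorOne_tmul, evalTriple_tmul, evalPair_tmul, evalPair_tmul, hγ, mul_one]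

theorem evalTriple_oneTensor (β γ : WithConv (A →ₗ[k] C)) (hα : α 1 = 1) (f : A ⊗[k] A) :
    evalTriple α β γ (oneTensor k A f) = evalPair β γ f := by
  rw [oneTensor_apply, evalTriple_tmul, hα, one_mul]

theorem evalTriple_tensorComul (α β γ : WithConv (A →ₗ[k] C)) (f : A ⊗[k] A) :
    evalTriple α β γ (tensorComul k A f) = evalPair α (β * γ) f := by
  induction f with
  | zero => simp
  | add x y hx hy => simp only [map_add, hx, hy]
  | tmul a b =>
    rw [tensorComul_tmul, evalTriple_tmul, evalPair_tmul, convMul_eq_evalPair_comul]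

theorem evalTriple_assoc (α β γ : WithConv (A →ₗ[k] C)) (z : A ⊗[k] A) (b : A) :
    evalTriple α β γ (TensorProduct.assoc k A A A (z ⊗ₜ b)) = evalPair α β z * γ b := by
  induction z with
  | zero => simp
  | add x y hx hy => simp only [TensorProduct.add_tmul, map_add, hx, hy, add_mul]
  | tmul a a' =>
    rw [TensorProduct.assoc_tmul, evalTriple_tmul, evalPair_tmul, evalPair_tmul, mul_assoc]

theorem evalTriple_comulTensor (α β γ : WithConv (A →ₗ[k] C)) (f : A ⊗[k] A) :
    evalTriple α β γ (comulTensor k A f) = evalPair (α * β) γ f := by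
  induction f with
  | zero => simp
  | add x y hx hy => simp only [map_add, hx, hy]
  | tmul a b =>
    rw [comulTensor_tmul, evalTriple_assoc, evalPair_tmul, convMul_eq_evalPair_comul]

theorem IsCocycle.evalPair_add (hf : IsCocycle f) (β : WithConv (A →ₗ[k] C)) (hα : α 1 = 1)
    (hγ : γ 1 = 1) :
    evalPair α β f + evalPair (α * β) γ f = evalPair β γ f + evalPair α (β * γ) f := by
  have heval := congrArg (evalTriple α β γ) hf
  rwa [map_add, map_add, evalTriple_tensorOne α β hγ, evalTriple_comulTensor,
    evalTriple_oneTensor β γ hα, evalTriple_tensorComul] at heval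

theorem evalPair_swap (h : ∀ a b, Commute (α a) (β b)) (f : A ⊗[k] A) :
    evalPair β α f = evalPair α β (TensorProduct.comm k A A f) := by
  induction f with
  | zero => simp
  | add x y hx hy => simp only [map_add, hx, hy]
  | tmul a b => rw [TensorProduct.comm_tmul, evalPair_tmul, evalPair_tmul, (h b a).eq]

theorem commute_of_forall_commute [IsCocomm k A] (h : ∀ a b, Commute (α a) (β b)) :
    Commute α β := by
  ext u
  rw [convMul_eq_evalPair_comul, convMul_eq_evalPair_comul, evalPair_swap h, Coalgebra.comm_comul]

theorem commute_convMul (hαγ : ∀ a b, Commute (α a) (γ b)) (hβγ : ∀ a b, Commute (β a) (γ b))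
    (u b : A) : Commute ((α * β) u) (γ b) := by
  rw [convMul_eq_evalPair_comul]
  induction comul (R := k) u with
  | zero => simp
  | add x y hx hy => rw [map_add]; exact hx.add_left hy
  | tmul c d => rw [evalPair_tmul]; exact (hαγ c b).mul_left (hβγ d b)

theorem IsCocycle.evalPair_convMul_of_skew [CharZero k] (hf : IsCocycle f)
    (hskew : TensorProduct.comm k A A f = -f) (hα : α 1 = 1) (hβ : β 1 = 1) (hγ : γ 1 = 1)
    (hαβ : ∀ a b, Commute (α a) (β b)) (hβγ : ∀ a b, Commute (β a) (γ b))
    (hαγ : ∀ a b, Commute (α a) (γ b)) :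
    evalPair (α * β) γ f = evalPair α γ f + evalPair β γ f := by
  have hswap {α β : WithConv (A →ₗ[k] C)} (h : ∀ a b, Commute (α a) (β b)) :
      evalPair β α f = -evalPair α β f := by
    rw [evalPair_swap h, hskew, map_neg]
  have hαβγ := hf.evalPair_add β hα hγ
  have hβγα := hf.evalPair_add γ hβ hα
  have hγαβ := hf.evalPair_add α hγ hβ
  have hβα := fun a b => (hαβ b a).symm
  have hγα := fun a b => (hαγ b a).symm
  have hγβ := fun a b => (hβγ b a).symm
  rw [hswap (commute_convMul hβα hγα)] at hαβγ
  rw [hswap hαγ, hswap (commute_convMul hγβ hαβ)] at hβγα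
  rw [hswap hαγ, hswap (commute_convMul hαγ hβγ)] at hγαβ
  have htwice : (2 : k) • (evalPair (α * β) γ f - (evalPair α γ f + evalPair β γ f)) = 0 := by
    linear_combination (norm := module) hαβγ - hβγα + hγαβ
  exact sub_eq_zero.1 ((smul_eq_zero_iff_right two_ne_zero).1 htwice)

theorem IsCocycle.evalPair_sq_of_symm [IsCocomm k A] (hf : IsCocycle f)
    (hsymm : TensorProduct.comm k A A f = f) (hα : α 1 = 1) (hβ : β 1 = 1)
    (hαβ : ∀ a b, Commute (α a) (β b)) :
    evalPair (α * α) (β * β) f =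
      2 • evalPair α β f + evalPair (α * β) (α * β) f - evalPair α α f - evalPair β β f := by
  have hcomm : α * β = β * α := commute_of_forall_commute hαβ
  have hswap : evalPair β α f = evalPair α β f := by rw [evalPair_swap hαβ, hsymm]
  have hβα := fun a b => (hαβ b a).symm
  have hswap_sq : evalPair (β * β) α f = evalPair α (β * β) f := by
    rw [evalPair_swap fun a b => (commute_convMul hβα hβα b a).symm, hsymm]
  have hααββ := hf.evalPair_add α hα (convMul_map_one hβ hβ)
  have hαβαβ := hf.evalPair_add β hα (convMul_map_one hα hβ)
  have hββα := hf.evalPair_add β hβ hα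
  rw [← mul_assoc, hcomm, mul_assoc] at hααββ
  rw [← hcomm, hswap, hswap_sq] at hββα
  linear_combination (norm := module) hααββ - hαβαβ + hββα

theorem evalPair_algHom_self (φ : A →ₐ[k] C) (z : A ⊗[k] A) :
    evalPair (toConv φ.toLinearMap) (toConv φ.toLinearMap) z = φ (LinearMap.mul' k A z) := by
  induction z with
  | zero => simp
  | add x y hx hy => simp only [map_add, hx, hy]
  | tmul a b => simp [evalPair_tmul]

end Evaluation

section Adams

open Algebra.TensorProduct (includeLeft includeRight)
open WithConv (toConv)

theorem evalPair_includeLeft_includeRight (S T : A →ₗ[k] A) :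
    evalPair (toConv ((includeLeft : A →ₐ[k] A ⊗[k] A).toLinearMap ∘ₗ S))
      (toConv ((includeRight : A →ₐ[k] A ⊗[k] A).toLinearMap ∘ₗ T)) = TensorProduct.map S T := by
  ext a b
  simp [evalPair_tmul]

theorem adams_tensor (f : A ⊗[k] A) :
    adams k (A ⊗[k] A) f = TensorProduct.map (adams k A) (adams k A) f := by
  induction f with
  | zero => simp
  | add x y hx hy => simp only [map_add, hx, hy]
  | tmul a b =>
    rw [adams_apply, TensorProduct.comul_tmul, TensorProduct.map_tmul, adams_apply, adams_apply]
    induction comul (R := k) a with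
    | zero => simp
    | add x y hx hy => simp only [TensorProduct.add_tmul, map_add, hx, hy]
    | tmul a a' =>
      induction comul (R := k) b with
      | zero => simp
      | add x y hx hy => simp only [TensorProduct.tmul_add, map_add, hx, hy]
      | tmul b b' => simp

variable (k) in
/-- The coboundary `a ↦ a ⊗ 1 + 1 ⊗ a - Δ(a)` of the cobar complex, the linearisation of
`boundary`. -/
def coboundary : A →ₗ[k] A ⊗[k] A :=
  (includeLeft : A →ₐ[k] A ⊗[k] A).toLinearMap +
    (includeRight : A →ₐ[k] A ⊗[k] A).toLinearMap - comul

theorem coboundary_apply (a : A) : coboundary k a = a ⊗ₜ 1 + 1 ⊗ₜ a - comul a := rfl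

theorem IsCocycle.adams_of_symm [IsCocomm k A] {f : A ⊗[k] A} (hf : IsCocycle f)
    (hsymm : TensorProduct.comm k A A f = f) :
    adams k (A ⊗[k] A) f = (2 : k) • f - coboundary k (LinearMap.mul' k A f) := by
  let x : WithConv (A →ₗ[k] A ⊗[k] A) := toConv (includeLeft : A →ₐ[k] A ⊗[k] A).toLinearMap
  let y : WithConv (A →ₗ[k] A ⊗[k] A) := toConv (includeRight : A →ₐ[k] A ⊗[k] A).toLinearMap
  have hpair : evalPair x y = LinearMap.id :=
    (evalPair_includeLeft_includeRight .id .id).trans TensorProduct.map_id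
  have hxx : x * x = toConv ((includeLeft : A →ₐ[k] A ⊗[k] A).toLinearMap ∘ₗ adams k A) := by
    ext u
    exact evalPair_algHom_self _ _
  have hyy : y * y = toConv ((includeRight : A →ₐ[k] A ⊗[k] A).toLinearMap ∘ₗ adams k A) := by
    ext u
    exact evalPair_algHom_self _ _
  have hxy : x * y = toConv (Bialgebra.comulAlgHom k A).toLinearMap := by
    ext u
    rw [convMul_eq_evalPair_comul, hpair]
    rfl
  have hsq := hf.evalPair_sq_of_symm (α := x) (β := y) hsymm rfl rfl
    fun a b => by simp [x, y, Commute, SemiconjBy]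
  rw [hxx, hyy, evalPair_includeLeft_includeRight, ← adams_tensor, hxy, evalPair_algHom_self,
    evalPair_algHom_self, evalPair_algHom_self, hpair] at hsq
  rw [hsq, coboundary_apply, LinearMap.id_apply, Bialgebra.comulAlgHom_apply,
    Algebra.TensorProduct.includeLeft_apply, Algebra.TensorProduct.includeRight_apply]
  module

end Adams

section InvariantCocycle

theorem isCocycle_coboundary (a : A) : IsCocycle (coboundary k a) := by
  have hcoassoc : comulTensor k A (comul a) = tensorComul k A (comul a) :=
    Coalgebra.coassoc_apply a
  have hright : comulTensor k A ((1 : A) ⊗ₜ a) = 1 ⊗ₜ (1 ⊗ₜ a) := by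
    rw [comulTensor_tmul, Bialgebra.comul_one, Algebra.TensorProduct.one_def,
      TensorProduct.assoc_tmul]
  have hleft : comulTensor k A (a ⊗ₜ (1 : A)) = tensorOne k A (comul a) := comulTensor_tmul a 1
  rw [IsCocycle, coboundary_apply]
  simp only [map_sub, map_add, hcoassoc, hright, hleft, tensorOne_tmul, oneTensor_apply,
    tensorComul_tmul, Bialgebra.comul_one, Algebra.TensorProduct.one_def]
  abel

theorem comm_coboundary [IsCocomm k A] (a : A) :
    TensorProduct.comm k A A (coboundary k a) = coboundary k a := by
  rw [coboundary_apply, map_sub, Coalgebra.comm_comul, map_add, TensorProduct.comm_tmul,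
    TensorProduct.comm_tmul, add_comm]

/-- The additive cocycles which are invariant and normalised, the linearisation of
`IsInvariantTwist`. -/
structure IsInvariantCocycle (f : A ⊗[k] A) : Prop where
  isCocycle : IsCocycle f
  invariant : ∀ u, Commute (comul (R := k) u) f
  counit_left : counitTensor k A f = 0
  counit_right : tensorCounit k A f = 0

variable (k A) in
/-- The subspace of invariant normalised cocycles. -/
def invariantCocycles : Submodule k (A ⊗[k] A) where
  carrier := {f | IsInvariantCocycle f}
  zero_mem' := ⟨by simp [IsCocycle], fun u => Commute.zero_right _, map_zero _, map_zero _⟩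
  add_mem' {f f'} hf hf' :=
    { isCocycle := by
        rw [IsCocycle, map_add, map_add, map_add, map_add, add_add_add_comm, hf.isCocycle,
          hf'.isCocycle, add_add_add_comm]
      invariant := fun u => (hf.invariant u).add_right (hf'.invariant u)
      counit_left := by rw [map_add, hf.counit_left, hf'.counit_left, add_zero]
      counit_right := by rw [map_add, hf.counit_right, hf'.counit_right, add_zero] }
  smul_mem' c f hf :=
    { isCocycle := by
        rw [IsCocycle, map_smul, map_smul, map_smul, map_smul, ← smul_add, hf.isCocycle, smul_add]
      invariant := fun u => (hf.invariant u).smul_right c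
      counit_left := by rw [map_smul, hf.counit_left, smul_zero]
      counit_right := by rw [map_smul, hf.counit_right, smul_zero] }

theorem comm_mem_invariantCocycles [IsCocomm k A] {f : A ⊗[k] A} (hf : f ∈ invariantCocycles k A) :
    TensorProduct.comm k A A f ∈ invariantCocycles k A where
  isCocycle := hf.isCocycle.comm
  invariant u := by
    have hcomm := (hf.invariant u).map (Algebra.TensorProduct.comm k A A)
    rwa [← Coalgebra.comm_comul]
  counit_left := by
    rw [← tensorCounit_comm, TensorProduct.comm_comm, hf.counit_right]
  counit_right := by rw [tensorCounit_comm, hf.counit_left]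

variable (k A) in
/-- The central elements of counit zero, the linearisation of `centralUnits`. -/
def centralAugmentation : Submodule k A :=
  Subalgebra.toSubmodule (Subalgebra.center k A) ⊓ LinearMap.ker (counit (R := k))

theorem mem_centralAugmentation {a : A} :
    a ∈ centralAugmentation k A ↔ (∀ u, u * a = a * u) ∧ counit (R := k) a = 0 := by
  simp [centralAugmentation, Subalgebra.mem_center_iff]

theorem commute_tmul_one {a : A} (ha : ∀ u, u * a = a * u) (z : A ⊗[k] A) :
    Commute z (a ⊗ₜ 1) := by
  induction z with
  | zero => simp
  | add x y hx hy => exact hx.add_left hy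
  | tmul u v => simp [Commute, SemiconjBy, ha u]

theorem commute_one_tmul {a : A} (ha : ∀ u, u * a = a * u) (z : A ⊗[k] A) :
    Commute z (1 ⊗ₜ a) := by
  induction z with
  | zero => simp
  | add x y hx hy => exact hx.add_left hy
  | tmul u v => simp [Commute, SemiconjBy, ha v]

theorem coboundary_mem_invariantCocycles {a : A} (ha : a ∈ centralAugmentation k A) :
    coboundary k a ∈ invariantCocycles k A := by
  obtain ⟨hcentral, hcounit⟩ := mem_centralAugmentation.1 ha
  refine ⟨isCocycle_coboundary a, fun u => ?_, ?_, ?_⟩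
  · rw [coboundary_apply]
    refine ((commute_tmul_one hcentral _).add_right (commute_one_tmul hcentral _)).sub_right ?_
    rw [Commute, SemiconjBy, ← Bialgebra.comul_mul, ← Bialgebra.comul_mul, hcentral]
  · rw [coboundary_apply, map_sub, map_add, counitTensor_comul, counitTensor_tmul,
      counitTensor_tmul, hcounit, Bialgebra.counit_one, zero_smul, one_smul, zero_add, sub_self]
  · rw [coboundary_apply, map_sub, map_add, tensorCounit_comul, tensorCounit_tmul,
      tensorCounit_tmul, hcounit, Bialgebra.counit_one, zero_smul, one_smul, add_zero, sub_self]

theorem mul'_primitive_mul_sub (v : A) (z : A ⊗[k] A) :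
    LinearMap.mul' k A ((v ⊗ₜ 1 + 1 ⊗ₜ v) * z) - LinearMap.mul' k A (z * (v ⊗ₜ 1 + 1 ⊗ₜ v)) =
      v * LinearMap.mul' k A z - LinearMap.mul' k A z * v := by
  induction z with
  | zero => simp
  | add x y hx hy =>
    rw [mul_add _ x y, add_mul x y, map_add, map_add, add_sub_add_comm, hx, hy, map_add,
      mul_add, add_mul, add_sub_add_comm]
  | tmul a b =>
    simp only [add_mul, mul_add, Algebra.TensorProduct.tmul_mul_tmul, one_mul, mul_one, map_add,
      LinearMap.mul'_apply]
    noncomm_ring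

namespace IsPrimitivelyGenerated

variable {V : Submodule k A} (h : IsPrimitivelyGenerated V)

include h

theorem central_of_commute {a : A} (ha : ∀ v ∈ V, v * a = a * v) (u : A) : u * a = a * u := by
  have hV : (V : Set A) ⊆ Subalgebra.centralizer k {a} := fun v hv =>
    (Subalgebra.mem_centralizer_iff k).2 fun b hb => by rw [Set.mem_singleton_iff.1 hb, ha v hv]
  have hu : u ∈ Algebra.adjoin k (V : Set A) := h.adjoin_eq_top ▸ Algebra.mem_top
  exact ((Subalgebra.mem_centralizer_iff k).1 (Algebra.adjoin_le hV hu) a rfl).symm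

theorem mul'_mem_centralAugmentation {f : A ⊗[k] A} (hf : f ∈ invariantCocycles k A) :
    LinearMap.mul' k A f ∈ centralAugmentation k A := by
  refine mem_centralAugmentation.2 ⟨h.central_of_commute fun v hv => ?_, ?_⟩
  · rw [← sub_eq_zero, ← mul'_primitive_mul_sub, ← h.isPrimitiveElem v hv, (hf.invariant v).eq,
      sub_self]
  · rw [counit_mul', hf.counit_left, map_zero]

theorem eq_zero_of_mem_wordFil_tensorSup_one {f : A ⊗[k] A}
    (hf : f ∈ wordFil (InvTwist.tensorSup V) 1) (hleft : counitTensor k A f = 0)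
    (hright : tensorCounit k A f = 0) : f = 0 := by
  rw [wordFil_one] at hf
  obtain ⟨_, hc, _, hz, rfl⟩ := Submodule.mem_sup.1 hf
  obtain ⟨c, rfl⟩ := Submodule.mem_one.1 hc
  obtain ⟨v, hv, w, hw, rfl⟩ := mem_tensorSup.1 hz
  have hcounit_v := (h.isPrimitiveElem v hv).counit_eq_zero
  have hcounit_w := (h.isPrimitiveElem w hw).counit_eq_zero
  rw [map_add, map_add, AlgHom.commutes, counitTensor_tmul, counitTensor_tmul, hcounit_v,
    Bialgebra.counit_one, zero_smul, one_smul, zero_add] at hleft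
  rw [map_add, map_add, AlgHom.commutes, tensorCounit_tmul, tensorCounit_tmul, hcounit_w,
    Bialgebra.counit_one, zero_smul, one_smul, add_zero] at hright
  have hc : c = 0 := by simpa [hcounit_w] using congrArg (counit (R := k)) hleft
  rw [hc, map_zero, zero_add] at hleft hright
  simp [hc, hleft, hright]

theorem exists_coboundary_eq [CharZero k] [IsCocomm k A] {f : A ⊗[k] A}
    (hf : f ∈ invariantCocycles k A) (hsymm : TensorProduct.comm k A A f = f) :
    ∃ a ∈ centralAugmentation k A, coboundary k a = f := by
  obtain ⟨n, hn⟩ := h.tensorSup.exhaust f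
  replace hn := wordFil_mono n.le_succ hn
  induction n generalizing f with
  | zero =>
    refine ⟨0, Submodule.zero_mem _, ?_⟩
    rw [map_zero, h.eq_zero_of_mem_wordFil_tensorSup_one hn hf.counit_left hf.counit_right]
  | succ n ih =>
    have hmul := h.mul'_mem_centralAugmentation hf
    have hlower := h.tensorSup.adams_sub_mem hn
    rw [hf.isCocycle.adams_of_symm hsymm, sub_right_comm, ← sub_smul] at hlower
    obtain ⟨a, ha, hcobd⟩ := ih
      (Submodule.sub_mem _ (Submodule.smul_mem _ _ hf) (coboundary_mem_invariantCocycles hmul))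
      (by rw [map_sub, map_smul, hsymm, comm_coboundary]) hlower
    refine ⟨((2 : k) - 2 ^ (n + 2))⁻¹ • (a + LinearMap.mul' k A f),
      Submodule.smul_mem _ _ (Submodule.add_mem _ ha hmul), ?_⟩
    rw [map_smul, map_add, hcobd, sub_add_cancel, inv_smul_smul₀ (two_sub_two_pow_ne_zero n)]

end IsPrimitivelyGenerated

end InvariantCocycle

end Cocycle

section SkewCocycle

variable {k A : Type*} [Field k] [Ring A] [Bialgebra k A]

open Algebra.TensorProduct (includeLeft includeRight)
open Coalgebra (comul)
open WithConv (toConv)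

theorem IsCocycle.rTensor_coboundary_of_skew [CharZero k] {f : A ⊗[k] A}
    (hf : IsCocycle f) (hskew : TensorProduct.comm k A A f = -f) :
    LinearMap.rTensor A (coboundary k) f = 0 := by
  let inl : A ⊗[k] A →ₐ[k] (A ⊗[k] A) ⊗[k] A := includeLeft
  let x : A →ₐ[k] (A ⊗[k] A) ⊗[k] A := inl.comp includeLeft
  let y : A →ₐ[k] (A ⊗[k] A) ⊗[k] A := inl.comp includeRight
  let z : A →ₐ[k] (A ⊗[k] A) ⊗[k] A := includeRight
  have hrTensor (φ : A →ₗ[k] A ⊗[k] A) (w : A ⊗[k] A) :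
      evalPair (toConv (inl.toLinearMap ∘ₗ φ)) (toConv z.toLinearMap) w =
        LinearMap.rTensor A φ w := by
    induction w with
    | zero => simp
    | add a b ha hb => simp only [map_add, ha, hb]
    | tmul a b => simp [evalPair_tmul, inl, z]
  have hxy : toConv x.toLinearMap * toConv y.toLinearMap = toConv (inl.toLinearMap ∘ₗ comul) := by
    ext u
    rw [convMul_eq_evalPair_comul]
    change _ = inl (comul u)
    induction comul (R := k) u with
    | zero => simp
    | add a b ha hb => simp only [map_add, ha, hb]
    | tmul a b => simp [evalPair_tmul, inl, x, y]
  have hadditive := hf.evalPair_convMul_of_skew (α := toConv x.toLinearMap)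
    (β := toConv y.toLinearMap) (γ := toConv z.toLinearMap) hskew rfl rfl rfl
    (fun a b => by simp [x, y, inl, Commute, SemiconjBy])
    (fun a b => by simp [y, z, inl, Commute, SemiconjBy])
    (fun a b => by simp [x, z, inl, Commute, SemiconjBy])
  rw [hxy] at hadditive
  change evalPair _ _ f = evalPair (toConv (inl.toLinearMap ∘ₗ includeLeft.toLinearMap)) _ f +
    evalPair (toConv (inl.toLinearMap ∘ₗ includeRight.toLinearMap)) _ f at hadditive
  rw [hrTensor, hrTensor, hrTensor] at hadditive
  rw [coboundary, LinearMap.rTensor_sub, LinearMap.rTensor_add, LinearMap.sub_apply,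
    LinearMap.add_apply, hadditive, sub_self]

theorem exists_map_eq_of_rTensor_eq_of_skew {M N : Type*} [AddCommGroup M] [Module k M]
    [AddCommGroup N] [Module k N] {ι : M →ₗ[k] N} (hι : Function.Injective ι) {f : N ⊗[k] N}
    (hf : f ∈ (LinearMap.rTensor N ι).range) (hskew : TensorProduct.comm k N N f = -f) :
    ∃ X, TensorProduct.map ι ι X = f := by
  obtain ⟨w, hw⟩ := hf
  obtain ⟨p, hp⟩ := ι.exists_leftInverse_of_injective (LinearMap.ker_eq_bot.2 hι)
  have hleft : TensorProduct.map (ι ∘ₗ p) LinearMap.id f = f := by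
    rw [← hw, LinearMap.rTensor, TensorProduct.map_map, LinearMap.comp_assoc, hp,
      LinearMap.comp_id, LinearMap.id_comp]
  have hright : TensorProduct.map LinearMap.id (ι ∘ₗ p) f = f := by
    rw [← neg_neg f, ← hskew, map_neg, TensorProduct.map_comm, hleft]
  refine ⟨TensorProduct.map p p f, ?_⟩
  calc TensorProduct.map ι ι (TensorProduct.map p p f)
      = TensorProduct.map (ι ∘ₗ p) LinearMap.id (TensorProduct.map LinearMap.id (ι ∘ₗ p) f) := by
        rw [TensorProduct.map_map, TensorProduct.map_map, LinearMap.comp_id, LinearMap.id_comp]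
    _ = f := by rw [hright, hleft]

end SkewCocycle

section EnvCocycle

variable {k g : Type*} [Field k] [LieRing g] [LieAlgebra k g]

open Coalgebra (comul)

attribute [local instance 100] LieRing.ofAssociativeRing

variable (k g) in
/-- The map `g ⊗ g → U(g) ⊗ U(g)` induced by `g → U(g)`. -/
abbrev envι₂ : g ⊗[k] g →ₗ[k] UniversalEnvelopingAlgebra k g ⊗[k] UniversalEnvelopingAlgebra k g :=
  TensorProduct.map (envι k g) (envι k g)

theorem envι₂_lie (x : g) (X : g ⊗[k] g) :
    envι₂ k g ⁅x, X⁆ = comul (R := k) (envι k g x) * envι₂ k g X -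
      envι₂ k g X * comul (R := k) (envι k g x) := by
  rw [comul_envι]
  induction X with
  | zero => simp
  | add X Y hX hY =>
    rw [lie_add, map_add, hX, hY, map_add, mul_add _ (envι₂ k g X), add_mul (envι₂ k g X),
      add_sub_add_comm]
  | tmul a b =>
    rw [TensorProduct.LieModule.lie_tmul_right, map_add, TensorProduct.map_tmul,
      TensorProduct.map_tmul, TensorProduct.map_tmul, envι_lie, envι_lie]
    simp only [add_mul, mul_add, Algebra.TensorProduct.tmul_mul_tmul, one_mul, mul_one,
      TensorProduct.sub_tmul, TensorProduct.tmul_sub]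
    abel

variable (k g) in
theorem envι₂_injective [CharZero k] : Function.Injective (envι₂ k g) :=
  TensorProduct.map_injective_of_flat_flat _ _ (envι_injective k g) (envι_injective k g)

theorem mem_invariantBivectors {X : g ⊗[k] g} :
    X ∈ invariantBivectors k g ↔ (∀ x : g, ⁅x, X⁆ = 0) ∧ TensorProduct.comm k g g X = -X := by
  simp [invariantBivectors, eq_neg_iff_add_eq_zero]

variable (k g) in
theorem exact_envι_coboundary [CharZero k] :
    Function.Exact (envι k g) (coboundary k : UniversalEnvelopingAlgebra k g →ₗ[k] _) := by
  intro p
  rw [coboundary_apply, sub_eq_zero, eq_comm]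
  refine ⟨fun hp => (isPrimitivelyGenerated_range_envι k g).mem_of_isPrimitiveElem hp, ?_⟩
  rintro ⟨v, rfl⟩
  exact comul_envι k v

theorem exists_envι₂_eq [CharZero k]
    {f : UniversalEnvelopingAlgebra k g ⊗[k] UniversalEnvelopingAlgebra k g} (hf : IsCocycle f)
    (hskew : TensorProduct.comm k _ _ f = -f) (hinv : ∀ u, Commute (comul (R := k) u) f) :
    ∃ X ∈ invariantBivectors k g, envι₂ k g X = f := by
  have hrange := (Module.Flat.rTensor_exact (UniversalEnvelopingAlgebra k g)
    (exact_envι_coboundary k g) f).1 (hf.rTensor_coboundary_of_skew hskew)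
  obtain ⟨X, rfl⟩ := exists_map_eq_of_rTensor_eq_of_skew (envι_injective k g) hrange hskew
  refine ⟨X, mem_invariantBivectors.2 ⟨fun x => ?_, ?_⟩, rfl⟩
  · apply envι₂_injective k g
    rw [envι₂_lie, (hinv _).eq, sub_self, map_zero]
  · apply envι₂_injective k g
    rw [map_neg, ← hskew, TensorProduct.map_comm]

theorem exists_envι₂_add_coboundary_eq [CharZero k]
    {f : UniversalEnvelopingAlgebra k g ⊗[k] UniversalEnvelopingAlgebra k g}
    (hf : f ∈ invariantCocycles k (UniversalEnvelopingAlgebra k g)) :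
    ∃ X ∈ invariantBivectors k g, ∃ a ∈ centralAugmentation k (UniversalEnvelopingAlgebra k g),
      envι₂ k g X + coboundary k a = f := by
  have hcomm := comm_mem_invariantCocycles hf
  have hskew := Submodule.smul_mem _ (2⁻¹ : k) (Submodule.sub_mem _ hf hcomm)
  have hsymm := Submodule.smul_mem _ (2⁻¹ : k) (Submodule.add_mem _ hf hcomm)
  obtain ⟨X, hX, hXf⟩ := exists_envι₂_eq hskew.isCocycle
    (by rw [map_smul, map_sub, TensorProduct.comm_comm, ← smul_neg, neg_sub]) hskew.invariant
  obtain ⟨a, ha, haf⟩ := (isPrimitivelyGenerated_range_envι k g).exists_coboundary_eq hsymm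
    (by rw [map_smul, map_add, TensorProduct.comm_comm, add_comm])
  refine ⟨X, hX, a, ha, ?_⟩
  rw [hXf, haf, ← smul_add, sub_add_add_cancel, ← two_smul k f, inv_smul_smul₀ two_ne_zero]

end EnvCocycle

/-! ### Commutators of invariant bivectors -/

section ThreefoldTensors

variable {k M N P : Type*} [CommRing k] [AddCommGroup M] [Module k M] [AddCommGroup N] [Module k N]
  [AddCommGroup P] [Module k P]

@[elab_as_elim]
theorem induction_tmul_tmul {motive : M ⊗[k] (N ⊗[k] P) → Prop} (zero : motive 0)
    (add : ∀ x y, motive x → motive y → motive (x + y))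
    (tmul : ∀ a b c, motive (a ⊗ₜ (b ⊗ₜ c))) (T : M ⊗[k] (N ⊗[k] P)) : motive T := by
  induction T with
  | zero => exact zero
  | add x y hx hy => exact add x y hx hy
  | tmul a z =>
    induction z with
    | zero => rwa [TensorProduct.tmul_zero]
    | add x y hx hy => rw [TensorProduct.tmul_add]; exact add _ _ hx hy
    | tmul b c => exact tmul a b c

variable (k M N P) in
/-- The exchange of the last two factors of a threefold tensor product. -/
def swapRight : M ⊗[k] (N ⊗[k] P) →ₗ[k] M ⊗[k] (P ⊗[k] N) :=
  LinearMap.lTensor M (TensorProduct.comm k N P).toLinearMap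

variable (k M N P) in
/-- The exchange of the first two factors of a threefold tensor product. -/
def swapLeft : M ⊗[k] (N ⊗[k] P) →ₗ[k] N ⊗[k] (M ⊗[k] P) :=
  (TensorProduct.leftComm k M N P).toLinearMap

theorem swapRight_tmul (m : M) (z : N ⊗[k] P) :
    swapRight k M N P (m ⊗ₜ z) = m ⊗ₜ TensorProduct.comm k N P z := rfl

theorem swapLeft_tmul_tmul (m : M) (n : N) (p : P) :
    swapLeft k M N P (m ⊗ₜ (n ⊗ₜ p)) = n ⊗ₜ (m ⊗ₜ p) := rfl

theorem swapLeft_assoc_tmul (z : M ⊗[k] N) (p : P) :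
    swapLeft k M N P (TensorProduct.assoc k M N P (z ⊗ₜ p)) =
      TensorProduct.assoc k N M P (TensorProduct.comm k M N z ⊗ₜ p) := by
  induction z with
  | zero => rw [TensorProduct.zero_tmul, map_zero, map_zero, map_zero, TensorProduct.zero_tmul,
      map_zero]
  | add x y hx hy => simp only [map_add, TensorProduct.add_tmul, hx, hy]
  | tmul a b => rfl

end ThreefoldTensors

section MiddleBracket

variable {k g : Type*} [CommRing k] [LieRing g] [LieAlgebra k g]

variable (k g) in
/-- The bilinear map `(a ⊗ b, c ⊗ d) ↦ a ⊗ ⁅b, c⁆ ⊗ d`. -/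
def middleBracket : g ⊗[k] g →ₗ[k] g ⊗[k] g →ₗ[k] g ⊗[k] (g ⊗[k] g) :=
  TensorProduct.lift (LinearMap.mk₂ k
    (fun a b => TensorProduct.mk k g (g ⊗[k] g) a ∘ₗ LinearMap.rTensor g (LieAlgebra.ad k g b))
    (fun a a' b => by simp [LinearMap.add_comp])
    (fun c a b => by simp [LinearMap.smul_comp])
    (fun a b b' => by simp [LinearMap.rTensor_add, LinearMap.comp_add])
    (fun c a b => by simp [LinearMap.rTensor_smul, LinearMap.comp_smul]))

theorem middleBracket_tmul (a b : g) (Y : g ⊗[k] g) :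
    middleBracket k g (a ⊗ₜ b) Y = a ⊗ₜ LinearMap.rTensor g (LieAlgebra.ad k g b) Y := by
  simp [middleBracket]

theorem middleBracket_tmul_tmul (a b c d : g) :
    middleBracket k g (a ⊗ₜ b) (c ⊗ₜ d) = a ⊗ₜ (⁅b, c⁆ ⊗ₜ d) := by
  simp [middleBracket_tmul]

theorem middleBracket_tmul_right (X : g ⊗[k] g) (c d : g) :
    middleBracket k g X (c ⊗ₜ d) = -TensorProduct.assoc k g g g
      (LinearMap.lTensor g (LieAlgebra.ad k g c) X ⊗ₜ d) := by
  induction X with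
  | zero => simp
  | add X Y hX hY =>
    simp only [map_add, LinearMap.add_apply, hX, hY, TensorProduct.add_tmul, neg_add]
  | tmul a b =>
    rw [middleBracket_tmul_tmul, LinearMap.lTensor_tmul, TensorProduct.assoc_tmul,
      LieAlgebra.ad_apply, ← lie_skew b c, TensorProduct.neg_tmul, TensorProduct.tmul_neg]

theorem lie_middleBracket (x : g) (X Y : g ⊗[k] g) :
    ⁅x, middleBracket k g X Y⁆ = middleBracket k g ⁅x, X⁆ Y + middleBracket k g X ⁅x, Y⁆ := by
  induction X with
  | zero => simp
  | add X X' hX hX' =>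
    rw [lie_add, map_add, map_add, LinearMap.add_apply, LinearMap.add_apply, LinearMap.add_apply,
      lie_add, hX, hX', add_add_add_comm]
  | tmul a b =>
    induction Y with
    | zero => simp
    | add Y Y' hY hY' =>
      rw [lie_add, map_add, map_add, map_add, lie_add, hY, hY', add_add_add_comm]
    | tmul c d =>
      simp only [TensorProduct.LieModule.lie_tmul_right, map_add, LinearMap.add_apply,
        middleBracket_tmul_tmul, leibniz_lie x b c, TensorProduct.add_tmul, TensorProduct.tmul_add]
      abel

theorem rTensor_ad_eq_neg_lTensor_ad {X : g ⊗[k] g} (hX : ∀ x : g, ⁅x, X⁆ = 0) (x : g) :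
    LinearMap.rTensor g (LieAlgebra.ad k g x) X = -LinearMap.lTensor g (LieAlgebra.ad k g x) X :=
  eq_neg_of_add_eq_zero_left (hX x)

theorem comm_rTensor_ad {X : g ⊗[k] g} (hX : ∀ x : g, ⁅x, X⁆ = 0)
    (hskew : TensorProduct.comm k g g X = -X) (x : g) :
    TensorProduct.comm k g g (LinearMap.rTensor g (LieAlgebra.ad k g x) X) =
      LinearMap.rTensor g (LieAlgebra.ad k g x) X := by
  rw [LinearMap.rTensor, ← TensorProduct.map_comm, hskew, map_neg, ← LinearMap.lTensor,
    ← LinearMap.rTensor, rTensor_ad_eq_neg_lTensor_ad hX]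

theorem swapRight_middleBracket (X : g ⊗[k] g) {Y : g ⊗[k] g} (hY : ∀ x : g, ⁅x, Y⁆ = 0)
    (hskew : TensorProduct.comm k g g Y = -Y) :
    swapRight k g g g (middleBracket k g X Y) = middleBracket k g X Y := by
  induction X with
  | zero => simp
  | add X X' hX hX' => simp only [map_add, LinearMap.add_apply, hX, hX']
  | tmul a b => rw [middleBracket_tmul, swapRight_tmul, comm_rTensor_ad hY hskew]

theorem swapLeft_middleBracket {X : g ⊗[k] g} (hX : ∀ x : g, ⁅x, X⁆ = 0)
    (hskew : TensorProduct.comm k g g X = -X) (Y : g ⊗[k] g) :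
    swapLeft k g g g (middleBracket k g X Y) = middleBracket k g X Y := by
  induction Y with
  | zero => simp
  | add Y Y' hY hY' => simp only [map_add, hY, hY']
  | tmul c d =>
    rw [middleBracket_tmul_right, ← map_neg (TensorProduct.assoc k g g g),
      ← TensorProduct.neg_tmul, ← rTensor_ad_eq_neg_lTensor_ad hX, swapLeft_assoc_tmul,
      comm_rTensor_ad hX hskew]

end MiddleBracket

section Cubic

variable {k g : Type*} [Field k] [LieRing g] [LieAlgebra k g]

open Coalgebra (counit)

attribute [local instance 100] LieRing.ofAssociativeRing

variable (k g) in
/-- The product `a ⊗ b ⊗ c ↦ a b c` in `U(g)`. -/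
def tripleProd : g ⊗[k] (g ⊗[k] g) →ₗ[k] UniversalEnvelopingAlgebra k g :=
  LinearMap.mul' k _ ∘ₗ TensorProduct.map (envι k g) (LinearMap.mul' k _ ∘ₗ envι₂ k g)

variable (k g) in
/-- The map `a ⊗ b ⊗ c ↦ a b ⊗ c`. -/
def prodLeft : g ⊗[k] (g ⊗[k] g) →ₗ[k]
    UniversalEnvelopingAlgebra k g ⊗[k] UniversalEnvelopingAlgebra k g :=
  TensorProduct.map (LinearMap.mul' k _ ∘ₗ envι₂ k g) (envι k g) ∘ₗ
    (TensorProduct.assoc k g g g).symm.toLinearMap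

variable (k g) in
/-- The map `a ⊗ b ⊗ c ↦ a ⊗ b c`. -/
def prodRight : g ⊗[k] (g ⊗[k] g) →ₗ[k]
    UniversalEnvelopingAlgebra k g ⊗[k] UniversalEnvelopingAlgebra k g :=
  TensorProduct.map (envι k g) (LinearMap.mul' k _ ∘ₗ envι₂ k g)

theorem tripleProd_tmul (a b c : g) :
    tripleProd k g (a ⊗ₜ (b ⊗ₜ c)) = envι k g a * (envι k g b * envι k g c) := rfl

theorem prodLeft_tmul (a b c : g) :
    prodLeft k g (a ⊗ₜ (b ⊗ₜ c)) = (envι k g a * envι k g b) ⊗ₜ envι k g c := rfl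

theorem prodRight_tmul (a b c : g) :
    prodRight k g (a ⊗ₜ (b ⊗ₜ c)) = envι k g a ⊗ₜ (envι k g b * envι k g c) := rfl

-- The six summands are those of the coproduct of a product of three primitive elements.
theorem coboundary_tripleProd (T : g ⊗[k] (g ⊗[k] g)) :
    coboundary k (tripleProd k g T) =
      -(prodLeft k g (T + swapRight k g g g T + swapRight k g g g (swapLeft k g g g T)) +
        prodRight k g (T + swapLeft k g g g T + swapLeft k g g g (swapRight k g g g T))) := by
  induction T using induction_tmul_tmul with
  | zero => simp
  | add x y hx hy =>
    simp only [map_add] at hx hy ⊢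
    rw [hx, hy]
    abel
  | tmul a b c =>
    simp only [tripleProd_tmul, coboundary_apply, Bialgebra.comul_mul, comul_envι, map_add,
      swapLeft_tmul_tmul, swapRight_tmul, TensorProduct.comm_tmul, prodLeft_tmul, prodRight_tmul,
      add_mul, mul_add, Algebra.TensorProduct.tmul_mul_tmul, one_mul, mul_one]
    abel

theorem coboundary_tripleProd_of_symm {T : g ⊗[k] (g ⊗[k] g)} (hleft : swapLeft k g g g T = T)
    (hright : swapRight k g g g T = T) :
    coboundary k (tripleProd k g T) = -((3 : k) • (prodLeft k g T + prodRight k g T)) := by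
  rw [coboundary_tripleProd, hleft, hright, hleft, map_add, map_add, map_add, map_add]
  module

theorem tripleProd_lie (x : g) (T : g ⊗[k] (g ⊗[k] g)) :
    tripleProd k g ⁅x, T⁆ = envι k g x * tripleProd k g T - tripleProd k g T * envι k g x := by
  induction T using induction_tmul_tmul with
  | zero => simp
  | add y z hy hz =>
    rw [lie_add, map_add, map_add, hy, hz, mul_add, add_mul, add_sub_add_comm]
  | tmul a b c =>
    simp only [TensorProduct.LieModule.lie_tmul_right, TensorProduct.tmul_add, map_add,
      tripleProd_tmul, envι_lie]
    noncomm_ring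

theorem counit_tripleProd (T : g ⊗[k] (g ⊗[k] g)) :
    counit (R := k) (tripleProd k g T) = 0 := by
  induction T using induction_tmul_tmul with
  | zero => simp
  | add x y hx hy => rw [map_add, map_add, hx, hy, add_zero]
  | tmul a b c => rw [tripleProd_tmul, Bialgebra.counit_mul, counit_envι, zero_mul]

theorem tripleProd_mem_centralAugmentation {T : g ⊗[k] (g ⊗[k] g)} (hT : ∀ x : g, ⁅x, T⁆ = 0) :
    tripleProd k g T ∈ centralAugmentation k (UniversalEnvelopingAlgebra k g) := by
  refine mem_centralAugmentation.2
    ⟨(isPrimitivelyGenerated_range_envι k g).central_of_commute ?_, counit_tripleProd T⟩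
  rintro _ ⟨x, rfl⟩
  rw [← sub_eq_zero, ← tripleProd_lie, hT, map_zero]

-- `[a ⊗ b, c ⊗ d] = a c ⊗ [b, d] + [a, c] ⊗ d b`.
theorem envι₂_mul_sub_mul (X Y : g ⊗[k] g) :
    envι₂ k g X * envι₂ k g Y - envι₂ k g Y * envι₂ k g X =
      prodLeft k g (swapRight k g g g (middleBracket k g X (TensorProduct.comm k g g Y))) +
      prodRight k g (swapRight k g g g (swapLeft k g g g
        (middleBracket k g (TensorProduct.comm k g g X) Y))) := by
  induction X with
  | zero => simp
  | add X X' hX hX' =>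
    simp only [map_add, add_mul, mul_add, LinearMap.add_apply] at hX hX' ⊢
    rw [add_sub_add_comm, hX, hX', add_add_add_comm]
  | tmul a b =>
    induction Y with
    | zero => simp
    | add Y Y' hY hY' =>
      simp only [map_add, add_mul, mul_add] at hY hY' ⊢
      rw [add_sub_add_comm, hY, hY', add_add_add_comm]
    | tmul c d =>
      simp only [TensorProduct.comm_tmul, middleBracket_tmul_tmul, swapLeft_tmul_tmul,
        swapRight_tmul, TensorProduct.map_tmul, prodLeft_tmul, prodRight_tmul, envι_lie,
        Algebra.TensorProduct.tmul_mul_tmul, TensorProduct.sub_tmul, TensorProduct.tmul_sub]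
      abel

theorem envι₂_mul_sub_mul_of_invariant {X Y : g ⊗[k] g} (hX : X ∈ invariantBivectors k g)
    (hY : Y ∈ invariantBivectors k g) :
    envι₂ k g X * envι₂ k g Y - envι₂ k g Y * envι₂ k g X =
      -(prodLeft k g (middleBracket k g X Y) + prodRight k g (middleBracket k g X Y)) := by
  obtain ⟨hXinv, hXskew⟩ := mem_invariantBivectors.1 hX
  obtain ⟨hYinv, hYskew⟩ := mem_invariantBivectors.1 hY
  rw [envι₂_mul_sub_mul, hXskew, hYskew]
  simp only [map_neg, LinearMap.neg_apply]
  rw [swapLeft_middleBracket hXinv hXskew, swapRight_middleBracket X hYinv hYskew, neg_add]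

variable (k g) in
/-- The element `(1/3) ∑ a ⁅b, c⁆ d` of `U(g)` attached to `∑ a ⊗ b` and `∑ c ⊗ d`.  For invariant
bivectors it is a third of a symmetric tensor, and the coproduct of a product of three primitive
elements produces each mixed term three times; so its coboundary is the commutator. -/
def cubic : g ⊗[k] g →ₗ[k] g ⊗[k] g →ₗ[k] UniversalEnvelopingAlgebra k g :=
  (middleBracket k g).compr₂ ((3 : k)⁻¹ • tripleProd k g)

theorem coboundary_cubic [CharZero k] {X Y : g ⊗[k] g} (hX : X ∈ invariantBivectors k g)
    (hY : Y ∈ invariantBivectors k g) :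
    coboundary k (cubic k g X Y) = envι₂ k g X * envι₂ k g Y - envι₂ k g Y * envι₂ k g X := by
  obtain ⟨hXinv, hXskew⟩ := mem_invariantBivectors.1 hX
  obtain ⟨hYinv, hYskew⟩ := mem_invariantBivectors.1 hY
  rw [envι₂_mul_sub_mul_of_invariant hX hY, cubic, LinearMap.compr₂_apply, LinearMap.smul_apply,
    map_smul, coboundary_tripleProd_of_symm (swapLeft_middleBracket hXinv hXskew Y)
      (swapRight_middleBracket X hYinv hYskew), smul_neg, inv_smul_smul₀ three_ne_zero]

theorem cubic_mem_centralAugmentation {X Y : g ⊗[k] g} (hX : X ∈ invariantBivectors k g)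
    (hY : Y ∈ invariantBivectors k g) :
    cubic k g X Y ∈ centralAugmentation k (UniversalEnvelopingAlgebra k g) := by
  refine Submodule.smul_mem _ _ (tripleProd_mem_centralAugmentation fun x => ?_)
  rw [lie_middleBracket, (mem_invariantBivectors.1 hX).1, (mem_invariantBivectors.1 hY).1, map_zero,
    LinearMap.zero_apply, map_zero, add_zero]

end Cubic

/-! ### Exponential twists -/

section ExtensionOfScalars

variable {k A B : Type*} [Field k] [Ring A] [Algebra k A] [Ring B] [Algebra k B]

open PowerSeries (coeff constantCoeff)

theorem constantCoeff_extendh (f : A →ₐ[k] B) (Y : PowerSeries A) :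
    constantCoeff (extendh f Y) = f (constantCoeff Y) := by
  rw [← PowerSeries.coeff_zero_eq_constantCoeff_apply, PowerSeries.coeff_map,
    PowerSeries.coeff_zero_eq_constantCoeff_apply, AlgHom.coe_toRingHom]

theorem extendh_exph_eq_one {f : A →ₐ[k] B} {Y : PowerSeries A} (h : ∀ n, f (coeff n Y) = 0) :
    extendh f (exph k Y) = 1 := by
  have hfY : extendh f Y = 0 := PowerSeries.ext h
  rw [extendh_exph, hfY, exph_zero]

theorem coeff_extendh_mul_extendh_sub {F G : PowerSeries A} {n : ℕ} (hn : n ≠ 0)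
    (hFG : ∀ i < n, coeff i F = coeff i G) (hF : constantCoeff F = 1) (f f' : A →ₐ[k] B) :
    coeff n (extendh f F * extendh f' F) - coeff n (extendh f G * extendh f' G) =
      f (coeff n F - coeff n G) + f' (coeff n F - coeff n G) := by
  rw [coeff_mul_sub_coeff_mul hn (fun i hi => by simp [hFG i hi]) (fun i hi => by simp [hFG i hi]),
    constantCoeff_extendh, constantCoeff_extendh, hF]
  simp

end ExtensionOfScalars

section ExponentialTwists

variable {k A : Type*} [Field k] [Ring A] [Bialgebra k A]

open Coalgebra (comul)
open PowerSeries (coeff constantCoeff)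

theorem commute_comulh {Y : PowerSeries (A ⊗[k] A)}
    (h : ∀ n u, Commute (comul (R := k) u) (coeff n Y)) (x : PowerSeries A) :
    Commute (comulh k A x) Y := by
  refine commute_of_coeff fun i j => ?_
  rw [PowerSeries.coeff_map]
  exact h j _

theorem isInvariantTwist_exphUnit [CharZero k] {Y : PowerSeries (A ⊗[k] A)}
    (hY : constantCoeff Y = 0) (hmem : ∀ n, coeff n Y ∈ invariantCocycles k A) :
    IsInvariantTwist k (exphUnit (k := k) hY) := by
  have hinv (x : PowerSeries A) : Commute (comulh k A x) Y :=
    commute_comulh (fun n => (hmem n).invariant) x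
  have hconst (f : A ⊗[k] A →ₐ[k] A ⊗[k] (A ⊗[k] A)) : constantCoeff (extendh f Y) = 0 := by
    rw [constantCoeff_extendh, hY, map_zero]
  have hsum : extendh (tensorOne k A) Y + extendh (comulTensor k A) Y =
      extendh (oneTensor k A) Y + extendh (tensorComul k A) Y :=
    PowerSeries.ext fun n => (hmem n).isCocycle
  refine ⟨fun x => (commute_exph hY (hinv x)).eq, ?_,
    extendh_exph_eq_one fun n => (hmem n).counit_left,
    extendh_exph_eq_one fun n => (hmem n).counit_right⟩
  change extendh _ (exph k Y) * extendh _ (exph k Y) =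
    extendh _ (exph k Y) * extendh _ (exph k Y)
  rw [extendh_exph, extendh_exph, extendh_exph, extendh_exph,
    ← exph_add (hconst _) (hconst _) (commute_comulTensor (fun x => (hinv x).eq) Y),
    ← exph_add (hconst _) (hconst _) (commute_tensorComul (fun x => (hinv x).eq) Y), hsum]

/-- The invariant twist `exp(Y)` attached to a series of invariant cocycles without constant
term. -/
def exphTwist [CharZero k] {Y : PowerSeries (A ⊗[k] A)} (hY : constantCoeff Y = 0)
    (hmem : ∀ n, coeff n Y ∈ invariantCocycles k A) : invariantTwists k A :=
  ⟨exphUnit hY, isInvariantTwist_exphUnit hY hmem⟩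

theorem IsInvariantTwist.coeff_sub_mem_invariantCocycles {F G : (PowerSeries (A ⊗[k] A))ˣ}
    (hF : IsInvariantTwist k F) (hG : IsInvariantTwist k G) (hF1 : constantCoeff F.1 = 1) {n : ℕ}
    (hn : n ≠ 0) (hFG : ∀ i < n, coeff i F.1 = coeff i G.1) :
    coeff n F.1 - coeff n G.1 ∈ invariantCocycles k A := by
  refine ⟨?_, fun u => ?_, ?_, ?_⟩
  · rw [IsCocycle, ← coeff_extendh_mul_extendh_sub hn hFG hF1,
      ← coeff_extendh_mul_extendh_sub hn hFG hF1, hF.cocycle, hG.cocycle]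
  · exact (coeff_commute_comul hF.invariant u n).sub_right (coeff_commute_comul hG.invariant u n)
  · rw [map_sub, sub_eq_zero]
    exact congrArg (coeff n) (hF.counit_left.trans hG.counit_left.symm)
  · rw [map_sub, sub_eq_zero]
    exact congrArg (coeff n) (hF.counit_right.trans hG.counit_right.symm)

-- The exponential of the truncation of `Y` below degree `n` is an invariant twist which agrees with
-- `F` below degree `n`, and differs from it by the coefficient of `Y` in degree `n`.
theorem IsInvariantTwist.coeff_log_mem_invariantCocycles [CharZero k]
    {F : (PowerSeries (A ⊗[k] A))ˣ} (hF : IsInvariantTwist k F) {Y : PowerSeries (A ⊗[k] A)}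
    (hY : constantCoeff Y = 0) (hYF : exph k Y = F.1) (n : ℕ) :
    coeff n Y ∈ invariantCocycles k A := by
  induction n using Nat.strong_induction_on with
  | _ n ih =>
    rcases eq_or_ne n 0 with rfl | hn
    · rw [PowerSeries.coeff_zero_eq_constantCoeff_apply, hY]
      exact Submodule.zero_mem _
    let Z : PowerSeries (A ⊗[k] A) := PowerSeries.trunc n Y
    have hZ (i : ℕ) : coeff i Z = if i < n then coeff i Y else 0 := by
      rw [Polynomial.coeff_coe, PowerSeries.coeff_trunc]
    have hYZ : ∀ i < n, coeff i Y = coeff i Z := fun i hi => by rw [hZ, if_pos hi]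
    have hZ0 : constantCoeff Z = 0 := by
      rw [← PowerSeries.coeff_zero_eq_constantCoeff_apply, ← hYZ 0 (Nat.pos_of_ne_zero hn),
        PowerSeries.coeff_zero_eq_constantCoeff_apply, hY]
    have hZmem (i : ℕ) : coeff i Z ∈ invariantCocycles k A := by
      rw [hZ]
      split_ifs with hi
      exacts [ih i hi, Submodule.zero_mem _]
    have hdiff : coeff n F.1 - coeff n (exphUnit (k := k) hZ0).1 = coeff n Y := by
      rw [← hYF]
      refine (coeff_exph_sub hY hYZ hn).trans ?_
      rw [hZ, if_neg (lt_irrefl n), sub_zero]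
    rw [← hdiff]
    refine hF.coeff_sub_mem_invariantCocycles (isInvariantTwist_exphUnit hZ0 hZmem) ?_ hn ?_
    · rw [← hYF, constantCoeff_exph]
    · rw [← hYF]
      exact coeff_exph_congr hY hYZ

end ExponentialTwists

section ExponentialBoundary

variable {k A : Type*} [Field k] [Ring A] [Bialgebra k A]

open Algebra.TensorProduct (includeLeft includeRight)
open Coalgebra (IsCocomm)
open PowerSeries (coeff constantCoeff)

variable (k) in
/-- The coboundary `s ⊗ 1 + 1 ⊗ s - Δ(s)` of a power series. -/
def coboundaryh (s : PowerSeries A) : PowerSeries (A ⊗[k] A) :=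
  extendh (includeLeft : A →ₐ[k] A ⊗[k] A) s + extendh (includeRight : A →ₐ[k] A ⊗[k] A) s -
    comulh k A s

theorem coeff_coboundaryh (s : PowerSeries A) (n : ℕ) :
    coeff n (coboundaryh k s) = coboundary k (coeff n s) := by
  simp [coboundaryh, coboundary_apply]

theorem coboundaryh_smul (c : k) (s : PowerSeries A) :
    coboundaryh k (c • s) = c • coboundaryh k s := by
  ext n
  rw [coeff_coboundaryh, PowerSeries.coeff_smul, PowerSeries.coeff_smul, map_smul,
    coeff_coboundaryh]

theorem constantCoeff_coboundaryh {s : PowerSeries A} (hs : constantCoeff s = 0) :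
    constantCoeff (coboundaryh k s) = 0 := by
  rw [← PowerSeries.coeff_zero_eq_constantCoeff_apply, coeff_coboundaryh,
    PowerSeries.coeff_zero_eq_constantCoeff_apply, hs, map_zero]

theorem commute_extendh_includeLeft_includeRight (s t : PowerSeries A) :
    Commute (extendh (includeLeft : A →ₐ[k] A ⊗[k] A) s)
      (extendh (includeRight : A →ₐ[k] A ⊗[k] A) t) :=
  commute_of_coeff fun m n => by simp [Commute, SemiconjBy]

variable (k A) in
/-- The series without constant term whose coefficients are central of counit zero: the domain of
the exponential map to `centralUnits`. -/
def centralSeries : Submodule k (PowerSeries A) where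
  carrier := {s | constantCoeff s = 0 ∧ ∀ n, coeff n s ∈ centralAugmentation k A}
  zero_mem' := ⟨map_zero _, fun n => by simp⟩
  add_mem' := by
    rintro s t ⟨hs, hs'⟩ ⟨ht, ht'⟩
    refine ⟨by rw [map_add, hs, ht, add_zero], fun n => ?_⟩
    rw [map_add]
    exact Submodule.add_mem _ (hs' n) (ht' n)
  smul_mem' := by
    rintro c s ⟨hs, hs'⟩
    refine ⟨?_, fun n => ?_⟩
    · rw [← PowerSeries.coeff_zero_eq_constantCoeff_apply, PowerSeries.coeff_smul,
        PowerSeries.coeff_zero_eq_constantCoeff_apply, hs, smul_zero]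
    · rw [PowerSeries.coeff_smul]
      exact Submodule.smul_mem _ _ (hs' n)

theorem commute_of_mem_centralSeries {s : PowerSeries A} (hs : s ∈ centralSeries k A)
    (x : PowerSeries A) : Commute x s :=
  commute_of_coeff fun _ j => (mem_centralAugmentation.1 (hs.2 j)).1 _

theorem commute_coboundaryh {s : PowerSeries A} (hs : s ∈ centralSeries k A)
    {Y : PowerSeries (A ⊗[k] A)} (hY : Commute (comulh k A s) Y) : Commute (coboundaryh k s) Y := by
  have hcentral (n : ℕ) := (mem_centralAugmentation.1 (hs.2 n)).1
  refine (Commute.add_left ?_ ?_).sub_left hY <;> refine commute_of_coeff fun i j => ?_ <;>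
    rw [PowerSeries.coeff_map]
  exacts [(commute_tmul_one (hcentral i) _).symm, (commute_one_tmul (hcentral i) _).symm]

variable (k A) in
/-- The exponential of central series. -/
def expCentral [CharZero k] : Multiplicative (centralSeries k A) →* centralUnits k A where
  toFun s := ⟨exphUnit (k := k) s.toAdd.2.1,
    Subring.mem_center_iff.2 fun x => (commute_exph s.toAdd.2.1
      (commute_of_mem_centralSeries s.toAdd.2 x)).eq,
    extendh_exph_eq_one fun n => (mem_centralAugmentation.1 (s.toAdd.2.2 n)).2⟩
  map_one' := Subtype.ext (Units.ext exph_zero)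
  map_mul' s t := Subtype.ext (Units.ext (exph_add s.toAdd.2.1 t.toAdd.2.1
    (commute_of_mem_centralSeries t.toAdd.2 _)))

theorem boundary_expCentral [CharZero k] (s : centralSeries k A) :
    (boundary k A (expCentral k A (Multiplicative.ofAdd s))).1.1 =
      exph k (coboundaryh k s.1) := by
  have hconst (f : A →ₐ[k] A ⊗[k] A) : constantCoeff (extendh f s.1) = 0 := by
    rw [constantCoeff_extendh, s.2.1, map_zero]
  have hunits : tensorSelfUnit (expCentral k A (Multiplicative.ofAdd s)) *
      (comulUnit (expCentral k A (Multiplicative.ofAdd s)))⁻¹ =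
        exphUnit (k := k) (constantCoeff_coboundaryh (k := k) s.2.1) := by
    rw [mul_inv_eq_iff_eq_mul]
    ext1
    change extendh _ (exph k s.1) * extendh _ (exph k s.1) =
      exph k (coboundaryh k s.1) * extendh _ (exph k s.1)
    rw [extendh_exph, extendh_exph, extendh_exph,
      ← exph_add (hconst _) (hconst _) (commute_extendh_includeLeft_includeRight _ _),
      ← exph_add (constantCoeff_coboundaryh s.2.1) (hconst _)
        (commute_coboundaryh s.2 (Commute.refl _)), coboundaryh, sub_add_cancel]
  exact congrArg Units.val hunits

theorem extendh_comm_boundary [IsCocomm k A] (x : centralUnits k A) :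
    extendh (Algebra.TensorProduct.comm k A A).toAlgHom (boundary k A x).1.1 =
      (boundary k A x).1.1 := by
  let τ : A ⊗[k] A →ₐ[k] A ⊗[k] A := (Algebra.TensorProduct.comm k A A).toAlgHom
  have hleft : τ.comp (includeLeft : A →ₐ[k] A ⊗[k] A) = includeRight := by ext; simp [τ]
  have hright : τ.comp (includeRight : A →ₐ[k] A ⊗[k] A) = includeLeft := by ext; simp [τ]
  have htensor : Units.map (extendh τ).toMonoidHom (tensorSelfUnit x) = tensorSelfUnit x := by
    ext1
    change extendh τ (extendh _ x.1.1 * extendh _ x.1.1) = extendh _ x.1.1 * extendh _ x.1.1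
    rw [map_mul, extendh_comp_apply, extendh_comp_apply, hleft, hright]
    exact (commute_extendh_includeLeft_includeRight _ _).symm.eq
  have hcomul : Units.map (extendh τ).toMonoidHom (comulUnit x) = comulUnit x := by
    ext1
    change extendh τ (extendh _ x.1.1) = extendh _ x.1.1
    rw [extendh_comp_apply]
    congr 2
    ext u
    exact Coalgebra.comm_comul k u
  have hunits : Units.map (extendh τ).toMonoidHom (tensorSelfUnit x * (comulUnit x)⁻¹) =
      tensorSelfUnit x * (comulUnit x)⁻¹ := by
    rw [map_mul, map_inv, htensor, hcomul]
  exact congrArg Units.val hunits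

end ExponentialBoundary

section Associator

variable {k A : Type*} [Field k] [Ring A] [Bialgebra k A]

instance centralUnits_commGroup : CommGroup (centralUnits k A) where
  mul_comm x y := Subtype.ext (Units.ext (Subring.mem_center_iff.1 y.2.1 x.1.1))

theorem gaugeClass_boundary_mul (x : centralUnits k A) (F : invariantTwists k A) :
    ((boundary k A x * F : invariantTwists k A) : GaugeClasses k A) = F := by
  have hx : (boundary k A x : GaugeClasses k A) = 1 :=
    (QuotientGroup.eq_one_iff (boundary k A x)).2 ⟨x, rfl⟩
  rw [QuotientGroup.mk_mul, hx, one_mul]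

theorem exists_eq_boundary_mul {F G : invariantTwists k A} (h : (F : GaugeClasses k A) = G) :
    ∃ x : centralUnits k A, F = boundary k A x * G := by
  obtain ⟨x, hx⟩ := QuotientGroup.eq.1 h.symm
  exact ⟨x, by rw [(boundary_commute x G).eq, hx, mul_inv_cancel_left]⟩

theorem threeCochain_eq_of_cohomologous {G C : Type*} [Semigroup G] [CommGroup C]
    {a a' c : G → G → C} {b : G → C}
    (ha : ∀ f g, a f g * (b f * b g) = c f g * (b (f * g) * a' f g))
    (ha' : ∀ f g l, a' f (g * l) * a' g l = a' (f * g) l * a' f g) (f g l : G) :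
    a f (g * l) * a g l * (a f g)⁻¹ * (a (f * g) l)⁻¹ =
      c g l * (c (f * g) l)⁻¹ * c f (g * l) * (c f g)⁻¹ := by
  have hc (f g : G) : c f g = a f g * (b f * b g) * (b (f * g) * a' f g)⁻¹ :=
    eq_mul_inv_of_mul_eq (ha f g).symm
  have ha'' : a' f (g * l) = a' (f * g) l * a' f g * (a' g l)⁻¹ :=
    eq_mul_inv_of_mul_eq (ha' f g l)
  simp only [hc, mul_assoc f g l, ha'']
  apply Additive.ofMul.injective
  simp only [ofMul_mul, ofMul_inv]
  abel

theorem associatorTrivial_of_choice {σ' : GaugeClasses k A → invariantTwists k A}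
    {a' : GaugeClasses k A → GaugeClasses k A → centralUnits k A}
    (h : IsAssociatorChoice k σ' a')
    (ha' : ∀ f g l, a' f (g * l) * a' g l = a' (f * g) l * a' f g) :
    AssociatorTrivial k A := by
  intro σ a hσ
  choose b hb using fun f =>
    exists_eq_boundary_mul ((hσ.isSection f).trans (h.isSection f).symm)
  have hker (f g) : a f g * (b f * b g) * (b (f * g) * a' f g)⁻¹ ∈ (boundary k A).ker := by
    have hboundary := hσ.boundary_eq f g
    rw [hb, hb, hb, h.boundary_eq] at hboundary
    rw [MonoidHom.mem_ker, map_mul, map_inv, mul_inv_eq_one, ← mul_left_inj (σ' f * σ' g)]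
    simp only [map_mul, mul_assoc] at hboundary ⊢
    rw [hboundary, ← mul_assoc (σ' f) (boundary k A (b g)), ← (boundary_commute (b g) (σ' f)).eq,
      mul_assoc]
  exact ⟨fun f g => ⟨_, hker f g⟩,
    threeCochain_eq_of_cohomologous (fun f g => (inv_mul_cancel_right _ _).symm) ha'⟩

end Associator

/-! ### The twists `exp(hX)` -/

section BivectorTwists

variable {k g : Type*} [Field k] [LieRing g] [LieAlgebra k g]

open Coalgebra (comul counit)
open PowerSeries (coeff constantCoeff)

attribute [local instance 100] LieRing.ofAssociativeRing

theorem commute_comul_envι₂ {X : g ⊗[k] g} (hX : ∀ x : g, ⁅x, X⁆ = 0)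
    (u : UniversalEnvelopingAlgebra k g) : Commute (comul (R := k) u) (envι₂ k g X) := by
  have hu : u ∈ Algebra.adjoin k
      (LinearMap.range (envι k g) : Set (UniversalEnvelopingAlgebra k g)) := by
    rw [adjoin_range_envι]
    exact Algebra.mem_top
  induction hu using Algebra.adjoin_induction with
  | mem u hu =>
    obtain ⟨x, rfl⟩ := hu
    refine sub_eq_zero.1 ?_
    rw [← envι₂_lie, hX, map_zero]
  | algebraMap c =>
    rw [Bialgebra.comul_algebraMap]
    exact Algebra.commutes c _
  | add u v _ _ hu hv => rw [map_add]; exact hu.add_left hv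
  | mul u v _ _ hu hv => rw [Bialgebra.comul_mul]; exact hu.mul_left hv

theorem isCocycle_envι₂ (X : g ⊗[k] g) : IsCocycle (envι₂ k g X) := by
  rw [IsCocycle]
  induction X with
  | zero => simp
  | add X Y hX hY =>
    simp only [map_add]
    rw [add_add_add_comm, hX, hY, add_add_add_comm]
  | tmul x y =>
    rw [TensorProduct.map_tmul, tensorOne_tmul, comulTensor_tmul, oneTensor_apply,
      tensorComul_tmul, comul_envι, comul_envι, TensorProduct.add_tmul, map_add,
      TensorProduct.assoc_tmul, TensorProduct.assoc_tmul, TensorProduct.tmul_add]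
    abel

theorem counitTensor_envι₂ (X : g ⊗[k] g) :
    counitTensor k (UniversalEnvelopingAlgebra k g) (envι₂ k g X) = 0 := by
  induction X with
  | zero => simp
  | add X Y hX hY => rw [map_add, map_add, hX, hY, add_zero]
  | tmul x y => rw [TensorProduct.map_tmul, counitTensor_tmul, counit_envι, zero_smul]

theorem tensorCounit_envι₂ (X : g ⊗[k] g) :
    tensorCounit k (UniversalEnvelopingAlgebra k g) (envι₂ k g X) = 0 := by
  induction X with
  | zero => simp
  | add X Y hX hY => rw [map_add, map_add, hX, hY, add_zero]
  | tmul x y => rw [TensorProduct.map_tmul, tensorCounit_tmul, counit_envι, zero_smul]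

theorem envι₂_mem_invariantCocycles {X : g ⊗[k] g} (hX : ∀ x : g, ⁅x, X⁆ = 0) :
    envι₂ k g X ∈ invariantCocycles k (UniversalEnvelopingAlgebra k g) :=
  ⟨isCocycle_envι₂ X, commute_comul_envι₂ hX, counitTensor_envι₂ X, tensorCounit_envι₂ X⟩

/-- The coefficients of the series `h X`. -/
def shift (X : InvariantBivectorSeries k g) : ℕ → invariantBivectors k g
  | 0 => 0
  | n + 1 => X n

theorem shift_add (X Y : InvariantBivectorSeries k g) : shift (X + Y) = shift X + shift Y := by
  ext (_ | n)
  exacts [(add_zero _).symm, rfl]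

theorem coeff_hMul (X : InvariantBivectorSeries k g) (n : ℕ) :
    coeff n (hMul X) = envι₂ k g (shift X n) := by
  cases n with
  | zero => simp [hMul, shift]
  | succ n => rw [hMul, PowerSeries.coeff_succ_X_mul, PowerSeries.coeff_mk, shift]

theorem constantCoeff_hMul (X : InvariantBivectorSeries k g) : constantCoeff (hMul X) = 0 := by
  rw [hMul, map_mul, PowerSeries.constantCoeff_X, zero_mul]

theorem hMul_add (X Y : InvariantBivectorSeries k g) : hMul (X + Y) = hMul X + hMul Y := by
  ext n
  rw [map_add, coeff_hMul, coeff_hMul, coeff_hMul, shift_add, Pi.add_apply, Submodule.coe_add,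
    map_add]

theorem coeff_hMul_mem_invariantCocycles (X : InvariantBivectorSeries k g) (n : ℕ) :
    coeff n (hMul X) ∈ invariantCocycles k (UniversalEnvelopingAlgebra k g) := by
  rw [coeff_hMul]
  exact envι₂_mem_invariantCocycles (mem_invariantBivectors.1 (shift X n).2).1

theorem commute_coboundaryh_hMul {s : PowerSeries (UniversalEnvelopingAlgebra k g)}
    (hs : s ∈ centralSeries k (UniversalEnvelopingAlgebra k g))
    (X : InvariantBivectorSeries k g) : Commute (coboundaryh k s) (hMul X) :=
  commute_coboundaryh hs
    (commute_comulh (fun n => (coeff_hMul_mem_invariantCocycles X n).invariant) s)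

theorem extendh_comm_hMul (X : InvariantBivectorSeries k g) :
    extendh (Algebra.TensorProduct.comm k (UniversalEnvelopingAlgebra k g)
      (UniversalEnvelopingAlgebra k g)).toAlgHom (hMul X) = -hMul X := by
  ext n
  rw [PowerSeries.coeff_map, map_neg, coeff_hMul]
  change TensorProduct.comm k _ _ (envι₂ k g (shift X n)) = _
  rw [← TensorProduct.map_comm, (mem_invariantBivectors.1 (shift X n).2).2, map_neg]

/-- The central series whose coboundary is the commutator of `hX` and `hY`. -/
def cubicSeries (X Y : InvariantBivectorSeries k g) :
    centralSeries k (UniversalEnvelopingAlgebra k g) :=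
  ⟨PowerSeries.mk fun n => ∑ p ∈ Finset.HasAntidiagonal.antidiagonal n,
      cubic k g (shift X p.1) (shift Y p.2), by
    rw [← PowerSeries.coeff_zero_eq_constantCoeff_apply]
    simp [shift], fun n => by
    rw [PowerSeries.coeff_mk]
    exact Submodule.sum_mem _ fun p _ =>
      cubic_mem_centralAugmentation (shift X p.1).2 (shift Y p.2).2⟩

theorem cubicSeries_add_left (X X' Y : InvariantBivectorSeries k g) :
    cubicSeries (X + X') Y = cubicSeries X Y + cubicSeries X' Y := by
  ext n
  simp [cubicSeries, shift_add, Finset.sum_add_distrib]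

theorem cubicSeries_add_right (X Y Y' : InvariantBivectorSeries k g) :
    cubicSeries X (Y + Y') = cubicSeries X Y + cubicSeries X Y' := by
  ext n
  simp [cubicSeries, shift_add, Finset.sum_add_distrib]

variable [CharZero k]

/-- The invariant twist `exp(hX)`. -/
def bivectorTwist (X : InvariantBivectorSeries k g) :
    invariantTwists k (UniversalEnvelopingAlgebra k g) :=
  exphTwist (constantCoeff_hMul X) (coeff_hMul_mem_invariantCocycles X)

theorem coe_bivectorTwist (X : InvariantBivectorSeries k g) :
    (bivectorTwist X).1.1 = exph k (hMul X) := rfl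

theorem boundary_expCentral_mul_bivectorTwist
    (s : centralSeries k (UniversalEnvelopingAlgebra k g)) (X : InvariantBivectorSeries k g) :
    (boundary k _ (expCentral k _ (Multiplicative.ofAdd s)) * bivectorTwist X).1.1 =
      exph k (coboundaryh k s.1 + hMul X) := by
  rw [exph_add (constantCoeff_coboundaryh s.2.1) (constantCoeff_hMul X)
    (commute_coboundaryh_hMul s.2 X), ← boundary_expCentral]
  rfl

theorem coboundaryh_cubicSeries (X Y : InvariantBivectorSeries k g) :
    coboundaryh k (cubicSeries X Y).1 = hMul X * hMul Y - hMul Y * hMul X := by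
  ext n
  rw [coeff_coboundaryh, cubicSeries, PowerSeries.coeff_mk, map_sub, PowerSeries.coeff_mul,
    PowerSeries.coeff_mul, ← Finset.Nat.sum_antidiagonal_swap (n := n)
      (f := fun p => coeff p.1 (hMul Y) * coeff p.2 (hMul X)),
    ← Finset.sum_sub_distrib, map_sum]
  refine Finset.sum_congr rfl fun p _ => ?_
  simp only [coeff_hMul, Prod.fst_swap, Prod.snd_swap]
  exact coboundary_cubic (shift X p.1).2 (shift Y p.2).2

-- The commutator of `hX` and `hY` is the coboundary of a central series, hence commutes with both,
-- and the Campbell-Hausdorff series of `hX` and `hY` stops after its quadratic term.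
theorem bivectorTwist_mul (X Y : InvariantBivectorSeries k g) :
    bivectorTwist X * bivectorTwist Y =
      boundary k _ (expCentral k _ (Multiplicative.ofAdd ((2 : k)⁻¹ • cubicSeries X Y))) *
        bivectorTwist (X + Y) := by
  have hcomm (Z : InvariantBivectorSeries k g) :
      Commute (hMul X * hMul Y - hMul Y * hMul X) (hMul Z) := by
    rw [← coboundaryh_cubicSeries]
    exact commute_coboundaryh_hMul (cubicSeries X Y).2 Z
  refine Subtype.ext (Units.ext ?_)
  rw [boundary_expCentral_mul_bivectorTwist, Submodule.coe_smul, coboundaryh_smul,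
    coboundaryh_cubicSeries, hMul_add, add_comm]
  exact exph_mul_exph (constantCoeff_hMul X) (constantCoeff_hMul Y) (hcomm X) (hcomm Y)

/-- The central element which measures the failure of `X ↦ exp(hX)` to be multiplicative. -/
def bivectorCochain (X Y : InvariantBivectorSeries k g) :
    centralUnits k (UniversalEnvelopingAlgebra k g) :=
  expCentral k _ (Multiplicative.ofAdd (-((2 : k)⁻¹ • cubicSeries X Y)))

theorem bivectorTwist_add (X Y : InvariantBivectorSeries k g) :
    bivectorTwist (X + Y) =
      boundary k _ (bivectorCochain X Y) * bivectorTwist X * bivectorTwist Y := by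
  rw [mul_assoc, bivectorTwist_mul, bivectorCochain, ofAdd_neg, map_inv, map_inv,
    inv_mul_cancel_left]

theorem bivectorCochain_cocycle (X Y Z : InvariantBivectorSeries k g) :
    bivectorCochain X (Y + Z) * bivectorCochain Y Z =
      bivectorCochain (X + Y) Z * bivectorCochain X Y := by
  simp only [bivectorCochain, ← map_mul, ← ofAdd_add, cubicSeries_add_left, cubicSeries_add_right]
  refine congrArg (fun s => expCentral k _ (Multiplicative.ofAdd s)) ?_
  generalize cubicSeries X Y = a, cubicSeries X Z = b, cubicSeries Y Z = c
  module

variable (k g) in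
/-- The homomorphism that sends `X` to the gauge class of `exp(hX)`. -/
def bivectorClass : Multiplicative (InvariantBivectorSeries k g) →*
    GaugeClasses k (UniversalEnvelopingAlgebra k g) :=
  MonoidHom.mk' (fun X => bivectorTwist X.toAdd) fun X Y => by
    rw [toAdd_mul, bivectorTwist_add, mul_assoc, gaugeClass_boundary_mul, QuotientGroup.mk_mul]

-- Boundaries are symmetric, whereas the flip sends `exp(hX)` to `exp(-hX)`.
theorem bivectorClass_injective : Function.Injective (bivectorClass k g) := by
  rw [injective_iff_map_eq_one]
  intro X hX
  obtain ⟨c, hc⟩ := (QuotientGroup.eq_one_iff (bivectorTwist X.toAdd)).1 hX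
  have hflip := extendh_comm_boundary c
  rw [hc, coe_bivectorTwist, extendh_exph, extendh_comm_hMul] at hflip
  have hneg : -hMul X.toAdd = hMul X.toAdd :=
    exph_injOn (k := k) (by simp [constantCoeff_hMul]) (constantCoeff_hMul X.toAdd) hflip
  refine Multiplicative.toAdd.injective (funext fun n => Subtype.ext (envι₂_injective k g ?_))
  have hcoeff : -envι₂ k g (X.toAdd n) = envι₂ k g (X.toAdd n) := by
    simpa only [map_neg, coeff_hMul, shift] using congrArg (coeff (n + 1)) hneg
  have htwo : (2 : k) • envι₂ k g (X.toAdd n) = 0 := by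
    rw [two_smul, ← eq_neg_iff_add_eq_zero, hcoeff]
  exact ((smul_eq_zero.1 htwo).resolve_left two_ne_zero).trans (map_zero _).symm

-- The units of `U(g) ⊗ U(g)` are scalars.
theorem constantCoeff_eq_one_of_isInvariantTwist
    {F : (PowerSeries (UniversalEnvelopingAlgebra k g ⊗[k] UniversalEnvelopingAlgebra k g))ˣ}
    (hF : IsInvariantTwist k F) : constantCoeff F.1 = 1 := by
  have hunit : constantCoeff F.1 * constantCoeff (F⁻¹).1 = 1 := by
    rw [← map_mul, Units.mul_inv, map_one]
  obtain ⟨c, hc⟩ :=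
    (isPrimitivelyGenerated_range_envι k g).tensorSup.exists_smul_one_of_mul_eq_one hunit
  have hcounit := congrArg constantCoeff hF.counit_left
  rw [constantCoeff_extendh, ← hc, map_smul, map_one, map_one] at hcounit
  have hc1 := congrArg (counit (R := k)) hcounit
  rw [map_smul, Bialgebra.counit_one, smul_eq_mul, mul_one] at hc1
  rw [← hc, hc1, one_smul]

theorem exists_coboundaryh_add_hMul_eq
    {Y : PowerSeries (UniversalEnvelopingAlgebra k g ⊗[k] UniversalEnvelopingAlgebra k g)}
    (hY : constantCoeff Y = 0)
    (hmem : ∀ n, coeff n Y ∈ invariantCocycles k (UniversalEnvelopingAlgebra k g)) :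
    ∃ (s : centralSeries k (UniversalEnvelopingAlgebra k g)) (X : InvariantBivectorSeries k g),
      coboundaryh k s.1 + hMul X = Y := by
  choose X hX a ha hXa using fun n => exists_envι₂_add_coboundary_eq (hmem (n + 1))
  refine ⟨⟨PowerSeries.X * PowerSeries.mk a, by simp, ?_⟩, fun n => ⟨X n, hX n⟩, ?_⟩
  · rintro (_ | n)
    · simp
    · rw [PowerSeries.coeff_succ_X_mul, PowerSeries.coeff_mk]
      exact ha n
  · ext (_ | n)
    · rw [PowerSeries.coeff_zero_eq_constantCoeff_apply, map_add,
        constantCoeff_coboundaryh (by simp), constantCoeff_hMul, add_zero,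
        PowerSeries.coeff_zero_eq_constantCoeff_apply, hY]
    · rw [map_add, coeff_coboundaryh, coeff_hMul, PowerSeries.coeff_succ_X_mul,
        PowerSeries.coeff_mk, shift, add_comm, hXa]

theorem bivectorClass_surjective : Function.Surjective (bivectorClass k g) := by
  intro f
  obtain ⟨F, rfl⟩ := QuotientGroup.mk_surjective f
  obtain ⟨Y, hY, hYF⟩ := exists_exph_eq (k := k) (constantCoeff_eq_one_of_isInvariantTwist F.2)
  obtain ⟨s, X, rfl⟩ :=
    exists_coboundaryh_add_hMul_eq hY (F.2.coeff_log_mem_invariantCocycles hY hYF)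
  have hF : boundary k _ (expCentral k _ (Multiplicative.ofAdd s)) * bivectorTwist X = F :=
    Subtype.ext (Units.ext ((boundary_expCentral_mul_bivectorTwist s X).trans hYF))
  refine ⟨Multiplicative.ofAdd X, ?_⟩
  rw [← hF, gaugeClass_boundary_mul]
  rfl

variable (k g) in
/-- The isomorphism from `(Λ²g)^g[[h]]` to the group of gauge classes. -/
def bivectorEquiv : Multiplicative (InvariantBivectorSeries k g) ≃*
    GaugeClasses k (UniversalEnvelopingAlgebra k g) :=
  MulEquiv.ofBijective (bivectorClass k g) ⟨bivectorClass_injective, bivectorClass_surjective⟩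

variable (k g) in
theorem associatorTrivial_env : AssociatorTrivial k (UniversalEnvelopingAlgebra k g) := by
  let e := bivectorEquiv k g
  refine associatorTrivial_of_choice (σ' := fun f => bivectorTwist (e.symm f).toAdd)
    (a' := fun f f' => bivectorCochain (e.symm f).toAdd (e.symm f').toAdd) ⟨?_, ?_⟩ ?_
  · exact e.apply_symm_apply
  · intro f f'
    rw [map_mul, toAdd_mul, bivectorTwist_add]
  · intro f f' l
    rw [map_mul e.symm, map_mul e.symm, toAdd_mul, toAdd_mul, bivectorCochain_cocycle]

end BivectorTwists

end InvTwist

end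

theorem mainTheorem2_general {k g : Type*} [Field k] [CharZero k] [LieRing g] [LieAlgebra k g] :
    (∃ e : Multiplicative (InvTwist.InvariantBivectorSeries k g) ≃*
        InvTwist.GaugeClasses k (UniversalEnvelopingAlgebra k g),
      ∀ X : InvTwist.InvariantBivectorSeries k g,
        ∃ F : InvTwist.invariantTwists k (UniversalEnvelopingAlgebra k g),
          ((F : (PowerSeries (UniversalEnvelopingAlgebra k g ⊗[k]
              UniversalEnvelopingAlgebra k g))ˣ) :
            PowerSeries (UniversalEnvelopingAlgebra k g ⊗[k] UniversalEnvelopingAlgebra k g)) =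
              InvTwist.exph k (InvTwist.hMul X) ∧
          e (Multiplicative.ofAdd X) =
            (F : InvTwist.GaugeClasses k (UniversalEnvelopingAlgebra k g))) ∧
    InvTwist.AssociatorTrivial k (UniversalEnvelopingAlgebra k g) :=
  ⟨⟨InvTwist.bivectorEquiv k g, fun X => ⟨InvTwist.bivectorTwist X, rfl, rfl⟩⟩,
    InvTwist.associatorTrivial_env k g⟩

theorem mainTheorem2 {k g : Type*} [Field k] [IsAlgClosed k] [CharZero k]
    [LieRing g] [LieAlgebra k g] :
    (∃ e : Multiplicative (InvTwist.InvariantBivectorSeries k g) ≃*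
        InvTwist.GaugeClasses k (UniversalEnvelopingAlgebra k g),
      ∀ X : InvTwist.InvariantBivectorSeries k g,
        ∃ F : InvTwist.invariantTwists k (UniversalEnvelopingAlgebra k g),
          ((F : (PowerSeries (UniversalEnvelopingAlgebra k g ⊗[k]
              UniversalEnvelopingAlgebra k g))ˣ) :
            PowerSeries (UniversalEnvelopingAlgebra k g ⊗[k] UniversalEnvelopingAlgebra k g)) =
              InvTwist.exph k (InvTwist.hMul X) ∧
          e (Multiplicative.ofAdd X) =
            (F : InvTwist.GaugeClasses k (UniversalEnvelopingAlgebra k g))) ∧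
    InvTwist.AssociatorTrivial k (UniversalEnvelopingAlgebra k g) :=
  mainTheorem2_general
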